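/- Let $n,k\ge 1$. Let $M$ be a compact oriented smooth manifold of dimension $2n$ without boundary, $x\in C^\infty(M)$ a function with regular value $0$, and $Z=x^{-1}(0)$, oriented so that $(v_1,\dots,v_{2n-1})$ is positive on $Z$ if and only if $(u,v_1,\dots,v_{2n-1})$ is positive on $M$ for $dx(u)>0$. Let $\omega$ be a $b^{2k}$-symplectic form on $(M,Z,x)$, i.e. a closed form $\omega=\frac{dx}{x^{2k}}\wedge\alpha+\beta'$ (with $\alpha,\beta'$ smooth on $M$) which has maximal rank at every point as a form on the $b^{2k}$-tangent bundle. Let $U\supset Z$ be a tubular neighbourhood, with a diffeomorphism $(\pi,x):U\to Z\times(-r,r)$, $r>0$, $\pi|_Z=\mathrm{id}$, and let $$\omega=\frac{dx}{x^{2k}}\wedge\sum_{i=0}^{2k-1}x^i\,\pi^*\alpha_i+\beta\qquad\text{on }U\setminus Z$$ be a Laurent series of $\omega$, where the $\alpha_i$ are closed smooth $1$-forms on $Z$ and $\beta$ is a smooth $2$-form on $U$. Write $\beta=dx\wedge\gamma+\sum_{j=0}^{2k-1}x^j\,\pi^*\beta_j+O(x^{2k})$ with $2$-forms $\beta_j$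 on $Z$. Let $f\in C^\infty(\mathbb R)$ be odd with $f'>0$ on $[-1,1]$, $f(t)=\frac{-1}{(2k-1)t^{2k-1}}-2$ for $t<-1$ and $f(t)=\frac{-1}{(2k-1)t^{2k-1}}+2$ for $t>1$; put $f_\epsilon(t)=\epsilon^{-(2k-1)}f(t/\epsilon)$, and let $\omega_\epsilon$ be the desingularized form, equal to $d(f_\epsilon\circ x)\wedge\sum_{i}x^i\pi^*\alpha_i+\beta$ on $U$ and to $\omega$ on $M\setminus U$. Put $U_\epsilon=\{p\in U:|x(p)|<\epsilon\}$. Then, as $\epsilon\to0^+$, $$\int_{M\setminus U_\epsilon}\omega^n=\sum_{i=1}^k c_i\,\epsilon^{-(2i-1)}+O(1),\qquad \int_{U_\epsilon}\omega_\epsilon^n=\sum_{i=1}^k a_i\,\epsilon^{-(2i-1)}+O(1),$$ and $$\int_M\omega_\epsilon^n=\sum_{i=1}^k(a_i+c_i)\,\epsilon^{-(2i-1)}+O(1),$$ where the $a_i$ and $c_i$ are linear combinations of the integrals $$\int_Z\alpha_{j_1}\wedge\beta_{j_2}\wedge\dots\wedge\beta_{j_n},\qquad 0\le j_1,\dots,j_n\le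 2k-1 .$$ The coefficients of these linear combinations depend only on $n,k,i$ and $j_1,\dots,j_n$ for $c_i$, and in addition on $f$ for $a_i$; they do not depend on $M,Z,x,\omega$ or the Laurent series. -/

import Mathlib

open scoped Manifold ContDiff Topology
open Set MeasureTheory

noncomputable section

namespace BSymplectic

/-! ### Exterior algebra -/

section Algebra

variable {V : Type*} [AddCommGroup V] [Module ℝ V] [TopologicalSpace V]

/-- The exterior product of real alternating forms (sum over shuffles, so that
`(a ∧ b)(v, w) = a v * b w - a w * b v` for linear forms `a`, `b`). -/
def wedge {p q : ℕ} (a : V [⋀^Fin p]→L[ℝ] ℝ) (b : V [⋀^Fin q]→L[ℝ] ℝ) :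
    V [⋀^Fin (p + q)]→L[ℝ] ℝ :=
  { ((LinearMap.mul' ℝ ℝ).compAlternatingMap
      (a.toAlternatingMap.domCoprod b.toAlternatingMap)).domDomCongr finSumFinEquiv with
    cont := by
      change Continuous fun v : Fin (p + q) → V => LinearMap.mul' ℝ ℝ
        ((∑ σ : Equiv.Perm.ModSumCongr (Fin p) (Fin q),
          AlternatingMap.domCoprod.summand a.toAlternatingMap b.toAlternatingMap σ)
            fun i => v (finSumFinEquiv i))
      simp only [sum_apply, map_sum]
      refine continuous_finsetSum _ fun σ _ => ?_
      induction σ using Quotient.inductionOn' with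
      | h σ =>
        have ha := a.cont
        have hb := b.cont
        rw [AlternatingMap.domCoprod.summand_mk'']
        rcases Int.units_eq_one_or (Equiv.Perm.sign σ) with h | h <;>
        · simp only [h, one_smul, Units.neg_smul, neg_apply, map_neg]
          first
          | refine (ha.comp (f := fun v : Fin (p + q) → V =>
                fun i => v (finSumFinEquiv (σ (Sum.inl i)))) (by fun_prop)).mul
              (hb.comp (f := fun v : Fin (p + q) → V =>
                fun i => v (finSumFinEquiv (σ (Sum.inr i)))) (by fun_prop))
          | refine ((ha.comp (f := fun v : Fin (p + q) → V =>
                fun i => v (finSumFinEquiv (σ (Sum.inl i)))) (by fun_prop)).mul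
              (hb.comp (f := fun v : Fin (p + q) → V =>
                fun i => v (finSumFinEquiv (σ (Sum.inr i)))) (by fun_prop))).neg }

/-- The exterior product `b 0 ∧ b 1 ∧ ⋯ ∧ b (m - 1)` of a family of 2-forms; it is the constant `1`
for `m = 0`. -/
def wedgeFamily : (m : ℕ) → (Fin m → V [⋀^Fin 2]→L[ℝ] ℝ) → V [⋀^Fin (2 * m)]→L[ℝ] ℝ
  | 0, _ => ContinuousAlternatingMap.constOfIsEmpty ℝ V (Fin 0) 1
  | m + 1, b => wedge (wedgeFamily m fun i => b i.castSucc) (b (Fin.last m))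

/-- The exterior power `w ∧ ⋯ ∧ w` (`m` factors) of a 2-form. -/
def wedgePow (m : ℕ) (w : V [⋀^Fin 2]→L[ℝ] ℝ) : V [⋀^Fin (2 * m)]→L[ℝ] ℝ :=
  wedgeFamily m fun _ => w

/-- A linear functional regarded as a 1-form. -/
def toOneForm (l : V →L[ℝ] ℝ) : V [⋀^Fin 1]→L[ℝ] ℝ :=
  ContinuousAlternatingMap.ofSubsingleton ℝ V ℝ 0 l

end Algebra

/-! ### Differential forms on manifolds without boundary -/

/-- The model space `ℝ^d`. -/
abbrev Euc (d : ℕ) : Type := EuclideanSpace ℝ (Fin d)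

/-- A (not necessarily smooth) differential `q`-form on a `d`-dimensional manifold. -/
abbrev DForm (d : ℕ) (M : Type*) [TopologicalSpace M] [ChartedSpace (Euc d) M] (q : ℕ) :=
  (p : M) → TangentSpace (𝓡 d) p [⋀^Fin q]→L[ℝ] ℝ

section Forms

variable {d d' q : ℕ} {M : Type*} [TopologicalSpace M] [ChartedSpace (Euc d) M]
  {N : Type*} [TopologicalSpace N] [ChartedSpace (Euc d') N]

/-- The pullback `φ^* η`. -/
def pullback (φ : N → M) (η : DForm d M q) : DForm d' N q := fun z =>
  (η (φ z)).compContinuousLinearMap (mfderiv (𝓡 d') (𝓡 d) φ z)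

/-- The coordinate expression of `η` in the chart at `c`: a form on (an open subset of) `ℝ^d`. -/
def inChart (η : DForm d M q) (c : M) (y : Euc d) : Euc d [⋀^Fin q]→L[ℝ] ℝ :=
  (η ((extChartAt (𝓡 d) c).symm y)).compContinuousLinearMap
    (mfderiv 𝓘(ℝ, Euc d) (𝓡 d) (extChartAt (𝓡 d) c).symm y)

/-- The part of the range of the chart at `c` which corresponds to `S`. -/
def chartPart (d : ℕ) {M : Type*} [TopologicalSpace M] [ChartedSpace (Euc d) M]
    (S : Set M) (c : M) : Set (Euc d) :=
  (extChartAt (𝓡 d) c).target ∩ (extChartAt (𝓡 d) c).symm ⁻¹' S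

/-- `η` is smooth on the open set `U`. -/
def IsSmoothOn (η : DForm d M q) (U : Set M) : Prop :=
  ∀ c : M, ContDiffOn ℝ ∞ (inChart η c) (chartPart d U c)

/-- `η` is closed (`dη = 0`) on the open set `U`. -/
def IsClosedOn (η : DForm d M q) (U : Set M) : Prop :=
  ∀ c : M, ∀ y ∈ chartPart d U c, extDeriv (inChart η c) y = 0

/-- The 1-form `dg` of a real function `g`. -/
def dFun (d : ℕ) {M : Type*} [TopologicalSpace M] [ChartedSpace (Euc d) M] (g : M → ℝ) :
    DForm d M 1 := fun p =>
  toOneForm ((NormedSpace.fromTangentSpace (𝕜 := ℝ) (g p)).toContinuousLinearMap.comp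
    (mfderiv (𝓡 d) 𝓘(ℝ) g p))

/-- A volume form: a nowhere vanishing smooth form of top degree. It represents the orientation
in which it is positive. -/
structure IsVolumeForm (μ : DForm d M d) : Prop where
  smooth : IsSmoothOn μ univ
  ne_zero : ∀ p, μ p ≠ 0

/-- A chosen smooth partition of unity subordinate to the domains of the charts `chartAt c`. -/
def chartPartition (d : ℕ) (M : Type*) [TopologicalSpace M] [ChartedSpace (Euc d) M]
    [IsManifold (𝓡 d) ∞ M] [T2Space M] [SigmaCompactSpace M] :
    SmoothPartitionOfUnity M (𝓡 d) M univ :=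
  (SmoothPartitionOfUnity.exists_isSubordinate_chartAt_source (𝓡 d) M).choose

/-- The integral `∫_S η` of a top degree form `η` over a subset `S` of a manifold with the
orientation represented by `μ`:
`∑_c ∫ ρ_c η(∂_1, …, ∂_d) dy_1 ⋯ dy_d`, where `ρ` is a partition of unity subordinate to the charts
and the integral over the chart at `c` has the sign of `μ(∂_1, …, ∂_d)`. -/
def integralOn [IsManifold (𝓡 d) ∞ M] [T2Space M] [SigmaCompactSpace M]
    (μ : DForm d M d) (S : Set M) (hq : q = d) (η : DForm d M q) : ℝ :=
  ∑ᶠ c : M, ∫ y in chartPart d S c,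
    chartPartition d M c ((extChartAt (𝓡 d) c).symm y) *
      ((SignType.sign (inChart μ c y fun i => EuclideanSpace.single i 1) : ℝ) *
        inChart η c y fun i => EuclideanSpace.single (Fin.cast hq i) 1)

end Forms

/-! ### `b^m`-symplectic manifolds, Laurent series and desingularization -/

section BM

variable {d : ℕ} {M : Type*} [TopologicalSpace M] [ChartedSpace (Euc (d + 1)) M]
  {Z : Type*} [TopologicalSpace Z] [ChartedSpace (Euc d) Z]

/-- The defining data of a `b^m`-manifold `(M, Z, x)`: `x` is a smooth function on `M` for which `0`
is a regular value, and `ι` identifies the manifold `Z` with the hypersurface `x⁻¹(0)`. -/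
structure IsBManifold (x : M → ℝ) (ι : Z → M) : Prop where
  smooth : ContMDiff (𝓡 (d + 1)) 𝓘(ℝ) ∞ x
  regular : ∀ p, x p = 0 → mfderiv (𝓡 (d + 1)) 𝓘(ℝ) x p ≠ 0
  embedding : Manifold.IsSmoothEmbedding (𝓡 d) (𝓡 (d + 1)) ∞ ι
  range_eq : range ι = {p | x p = 0}

/-- `σ` is a symplectic `b^m`-form on `(M, x⁻¹(0))`: it is `x^{-m} dx ∧ α + β` with smooth forms `α`,
`β` on `M`, it is closed, and it has maximal rank at every point. The values of `σ` at points of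
`Z = x⁻¹(0)` play no role. At such a point the fibre of the `b^m`-tangent bundle is
`ker dx ⊕ ℝ e` with `e = x^m ∂_x`, and the bilinear form on it is
`(v + s e, w + t e) ↦ β(v, w) + s α(w) - t α(v)`. -/
def IsBSymplecticForm (m : ℕ) (x : M → ℝ) (σ : DForm (d + 1) M 2) : Prop :=
  IsClosedOn σ {p | x p ≠ 0} ∧
  (∀ p, x p ≠ 0 → ∀ v, (∀ w, σ p ![v, w] = 0) → v = 0) ∧
  ∃ (α : DForm (d + 1) M 1) (β : DForm (d + 1) M 2),
    IsSmoothOn α univ ∧ IsSmoothOn β univ ∧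
    (∀ p, x p ≠ 0 → σ p = ((x p) ^ m)⁻¹ • wedge (dFun (d + 1) x p) (α p) + β p) ∧
    (∀ p, x p = 0 → ∀ v, dFun (d + 1) x p ![v] = 0 → ∀ s : ℝ,
      α p ![v] = 0 → (∀ w, dFun (d + 1) x p ![w] = 0 → β p ![v, w] + s * α p ![w] = 0) →
      v = 0 ∧ s = 0)

/-- A tubular neighbourhood `U = T.source` of `Z`: a diffeomorphism `T = (π, x) : U → Z × (-r, r)`
of an open set `U`, whose second component is the defining function `x`, and for which
`π : U → Z` restricts to the identity of `Z`. -/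
structure IsTube (x : M → ℝ) (ι : Z → M) (r : ℝ) (T : OpenPartialHomeomorph M (Z × ℝ)) : Prop where
  pos : 0 < r
  target_eq : T.target = univ ×ˢ Ioo (-r) r
  smooth : ContMDiffOn (𝓡 (d + 1)) ((𝓡 d).prod 𝓘(ℝ)) ∞ T T.source
  smooth_symm : ContMDiffOn ((𝓡 d).prod 𝓘(ℝ)) (𝓡 (d + 1)) ∞ T.symm T.target
  snd_eq : ∀ p ∈ T.source, (T p).2 = x p
  zero_section : ∀ z, T.symm (z, 0) = ι z

/-- The projection `π` of a tubular neighbourhood. -/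
def tubeProj (T : OpenPartialHomeomorph M (Z × ℝ)) (p : M) : Z := (T p).1

/-- The part `U_ε = Z × (-ε, ε)` of a tubular neighbourhood `U`. -/
def subTube (x : M → ℝ) (T : OpenPartialHomeomorph M (Z × ℝ)) (ε : ℝ) : Set M :=
  {p | p ∈ T.source ∧ |x p| < ε}

/-- The form `∑_i x^i π^* α_i`. -/
def laurentSum {m : ℕ} (x : M → ℝ) (T : OpenPartialHomeomorph M (Z × ℝ))
    (α : Fin m → DForm d Z 1) : DForm (d + 1) M 1 := fun p =>
  ∑ i : Fin m, (x p) ^ (i : ℕ) • pullback (tubeProj T) (α i) p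

/-- `σ = x^{-m} dx ∧ ∑_{i < m} x^i π^* α_i + β` is a Laurent series of `σ` on the tubular
neighbourhood `U = T.source`: the `α_i` are closed smooth 1-forms on `Z` and `β` is a smooth form
on `U`. -/
structure IsLaurentDecomposition {m : ℕ} (x : M → ℝ) (T : OpenPartialHomeomorph M (Z × ℝ))
    (σ : DForm (d + 1) M 2) (α : Fin m → DForm d Z 1) (β : DForm (d + 1) M 2) : Prop where
  smooth_α : ∀ i, IsSmoothOn (α i) univ
  closed_α : ∀ i, IsClosedOn (α i) univ
  smooth_β : IsSmoothOn β T.source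
  eq : ∀ p ∈ T.source, x p ≠ 0 →
    σ p = ((x p) ^ m)⁻¹ • wedge (dFun (d + 1) x p) (laurentSum x T α p) + β p

/-- The coefficients `β_j` of the expansion `β = dx ∧ γ + ∑_j x^j π^* β_j + O(x^N)` along `Z`:
the Taylor coefficients at `t = 0` of the restrictions of `β` to the slices `Z × {t}`. -/
def taylorCoeff (T : OpenPartialHomeomorph M (Z × ℝ)) (β : DForm (d + 1) M 2) (j : ℕ) :
    DForm d Z 2 := fun z =>
  let g : ℝ → (Euc d [⋀^Fin 2]→L[ℝ] ℝ) := fun t => pullback (fun z' : Z => T.symm (z', t)) β z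
  (j.factorial : ℝ)⁻¹ • iteratedDeriv j g 0

/-- The functions `f` used in the desingularization of `b^{2k}`-symplectic forms. -/
structure IsProfile (k : ℕ) (f : ℝ → ℝ) : Prop where
  smooth : ContDiff ℝ ∞ f
  odd : ∀ t, f (-t) = -f t
  deriv_pos : ∀ t ∈ Icc (-1 : ℝ) 1, 0 < deriv f t
  left : ∀ t < -1, f t = -1 / ((2 * k - 1) * t ^ (2 * k - 1)) - 2
  right : ∀ t > 1, f t = -1 / ((2 * k - 1) * t ^ (2 * k - 1)) + 2

/-- `f_ε(t) = ε^{-(2k-1)} f(t/ε)`. -/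
def scaled (k : ℕ) (f : ℝ → ℝ) (ε t : ℝ) : ℝ := 1 / ε ^ (2 * k - 1) * f (t / ε)

open Classical in
/-- The `f_ε`-desingularization of `σ`: `σ_ε = df_ε(x) ∧ ∑_i x^i π^* α_i + β` on the tubular
neighbourhood, `σ_ε = σ` elsewhere. -/
def desingularization (k : ℕ) (f : ℝ → ℝ) (x : M → ℝ) (T : OpenPartialHomeomorph M (Z × ℝ))
    (σ : DForm (d + 1) M 2) (α : Fin (2 * k) → DForm d Z 1) (β : DForm (d + 1) M 2) (ε : ℝ) :
    DForm (d + 1) M 2 := fun p =>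
  if p ∈ T.source then
    wedge (dFun (d + 1) (fun p' => scaled k f ε (x p')) p) (laurentSum x T α p) + β p
  else σ p

/-- The orientation `ν` of `Z` is the one induced by the orientation `μ` of `M` and the coorientation
`dx`: `(v_1, …, v_d)` is positive if and only if `(u, v_1, …, v_d)` is, where `dx(u) > 0`. -/
def IsInducedOrientation (x : M → ℝ) (ι : Z → M) (μ : DForm (d + 1) M (d + 1))
    (ν : DForm d Z d) : Prop :=
  ∀ (z : Z) (u : TangentSpace (𝓡 (d + 1)) (ι z)), 0 < dFun (d + 1) x (ι z) ![u] →
    ∀ v : Fin d → TangentSpace (𝓡 d) z,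
      (0 < ν z v ↔ 0 < μ (ι z) (Fin.cons u fun i => mfderiv (𝓡 d) (𝓡 (d + 1)) ι z (v i)))

/-- The integral `∫_Z α_{j₁} ∧ β_{j₂} ∧ ⋯ ∧ β_{jₙ}`, where `j = j₁` and `J = (j₂, …, jₙ)`. -/
def laurentIntegral [IsManifold (𝓡 d) ∞ Z] [T2Space Z] [SigmaCompactSpace Z] {n m : ℕ}
    (hd : d + 1 = 2 * n) (ν : DForm d Z d) (T : OpenPartialHomeomorph M (Z × ℝ))
    (α : Fin m → DForm d Z 1) (β : DForm (d + 1) M 2) (j : Fin m) (J : Fin (n - 1) → Fin m) : ℝ :=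
  integralOn ν univ (by omega : 1 + 2 * (n - 1) = d) fun z =>
    wedge (α j z) (wedgeFamily (n - 1) fun l => taylorCoeff T β (J l) z)

end BM

end BSymplectic

end

open BSymplectic

/-! On the tube both forms have the shape `s(x) dx ∧ α + β` with `α = ∑ x^i π^*α_i`: the symplectic
form with `s(t) = t^{-2k}`, the desingularized one with `s = f_ε'`. Since `dx ∧ dx = 0`, the `n`-th
power is `n s(x) dx ∧ α ∧ β^{n-1} + β^n` (`wedgePow_smul_wedge_add_apply`), and `β^n` contributes a
bounded amount. On the slice `Z × {t}` the form `α ∧ β^{n-1}` equals `∑ t^{j + |J|} α_j ∧ β_J` up to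
`O(t^{2k})`, where `|J|` is the sum of the entries of `J` and `β_J` is the product of the `β_{J l}`
(`exists_wedgeSum_taylor_bound`). In both cases `|s(t)| |t|^{2k}` is bounded uniformly in `ε` on the
range of integration, so this error also contributes `O(1)`. By Fubini, what remains is `n ∑ (∫_Z
α_j ∧ β_J) ∫ s(t) t^{j + |J|} dt` (`IsTube.exists_integralOn_bound`).

The geometry is thereby reduced to integrals over the line. For odd `m` the integrals of `s(t) t^m`
vanish, because `s` is even. For `m = 2(k - i)` with `1 ≤ i ≤ k`, the integral of `t^{m-2k}` over `ε
≤ |t| < ε₀` is `2/(2i-1) ε^{-(2i-1)}` plus a constant (`exists_shell_bound`), while that of `f_ε'(t)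
t^m` over `|t| < ε` is exactly `ε^{-(2i-1)} ∫_{-1}^1 f'(s) s^m ds` by scaling (`exists_core_bound`).
For even `m ≥ 2k` both are bounded. This gives the universal coefficients.

The region `|x| ≥ ε₀` inside the tube, together with the complement of the tube, contributes a
constant independent of `ε`. The third expansion is the sum of the first two, because `f_ε'(t) =
t^{-2k}` for `|t| ≥ ε`, so the two forms agree off `U_ε`.

Much of the work is the passage from the integral defined through charts of `M` to product
coordinates on the tube: change of variables for arbitrary parametrizations
(`integralOn_eq_sum_parametrizations`) and the comparison of the orientations of `M` and `Z`
(`IsTube.sign_coordValue`). -/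

noncomputable section

namespace BSymplectic

/-! ### Exterior products as signed sums over all permutations. -/

section AlgebraLemmas

lemma alternatization_apply_eq_sum {V : Type*} [AddCommGroup V] [Module ℝ V] {p : ℕ}
    (F : MultilinearMap ℝ (fun _ : Fin p => V) ℝ)
    (v : Fin p → V) :
    MultilinearMap.alternatization F v =
      ∑ σ : Equiv.Perm (Fin p), ((Equiv.Perm.sign σ : ℤ) : ℝ) * F (fun i => v (σ i)) := by
  rw [MultilinearMap.alternatization_apply]
  refine Finset.sum_congr rfl fun σ _ => ?_
  rw [MultilinearMap.domDomCongr_apply, Units.smul_def, zsmul_eq_mul]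

variable {V : Type*} [AddCommGroup V] [Module ℝ V] [TopologicalSpace V]

/-- Alternatization here is the sum over all permutations without a factorial. With this
normalization the shuffle product of the alternatizations of `F` and `G` is the alternatization of
`F ⊗ G`, so sums over shuffle classes can be traded for sums over a full symmetric group. -/
lemma exists_alternatization_wedge {p q : ℕ} (a : V [⋀^Fin p]→L[ℝ] ℝ) (b : V [⋀^Fin q]→L[ℝ] ℝ)
    (F : MultilinearMap ℝ (fun _ : Fin p => V) ℝ) (G : MultilinearMap ℝ (fun _ : Fin q => V) ℝ)
    (ha : a.toAlternatingMap = MultilinearMap.alternatization F)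
    (hb : b.toAlternatingMap = MultilinearMap.alternatization G) :
    ∃ H : MultilinearMap ℝ (fun _ : Fin (p + q) => V) ℝ,
      (∀ v, H v = F (fun i => v (Fin.castAdd q i)) * G (fun j => v (Fin.natAdd p j))) ∧
      (wedge a b).toAlternatingMap = MultilinearMap.alternatization H := by
  refine ⟨((LinearMap.mul' ℝ ℝ).compMultilinearMap (F.domCoprod G)).domDomCongr finSumFinEquiv,
    fun v => by simp [MultilinearMap.domCoprod_apply], ?_⟩
  ext v
  rw [alternatization_apply_eq_sum]
  change LinearMap.mul' ℝ ℝ ((a.toAlternatingMap.domCoprod b.toAlternatingMap)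
    fun i => v (finSumFinEquiv i)) = _
  rw [ha, hb, ← MultilinearMap.domCoprod_alternization, MultilinearMap.alternatization_apply,
    map_sum]
  refine Fintype.sum_equiv (Equiv.permCongr finSumFinEquiv) _ _ fun σ => ?_
  rw [MultilinearMap.domDomCongr_apply, Equiv.Perm.sign_permCongr, Units.smul_def, map_zsmul,
    zsmul_eq_mul]
  simp [MultilinearMap.domCoprod_apply, Equiv.permCongr_apply]

lemma exists_alternatization_one (a : V [⋀^Fin 1]→L[ℝ] ℝ) :
    ∃ F : MultilinearMap ℝ (fun _ : Fin 1 => V) ℝ, (∀ v, F v = a v) ∧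
      a.toAlternatingMap = MultilinearMap.alternatization F := by
  refine ⟨a.toMultilinearMap, fun v => rfl, ?_⟩
  ext v
  rw [alternatization_apply_eq_sum, Fintype.sum_unique]
  simp only [Subsingleton.elim (default : Equiv.Perm (Fin 1)) 1]
  simp

/-- The two permutations contribute equally, hence the factor `2⁻¹`; it is the source of the powers
of `2⁻¹` in all later formulas. -/
lemma exists_alternatization_two (a : V [⋀^Fin 2]→L[ℝ] ℝ) :
    ∃ F : MultilinearMap ℝ (fun _ : Fin 2 => V) ℝ, (∀ v, F v = 2⁻¹ * a v) ∧
      a.toAlternatingMap = MultilinearMap.alternatization F := by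
  refine ⟨(2⁻¹ : ℝ) • a.toMultilinearMap, fun v => rfl, ?_⟩
  ext v
  rw [alternatization_apply_eq_sum]
  have h : ∀ σ : Equiv.Perm (Fin 2), ((Equiv.Perm.sign σ : ℤ) : ℝ) *
      ((2⁻¹ : ℝ) • a.toMultilinearMap) (fun i => v (σ i)) = 2⁻¹ * a v := by
    intro σ
    have := a.toAlternatingMap.map_perm v σ
    change ((Equiv.Perm.sign σ : ℤ) : ℝ) * (2⁻¹ * a.toAlternatingMap (v ∘ σ)) = _
    rw [this, Units.smul_def, zsmul_eq_mul]
    have h2 : ((Equiv.Perm.sign σ : ℤ) : ℝ) * ((Equiv.Perm.sign σ : ℤ) : ℝ) = 1 := by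
      rcases Int.units_eq_one_or (Equiv.Perm.sign σ) with h | h <;> simp [h]
    change _ = 2⁻¹ * a.toAlternatingMap v
    linear_combination (2⁻¹ * a.toAlternatingMap v) * h2
  rw [Finset.sum_congr rfl fun σ _ => h σ]
  simp [Fintype.card_perm]

lemma wedge_one_one_apply (a b : V [⋀^Fin 1]→L[ℝ] ℝ) (v w : V) :
    wedge a b ![v, w] = a ![v] * b ![w] - a ![w] * b ![v] := by
  obtain ⟨F, hF, ha⟩ := exists_alternatization_one a
  obtain ⟨G, hG, hb⟩ := exists_alternatization_one b
  obtain ⟨H, hH, h⟩ := exists_alternatization_wedge a b F G ha hb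
  change (wedge a b).toAlternatingMap ![v, w] = _
  rw [h, alternatization_apply_eq_sum]
  have hu : (Finset.univ : Finset (Equiv.Perm (Fin (1 + 1)))) = {1, Equiv.swap 0 1} := by decide
  have hne : (1 : Equiv.Perm (Fin (1 + 1))) ≠ Equiv.swap 0 1 := by decide
  have e : ∀ x : Fin 1 → V, x = ![x 0] := fun x => by ext i; fin_cases i; rfl
  rw [hu, Finset.sum_pair hne, hH, hH, hF, hF, hG, hG, Equiv.Perm.sign_swap (by decide)]
  rw [e fun i => ![v, w] ((1 : Equiv.Perm (Fin (1 + 1))) (Fin.castAdd 1 i)),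
    e fun i => ![v, w] ((1 : Equiv.Perm (Fin (1 + 1))) (Fin.natAdd 1 i)),
    e fun i => ![v, w] ((Equiv.swap 0 1 : Equiv.Perm (Fin (1 + 1))) (Fin.castAdd 1 i)),
    e fun i => ![v, w] ((Equiv.swap 0 1 : Equiv.Perm (Fin (1 + 1))) (Fin.natAdd 1 i))]
  simp [sub_eq_add_neg, Fin.natAdd, Fin.castAdd]

/-- The first element of the `i`-th pair of consecutive indices. -/
def pairFst {m : ℕ} (i : Fin m) : Fin (2 * m) := ⟨2 * i, by omega⟩

/-- The second element of the `i`-th pair of consecutive indices. -/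
def pairSnd {m : ℕ} (i : Fin m) : Fin (2 * m) := ⟨2 * i + 1, by omega⟩

lemma exists_alternatization_wedgeFamily (m : ℕ) (b : Fin m → V [⋀^Fin 2]→L[ℝ] ℝ) :
    ∃ F : MultilinearMap ℝ (fun _ : Fin (2 * m) => V) ℝ,
      (∀ v, F v = (2⁻¹ : ℝ) ^ m * ∏ i, b i ![v (pairFst i), v (pairSnd i)]) ∧
      (wedgeFamily m b).toAlternatingMap = MultilinearMap.alternatization F := by
  induction m with
  | zero =>
    refine ⟨(MultilinearMap.constOfIsEmpty ℝ (fun _ : Fin 0 => V) (1 : ℝ) :), fun v => ?_, ?_⟩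
    · change (1 : ℝ) = _
      simp
    · ext v
      rw [alternatization_apply_eq_sum]
      change (1 : ℝ) = ∑ σ : Equiv.Perm (Fin 0), ((Equiv.Perm.sign σ : ℤ) : ℝ) * 1
      simp
  | succ m ih =>
    obtain ⟨F, hF, ha⟩ := ih fun i => b i.castSucc
    obtain ⟨G, hG, hb⟩ := exists_alternatization_two (b (Fin.last m))
    obtain ⟨H, hH, h⟩ := exists_alternatization_wedge _ _ F G ha hb
    refine ⟨H, fun v => ?_, h⟩
    have e : ∀ x : Fin 2 → V, x = ![x 0, x 1] := fun x => by ext i; fin_cases i <;> rfl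
    rw [hH, hF, hG, Fin.prod_univ_castSucc, pow_succ, e fun j => v (Fin.natAdd (2 * m) j)]
    have h1 : (Fin.natAdd (2 * m) (0 : Fin 2) : Fin (2 * m + 2)) = pairFst (Fin.last m) := rfl
    have h2 : (Fin.natAdd (2 * m) (1 : Fin 2) : Fin (2 * m + 2)) = pairSnd (Fin.last m) := rfl
    have h3 : ∀ i : Fin m, (Fin.castAdd 2 (pairFst i) : Fin (2 * m + 2)) = pairFst i.castSucc :=
      fun i => rfl
    have h4 : ∀ i : Fin m, (Fin.castAdd 2 (pairSnd i) : Fin (2 * m + 2)) = pairSnd i.castSucc :=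
      fun i => rfl
    simp only [h1, h2, h3, h4]
    ring

lemma wedgeFamily_apply (m : ℕ) (b : Fin m → V [⋀^Fin 2]→L[ℝ] ℝ) (v : Fin (2 * m) → V) :
    wedgeFamily m b v = (2⁻¹ : ℝ) ^ m * ∑ σ : Equiv.Perm (Fin (2 * m)),
      ((Equiv.Perm.sign σ : ℤ) : ℝ) * ∏ i, b i ![v (σ (pairFst i)), v (σ (pairSnd i))] := by
  obtain ⟨F, hF, h⟩ := exists_alternatization_wedgeFamily m b
  change (wedgeFamily m b).toAlternatingMap v = _
  rw [h, alternatization_apply_eq_sum, Finset.mul_sum]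
  refine Finset.sum_congr rfl fun σ _ => ?_
  rw [hF]
  ring

lemma wedge_wedgeFamily_apply (m : ℕ) (a : V [⋀^Fin 1]→L[ℝ] ℝ) (b : Fin m → V [⋀^Fin 2]→L[ℝ] ℝ)
    (v : Fin (1 + 2 * m) → V) :
    wedge a (wedgeFamily m b) v = (2⁻¹ : ℝ) ^ m * ∑ σ : Equiv.Perm (Fin (1 + 2 * m)),
      ((Equiv.Perm.sign σ : ℤ) : ℝ) * (a ![v (σ (Fin.castAdd (2 * m) 0))] *
        ∏ i, b i ![v (σ (Fin.natAdd 1 (pairFst i))), v (σ (Fin.natAdd 1 (pairSnd i)))]) := by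
  obtain ⟨F, hF, ha⟩ := exists_alternatization_one a
  obtain ⟨G, hG, hb⟩ := exists_alternatization_wedgeFamily m b
  obtain ⟨H, hH, h⟩ := exists_alternatization_wedge _ _ F G ha hb
  change (wedge a (wedgeFamily m b)).toAlternatingMap v = _
  rw [h, alternatization_apply_eq_sum, Finset.mul_sum]
  refine Finset.sum_congr rfl fun σ _ => ?_
  have e : ∀ x : Fin 1 → V, x = ![x 0] := fun x => by ext i; fin_cases i; rfl
  rw [hH, hF, hG, e fun i => v (σ (Fin.castAdd (2 * m) i))]
  ring

end AlgebraLemmas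

/-! ### Pfaffian-type sums over permutations and their contraction with index 0. -/

section Combinatorics

variable {m : ℕ}

/-- The permutation exchanging the pair with index `0` and the pair with index `i`. -/
def pairSwap (i : Fin (m + 1)) : Equiv.Perm (Fin (2 * (m + 1))) :=
  Equiv.swap (pairFst 0) (pairFst i) * Equiv.swap (pairSnd 0) (pairSnd i)

lemma pairFst_injective : Function.Injective (pairFst : Fin m → Fin (2 * m)) := by
  intro i j h
  simp only [pairFst, Fin.mk.injEq] at h
  omega

lemma pairSnd_injective : Function.Injective (pairSnd : Fin m → Fin (2 * m)) := by
  intro i j h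
  simp only [pairSnd, Fin.mk.injEq] at h
  omega

lemma pairFst_ne_pairSnd (i j : Fin m) : pairFst i ≠ pairSnd j := by
  intro h
  simp only [pairFst, pairSnd, Fin.mk.injEq] at h
  omega

lemma exists_eq_pair (p : Fin (2 * m)) : ∃ i : Fin m, p = pairFst i ∨ p = pairSnd i := by
  refine ⟨⟨p / 2, by omega⟩, ?_⟩
  simp only [pairFst, pairSnd, Fin.ext_iff]
  omega

lemma pairSwap_pairFst (i j : Fin (m + 1)) :
    pairSwap i (pairFst j) = pairFst (Equiv.swap 0 i j) := by
  rw [pairSwap, Equiv.Perm.mul_apply, Equiv.swap_apply_of_ne_of_ne (pairFst_ne_pairSnd _ _)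
    (pairFst_ne_pairSnd _ _), ← pairFst_injective.map_swap]

lemma pairSwap_pairSnd (i j : Fin (m + 1)) :
    pairSwap i (pairSnd j) = pairSnd (Equiv.swap 0 i j) := by
  rw [pairSwap, Equiv.Perm.mul_apply, ← pairSnd_injective.map_swap,
    Equiv.swap_apply_of_ne_of_ne (pairFst_ne_pairSnd _ _).symm (pairFst_ne_pairSnd _ _).symm]

lemma sign_pairSwap (i : Fin (m + 1)) : Equiv.Perm.sign (pairSwap i) = 1 := by
  by_cases h : i = 0
  · simp [h, pairSwap]
  · rw [pairSwap, Equiv.Perm.sign_mul, Equiv.Perm.sign_swap (pairFst_injective.ne (Ne.symm h)),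
      Equiv.Perm.sign_swap (pairSnd_injective.ne (Ne.symm h))]
    rfl

/-- Right multiplication by `pairSwap i` moves the distinguished pair to position `0`. It is a
product of two transpositions or the identity, so signs are unchanged. -/
lemma sum_perm_erase_pair (B C : Fin (2 * (m + 1)) → Fin (2 * (m + 1)) → ℝ) (i : Fin (m + 1)) :
    ∑ σ : Equiv.Perm (Fin (2 * (m + 1))), ((Equiv.Perm.sign σ : ℤ) : ℝ) *
        (C (σ (pairFst i)) (σ (pairSnd i)) *
          ∏ j ∈ Finset.univ.erase i, B (σ (pairFst j)) (σ (pairSnd j))) =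
      ∑ σ : Equiv.Perm (Fin (2 * (m + 1))), ((Equiv.Perm.sign σ : ℤ) : ℝ) *
        (C (σ (pairFst 0)) (σ (pairSnd 0)) *
          ∏ j : Fin m, B (σ (pairFst j.succ)) (σ (pairSnd j.succ))) := by
  symm
  refine Fintype.sum_equiv (Equiv.mulRight (pairSwap i)) _ _ fun σ => ?_
  have h0 : ∀ F : Fin (m + 1) → ℝ, ∏ j ∈ Finset.univ.erase i, F (Equiv.swap 0 i j) =
      ∏ j : Fin m, F j.succ := by
    intro F
    have h1 : ∏ j ∈ Finset.univ.erase i, F (Equiv.swap 0 i j) =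
        ∏ j ∈ Finset.univ.erase 0, F j := by
      refine Finset.prod_equiv (Equiv.swap 0 i) (fun j => ?_) fun j _ => rfl
      simp only [Finset.mem_erase, Finset.mem_univ, and_true, ne_eq]
      rw [not_iff_not]
      constructor
      · rintro rfl
        simp
      · intro h
        exact (Equiv.swap 0 i).injective (h.trans (Equiv.swap_apply_right 0 i).symm)
    rw [h1]
    have : Finset.univ.erase (0 : Fin (m + 1)) = Finset.univ.map (Fin.succEmb m) := by
      ext j
      simp only [Finset.mem_erase, Finset.mem_univ, and_true, Finset.mem_map, Fin.coe_succEmb,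
        true_and]
      exact ⟨fun h => ⟨j.pred h, Fin.succ_pred j h⟩, fun ⟨a, h⟩ => h ▸ Fin.succ_ne_zero a⟩
    rw [this, Finset.prod_map]
    rfl
  simp only [Equiv.coe_mulRight, Equiv.Perm.mul_apply, Equiv.Perm.sign_mul, sign_pairSwap, mul_one,
    pairSwap_pairFst, pairSwap_pairSnd, Equiv.swap_apply_right]
  rw [h0 fun j => B (σ (pairFst j)) (σ (pairSnd j))]

/-- The index `0` lies in exactly one of the pairs cut out by `σ`, so at most one factor `C` is
nonzero and the product is at most linear in `C`. -/
lemma prod_pair_add (B C : Fin (2 * (m + 1)) → Fin (2 * (m + 1)) → ℝ)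
    (hC : ∀ p q, p ≠ 0 → q ≠ 0 → C p q = 0) (σ : Equiv.Perm (Fin (2 * (m + 1)))) :
    ∏ i, (B (σ (pairFst i)) (σ (pairSnd i)) + C (σ (pairFst i)) (σ (pairSnd i))) =
      ∏ i, B (σ (pairFst i)) (σ (pairSnd i)) + ∑ i, C (σ (pairFst i)) (σ (pairSnd i)) *
        ∏ j ∈ Finset.univ.erase i, B (σ (pairFst j)) (σ (pairSnd j)) := by
  obtain ⟨i, hi⟩ := exists_eq_pair (σ.symm 0)
  have h0 : ∀ j, j ≠ i → C (σ (pairFst j)) (σ (pairSnd j)) = 0 := by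
    intro j hj
    apply hC
    · intro h
      rw [← Equiv.eq_symm_apply] at h
      rcases hi with hi | hi
      · exact hj (pairFst_injective (h.trans hi))
      · exact pairFst_ne_pairSnd _ _ (h.trans hi)
    · intro h
      rw [← Equiv.eq_symm_apply] at h
      rcases hi with hi | hi
      · exact pairFst_ne_pairSnd _ _ (h.trans hi).symm
      · exact hj (pairSnd_injective (h.trans hi))
  rw [Finset.sum_eq_single i (fun j _ hj => by rw [h0 j hj, zero_mul]) (by simp),
    ← Finset.mul_prod_erase _ _ (Finset.mem_univ i), ← Finset.mul_prod_erase _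
      (fun i => B (σ (pairFst i)) (σ (pairSnd i))) (Finset.mem_univ i),
    Finset.prod_congr rfl fun j hj => by rw [h0 j (Finset.ne_of_mem_erase hj), add_zero]]
  ring

lemma sum_perm_apply_zero {N : ℕ} (G : Equiv.Perm (Fin (N + 1)) → ℝ) :
    ∑ σ : Equiv.Perm (Fin (N + 1)), (if σ 0 = 0 then G σ else 0) =
      ∑ τ : Equiv.Perm (Fin N), G (Equiv.Perm.decomposeFin.symm (0, τ)) := by
  rw [← Equiv.sum_comp Equiv.Perm.decomposeFin.symm, Fintype.sum_prod_type, Finset.sum_eq_single 0]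
  · simp
  · intro p _ hp
    simp [hp]
  · simp

/-- This is the combinatorial form of `(e⁰ ∧ A + B)^{m+1} = B^{m+1} + (m+1) e⁰ ∧ A ∧ B^m`. The
factor `m + 1` counts the pair that contains the index `0`, the factor `2` its place within the
pair. Once `0` is fixed in first place, the permutations left are those of the other `2m + 1`
indices. -/
lemma sum_perm_contract (B : Fin (2 * (m + 1)) → Fin (2 * (m + 1)) → ℝ)
    (A : Fin (2 * (m + 1)) → ℝ) (C : Fin (2 * (m + 1)) → Fin (2 * (m + 1)) → ℝ)
    (hC : ∀ p q, C p q = (if p = 0 then A q else 0) - (if q = 0 then A p else 0)) :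
    ∑ σ : Equiv.Perm (Fin (2 * (m + 1))), ((Equiv.Perm.sign σ : ℤ) : ℝ) *
        ∏ i, (B (σ (pairFst i)) (σ (pairSnd i)) + C (σ (pairFst i)) (σ (pairSnd i))) =
      ∑ σ : Equiv.Perm (Fin (2 * (m + 1))), ((Equiv.Perm.sign σ : ℤ) : ℝ) *
        ∏ i, B (σ (pairFst i)) (σ (pairSnd i)) +
      2 * (m + 1) * ∑ τ : Equiv.Perm (Fin (2 * m + 1)), ((Equiv.Perm.sign τ : ℤ) : ℝ) *
        (A (τ 0).succ * ∏ i : Fin m, B (τ (pairFst i).succ).succ (τ (pairSnd i).succ).succ) := by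
  have hC0 : ∀ p q, p ≠ 0 → q ≠ 0 → C p q = 0 := fun p q hp hq => by simp [hC, hp, hq]
  have key : ∑ σ : Equiv.Perm (Fin (2 * (m + 1))), ((Equiv.Perm.sign σ : ℤ) : ℝ) *
        (C (σ (pairFst 0)) (σ (pairSnd 0)) *
          ∏ j : Fin m, B (σ (pairFst j.succ)) (σ (pairSnd j.succ))) =
      2 * ∑ τ : Equiv.Perm (Fin (2 * m + 1)), ((Equiv.Perm.sign τ : ℤ) : ℝ) *
        (A (τ 0).succ * ∏ i : Fin m, B (τ (pairFst i).succ).succ (τ (pairSnd i).succ).succ) := by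
    set G : Equiv.Perm (Fin (2 * m + 1 + 1)) → ℝ := fun σ => ((Equiv.Perm.sign σ : ℤ) : ℝ) *
      (A (σ (pairSnd (0 : Fin (m + 1)))) *
        ∏ j : Fin m, B (σ (pairFst j.succ)) (σ (pairSnd j.succ))) with hG
    have e1 : ∑ τ : Equiv.Perm (Fin (2 * m + 1)), ((Equiv.Perm.sign τ : ℤ) : ℝ) *
        (A (τ 0).succ * ∏ i : Fin m, B (τ (pairFst i).succ).succ (τ (pairSnd i).succ).succ) =
        ∑ σ : Equiv.Perm (Fin (2 * m + 1 + 1)), (if σ 0 = 0 then G σ else 0) := by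
      rw [sum_perm_apply_zero]
      refine Finset.sum_congr rfl fun τ _ => ?_
      have s1 : (pairSnd (0 : Fin (m + 1)) : Fin (2 * m + 1 + 1)) = (0 : Fin (2 * m + 1)).succ := rfl
      have s2 : ∀ j : Fin m, (pairFst j.succ : Fin (2 * m + 1 + 1)) = (pairFst j).succ.succ :=
        fun j => rfl
      have s3 : ∀ j : Fin m, (pairSnd j.succ : Fin (2 * m + 1 + 1)) = (pairSnd j).succ.succ :=
        fun j => rfl
      simp only [hG]
      rw [s1]
      simp only [s2, s3, Equiv.Perm.decomposeFin_symm_apply_succ, Equiv.Perm.decomposeFin.symm_sign,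
        Equiv.swap_self, Equiv.refl_apply, if_true, one_mul]
    -- Exchanging the two entries of the first pair is an odd permutation; its sign cancels the
    -- minus sign in `hC`, so both places of the index `0` contribute the same.
    have e2 : ∑ σ : Equiv.Perm (Fin (2 * m + 1 + 1)), (if σ 0 = 0 then G σ else 0) =
        - ∑ σ : Equiv.Perm (Fin (2 * (m + 1))), ((Equiv.Perm.sign σ : ℤ) : ℝ) *
        ((if σ (pairSnd 0) = 0 then A (σ (pairFst 0)) else 0) *
          ∏ j : Fin m, B (σ (pairFst j.succ)) (σ (pairSnd j.succ))) := by
      rw [← Finset.sum_neg_distrib]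
      refine Fintype.sum_equiv (Equiv.mulRight (Equiv.swap (pairFst 0) (pairSnd 0) :
        Equiv.Perm (Fin (2 * (m + 1))))) _ _ fun σ => ?_
      have n1 : ∀ j : Fin m, (pairFst j.succ) ≠ pairFst 0 := fun j h =>
        Fin.succ_ne_zero j (pairFst_injective h)
      have n2 : ∀ j : Fin m, (pairSnd j.succ) ≠ pairSnd 0 := fun j h =>
        Fin.succ_ne_zero j (pairSnd_injective h)
      simp only [Equiv.coe_mulRight, Equiv.Perm.mul_apply, Equiv.Perm.sign_mul,
        Equiv.Perm.sign_swap (pairFst_ne_pairSnd (0 : Fin (m + 1)) 0), Equiv.swap_apply_right,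
        Equiv.swap_apply_left, Equiv.swap_apply_of_ne_of_ne (n1 _) (pairFst_ne_pairSnd _ _),
        Equiv.swap_apply_of_ne_of_ne (pairFst_ne_pairSnd _ _).symm (n2 _)]
      have z : (0 : Fin (2 * m + 1 + 1)) = pairFst (0 : Fin (m + 1)) := rfl
      simp only [hG, z]
      split_ifs with h
      · simp
      · simp
    rw [e1]
    refine Eq.trans ?_ (two_mul _).symm
    nth_rewrite 2 [e2]
    rw [← Finset.sum_neg_distrib]
    change _ = ∑ σ : Equiv.Perm (Fin (2 * (m + 1))), _ + _
    rw [← Finset.sum_add_distrib]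
    refine Finset.sum_congr rfl fun σ _ => ?_
    rw [hC]
    have z : (0 : Fin (2 * m + 1 + 1)) = pairFst (0 : Fin (m + 1)) := rfl
    simp only [hG, z]
    split_ifs <;> ring
  rw [Finset.sum_congr rfl fun σ _ => by rw [prod_pair_add B C hC0 σ, mul_add, Finset.mul_sum],
    Finset.sum_add_distrib, Finset.sum_comm,
    Finset.sum_congr rfl fun i _ => (sum_perm_erase_pair B C i).trans key]
  simp only [Finset.sum_const, Finset.card_univ, Fintype.card_fin, nsmul_eq_mul, Nat.cast_add,
    Nat.cast_one]
  ring

end Combinatorics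

/-! ### The top power of `s l ∧ a + b`. -/

section Contraction

variable {V : Type*} [AddCommGroup V] [Module ℝ V] [TopologicalSpace V]

/-- The contraction of `(s l ∧ a + b)^n` with a vector `E 0` such that `l (E 0) = 1`, evaluated on
vectors in the kernel of `l`. -/
lemma wedgePow_smul_wedge_add_apply {n d : ℕ} (hd : d + 1 = 2 * n) (hd' : 1 + 2 * (n - 1) = d)
    (l a : V [⋀^Fin 1]→L[ℝ] ℝ) (b : V [⋀^Fin 2]→L[ℝ] ℝ) (s : ℝ) (E : Fin (d + 1) → V)
    (h0 : l ![E 0] = 1) (hl : ∀ i : Fin d, l ![E i.succ] = 0) :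
    wedgePow n (s • wedge l a + b) (fun i => E (Fin.cast hd.symm i)) =
      n * s * wedge a (wedgeFamily (n - 1) fun _ => b) (fun i => E (Fin.cast hd' i).succ) +
        wedgePow n b (fun i => E (Fin.cast hd.symm i)) := by
  obtain ⟨m, rfl⟩ : ∃ m, n = m + 1 := ⟨n - 1, by omega⟩
  obtain rfl : d = 2 * m + 1 := by omega
  rw [wedgePow, wedgePow, wedgeFamily_apply, wedgeFamily_apply, wedge_wedgeFamily_apply]
  have hl' : ∀ p : Fin (2 * m + 1 + 1), l ![E p] = if p = 0 then 1 else 0 := by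
    intro p
    induction p using Fin.cases with
    | zero => simpa using h0
    | succ p => simp [hl]
  -- Evaluated on the frame `E`, the form `l` is the indicator of the index `0`, so `s l ∧ a` has
  -- entries only in row and column `0`, as the contraction formula requires.
  have := sum_perm_contract (m := m) (fun p q => b ![E p, E q]) (fun q => s * a ![E q])
    (fun p q => (s • wedge l a) ![E p, E q]) (fun p q => by
      rw [ContinuousAlternatingMap.smul_apply, wedge_one_one_apply, hl', hl', smul_eq_mul]
      split_ifs <;> ring)
  simp only [ContinuousAlternatingMap.add_apply, Fin.cast_eq_self] at this ⊢
  rw [Finset.sum_congr rfl fun σ _ => by rw [Finset.prod_congr rfl fun i _ => add_comm _ _],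
    this, mul_add, add_comm]
  congr 1
  have e : ∑ σ : Equiv.Perm (Fin (1 + 2 * m)), ((Equiv.Perm.sign σ : ℤ) : ℝ) *
      (a ![E (Fin.cast hd' (σ (Fin.castAdd (2 * m) 0))).succ] *
        ∏ i : Fin m, b ![E (Fin.cast hd' (σ (Fin.natAdd 1 (pairFst i)))).succ,
          E (Fin.cast hd' (σ (Fin.natAdd 1 (pairSnd i)))).succ]) =
      ∑ τ : Equiv.Perm (Fin (2 * m + 1)), ((Equiv.Perm.sign τ : ℤ) : ℝ) *
        (a ![E (τ 0).succ] * ∏ i : Fin m, b ![E (τ (pairFst i).succ).succ,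
          E (τ (pairSnd i).succ).succ]) := by
    refine Fintype.sum_equiv (Equiv.permCongr (finCongr hd')) _ _ fun σ => ?_
    have c0 : (finCongr hd').symm 0 = Fin.castAdd (2 * m) (0 : Fin 1) := rfl
    have c1 : ∀ j : Fin (2 * m), (finCongr hd').symm j.succ = Fin.natAdd 1 j := fun j => by
      ext
      simp [add_comm]
    simp only [Equiv.Perm.sign_permCongr, Equiv.permCongr_apply, c0, c1, finCongr_apply]
  -- The constants match because `2^{-(m+1)} · 2(m+1) = (m+1) 2^{-m}`.
  change _ = ((m + 1 : ℕ) : ℝ) * s * (2⁻¹ ^ m * ∑ σ : Equiv.Perm (Fin (1 + 2 * m)), _)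
  refine Eq.trans ?_ (congrArg (fun X => ((m + 1 : ℕ) : ℝ) * s * (2⁻¹ ^ m * X)) e.symm)
  simp only [mul_assoc, mul_left_comm _ s, ← Finset.mul_sum]
  push_cast
  rw [pow_succ]
  ring

end Contraction

/-! ### Taylor expansion in the normal variable, uniform over compact sets. -/

section Taylor

/-- Induction on `N`: the derivative of the remainder of `g` is the remainder of `deriv g` of one
order less. The mean value inequality then costs a factor `|t|`. It does not produce the factor `1 /
N!`, which is irrelevant here. -/
lemma taylor_bound {r ε₀ M : ℝ} (hε₀ : ε₀ < r) (N : ℕ) (g : ℝ → ℝ)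
    (hg : ContDiffOn ℝ ∞ g (Ioo (-r) r))
    (hM : ∀ t, |t| ≤ ε₀ → |iteratedDeriv N g t| ≤ M) (t : ℝ) (ht : |t| ≤ ε₀) :
    |g t - ∑ j ∈ Finset.range N, t ^ j * ((j.factorial : ℝ)⁻¹ * iteratedDeriv j g 0)| ≤
      M * |t| ^ N := by
  induction N generalizing g t with
  | zero => simpa using hM t ht
  | succ N ih =>
    have hmem : ∀ s : ℝ, |s| ≤ ε₀ → s ∈ Ioo (-r) r := fun s hs =>
      ⟨by linarith [neg_abs_le s], by linarith [le_abs_self s]⟩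
    have hM0 : 0 ≤ M := (abs_nonneg _).trans (hM t ht)
    have hg' : ContDiffOn ℝ ∞ (deriv g) (Ioo (-r) r) :=
      hg.deriv_of_isOpen isOpen_Ioo (by simp)
    have ih' := ih (deriv g) hg' (fun s hs => by rw [← iteratedDeriv_succ']; exact hM s hs)
    have hle : ∀ s ∈ uIcc 0 t, |s| ≤ |t| := by
      intro s hs
      rcases le_total 0 t with h | h
      · rw [uIcc_of_le h] at hs
        rw [abs_of_nonneg hs.1, abs_of_nonneg h]
        exact hs.2
      · rw [uIcc_of_ge h] at hs
        rw [abs_of_nonpos hs.2, abs_of_nonpos h]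
        linarith [hs.1]
    set P : ℝ → ℝ := fun s => ∑ j ∈ Finset.range (N + 1),
      s ^ j * ((j.factorial : ℝ)⁻¹ * iteratedDeriv j g 0) with hP
    have hdP : ∀ s, HasDerivAt P (∑ j ∈ Finset.range N,
        s ^ j * ((j.factorial : ℝ)⁻¹ * iteratedDeriv j (deriv g) 0)) s := by
      intro s
      have h1 : HasDerivAt P (∑ j ∈ Finset.range (N + 1),
          ((j : ℝ) * s ^ (j - 1)) * ((j.factorial : ℝ)⁻¹ * iteratedDeriv j g 0)) s :=
        HasDerivAt.fun_sum fun j _ => (hasDerivAt_pow j s).mul_const _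
      convert h1 using 1
      rw [Finset.sum_range_succ']
      simp only [Nat.cast_zero, zero_mul, add_zero]
      refine Finset.sum_congr rfl fun j _ => ?_
      rw [← iteratedDeriv_succ', Nat.add_sub_cancel, Nat.factorial_succ]
      have : ((j + 1 : ℕ) : ℝ) ≠ 0 := by positivity
      have h2 : (j.factorial : ℝ) ≠ 0 := by positivity
      push_cast at this ⊢
      field_simp
    -- Mean value inequality for the remainder on the segment from `0` to `t`; the remainder
    -- vanishes at `0`.
    have key := (convex_uIcc (0 : ℝ) t).norm_image_sub_le_of_norm_hasDerivWithin_le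
      (f := fun s => g s - P s) (f' := fun s => deriv g s - ∑ j ∈ Finset.range N,
        s ^ j * ((j.factorial : ℝ)⁻¹ * iteratedDeriv j (deriv g) 0)) (C := M * |t| ^ N)
      (fun s hs => by
        have hs' := hmem s ((hle s hs).trans ht)
        have : HasDerivAt g (deriv g s) s :=
          ((hg.differentiableOn (by simp)).differentiableAt (isOpen_Ioo.mem_nhds hs')).hasDerivAt
        exact (this.sub (hdP s)).hasDerivWithinAt)
      (fun s hs => by
        refine (ih' s ((hle s hs).trans ht)).trans ?_
        have := hle s hs
        gcongr) left_mem_uIcc right_mem_uIcc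
    have hP0 : P 0 = g 0 := by
      simp only [hP]
      rw [Finset.sum_range_succ']
      simp
    simp only [hP0, sub_self, sub_zero, Real.norm_eq_abs] at key
    rw [pow_succ, ← mul_assoc]
    exact key

variable {Y : Type*} [NormedAddCommGroup Y] [NormedSpace ℝ Y]

/-- Each `t`-derivative is the Fréchet derivative in the direction `(1, 0)`, hence jointly smooth.
Joint continuity is what makes the Taylor constants uniform in `y`. -/
lemma contDiffOn_iteratedDeriv_fst {r : ℝ} {V : Set Y} (hV : IsOpen V) {G : ℝ × Y → ℝ}
    (hG : ContDiffOn ℝ ∞ G (Ioo (-r) r ×ˢ V)) (j : ℕ) :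
    ContDiffOn ℝ ∞ (fun q : ℝ × Y => iteratedDeriv j (fun t => G (t, q.2)) q.1)
      (Ioo (-r) r ×ˢ V) := by
  have hO : IsOpen (Ioo (-r) r ×ˢ V) := isOpen_Ioo.prod hV
  induction j with
  | zero => simpa using hG
  | succ j ih =>
    have h1 := ih.fderiv_of_isOpen (m := ∞) hO (by simp)
    refine (h1.clm_apply (contDiffOn_const (c := ((1 : ℝ), (0 : Y))))).congr fun q hq => ?_
    rw [iteratedDeriv_succ]
    have hd : HasFDerivAt (fun q : ℝ × Y => iteratedDeriv j (fun t => G (t, q.2)) q.1) _ q :=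
      ((ih.differentiableOn (by simp)).differentiableAt (hO.mem_nhds hq)).hasFDerivAt
    have hc : HasDerivAt (fun t : ℝ => (t, q.2)) ((1 : ℝ), (0 : Y)) q.1 :=
      (hasDerivAt_id q.1).prodMk (hasDerivAt_const _ _)
    exact (hd.comp_hasDerivAt_of_eq q.1 hc rfl).deriv

lemma exists_taylor_bound {r ε₀ : ℝ} (hε₀ : ε₀ < r) {V K : Set Y} (hV : IsOpen V)
    (hK : IsCompact K) (hKV : K ⊆ V) {G : ℝ × Y → ℝ} (hG : ContDiffOn ℝ ∞ G (Ioo (-r) r ×ˢ V))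
    (N : ℕ) :
    ∃ C, 0 ≤ C ∧ ∀ y ∈ K, ∀ t, |t| ≤ ε₀ → |G (t, y) - ∑ j ∈ Finset.range N,
      t ^ j * ((j.factorial : ℝ)⁻¹ * iteratedDeriv j (fun t => G (t, y)) 0)| ≤ C * |t| ^ N := by
  have hsub : Icc (-ε₀) ε₀ ×ˢ K ⊆ Ioo (-r) r ×ˢ V :=
    prod_mono (fun t ht => ⟨by linarith [ht.1], by linarith [ht.2]⟩) hKV
  obtain ⟨C, hC⟩ := (isCompact_Icc.prod hK).exists_bound_of_continuousOn
    ((contDiffOn_iteratedDeriv_fst hV hG N).continuousOn.mono hsub)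
  refine ⟨max C 0, le_max_right _ _, fun y hy t ht => ?_⟩
  refine taylor_bound (M := max C 0) hε₀ N (fun t => G (t, y)) ?_ (fun s hs => ?_) t ht
  · exact hG.comp (contDiff_id.prodMk contDiff_const).contDiffOn fun s hs => ⟨hs, hKV hy⟩
  · exact (hC (s, y) ⟨abs_le.1 hs, hy⟩).trans (le_max_left _ _)

end Taylor

/-! ### The integrals of `t^{m-2k}` over `ε ≤ |t| < ε₀`. -/

section OneDimensional

/-- The coefficient of `ε^{-(2i-1)}` contributed by the `m`-th Taylor coefficient, where `s` is the
value of the corresponding integral. -/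
def expansionCoeff (k : ℕ) (s : ℕ → ℝ) (m i : ℕ) : ℝ :=
  if m = 2 * (k - i) ∧ 1 ≤ i ∧ i ≤ k then s i else 0

lemma sum_expansionCoeff_of_lt {k : ℕ} (s : ℕ → ℝ) {i : ℕ} (hi : 1 ≤ i) (hik : i ≤ k) (ε : ℝ) :
    ∑ l ∈ Finset.Icc 1 k, expansionCoeff k s (2 * (k - i)) l * ε ^ (-(2 * (l : ℤ) - 1)) =
      s i * ε ^ (-(2 * (i : ℤ) - 1)) := by
  rw [Finset.sum_eq_single i]
  · rw [expansionCoeff, if_pos ⟨rfl, hi, hik⟩]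
  · intro l hl hli
    rw [Finset.mem_Icc] at hl
    rw [expansionCoeff, if_neg, zero_mul]
    omega
  · intro h
    exact absurd (Finset.mem_Icc.2 ⟨hi, hik⟩) h

lemma sum_expansionCoeff_eq_zero {k m : ℕ} (s : ℕ → ℝ)
    (h : ∀ i, 1 ≤ i → i ≤ k → m ≠ 2 * (k - i)) (ε : ℝ) :
    ∑ l ∈ Finset.Icc 1 k, expansionCoeff k s m l * ε ^ (-(2 * (l : ℤ) - 1)) = 0 := by
  refine Finset.sum_eq_zero fun l hl => ?_
  rw [Finset.mem_Icc] at hl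
  rw [expansionCoeff, if_neg, zero_mul]
  exact fun h' => h l hl.1 hl.2 h'.1

/-- The set `ε ≤ |t| < ε₀`. -/
def shell (ε ε₀ : ℝ) : Set ℝ := {t | ε ≤ |t| ∧ |t| < ε₀}

lemma measurableSet_shell (ε ε₀ : ℝ) : MeasurableSet (shell ε ε₀) :=
  (measurableSet_le measurable_const measurable_id.abs).inter
    (measurableSet_lt measurable_id.abs measurable_const)

lemma shell_eq {ε ε₀ : ℝ} (hε : 0 < ε) : shell ε ε₀ = Ico ε ε₀ ∪ Ioc (-ε₀) (-ε) := by
  ext t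
  simp only [shell, mem_ofPred_eq, mem_union, mem_Ico, mem_Ioc]
  rcases le_total 0 t with h | h
  · rw [abs_of_nonneg h]
    exact ⟨fun h' => Or.inl h', fun h' => h'.elim id fun h' => by linarith⟩
  · rw [abs_of_nonpos h]
    constructor
    · intro h'
      right
      constructor <;> linarith
    · rintro (h' | h')
      · linarith
      · constructor <;> linarith

lemma integral_shell {ε ε₀ : ℝ} (hε : 0 < ε) (hε₀ : ε ≤ ε₀) {g : ℝ → ℝ}
    (hg : ContinuousOn g {0}ᶜ) :
    ∫ t in shell ε ε₀, g t = ∫ t in ε..ε₀, (g t + g (-t)) := by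
  have h1 : ContinuousOn g (Icc ε ε₀) := hg.mono fun t ht => by
    simp only [mem_compl_iff, mem_singleton_iff]
    linarith [ht.1]
  have h2 : ContinuousOn g (Icc (-ε₀) (-ε)) := hg.mono fun t ht => by
    simp only [mem_compl_iff, mem_singleton_iff]
    linarith [ht.2]
  have h3 : ContinuousOn (fun t => g (-t)) (Icc ε ε₀) :=
    h2.comp continuous_neg.continuousOn fun t ht => ⟨by linarith [ht.2], by linarith [ht.1]⟩
  rw [shell_eq hε, setIntegral_union _ measurableSet_Ioc
    (h1.integrableOn_Icc.mono_set Ico_subset_Icc_self)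
    (h2.integrableOn_Icc.mono_set Ioc_subset_Icc_self), integral_Ico_eq_integral_Ioc,
    ← intervalIntegral.integral_of_le hε₀, ← intervalIntegral.integral_of_le (by linarith),
    intervalIntegral.integral_add, intervalIntegral.integral_comp_neg]
  · exact (h1.mono (by rw [uIcc_of_le hε₀])).intervalIntegrable
  · exact (h3.mono (by rw [uIcc_of_le hε₀])).intervalIntegrable
  · rw [Set.disjoint_left]
    intro t h h'
    linarith [h.1, h'.2]

lemma continuousOn_inv_pow_mul_pow (k m : ℕ) :
    ContinuousOn (fun t : ℝ => (t ^ (2 * k))⁻¹ * t ^ m) {0}ᶜ :=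
  ((continuous_pow _).continuousOn.inv₀ fun _ ht => pow_ne_zero _ ht).mul
    (continuous_pow _).continuousOn

/-- Folding `t` onto `-t` gives the factor `1 + (-1)^m`. Odd powers therefore cancel, including the
exponent `-1`, so no logarithm appears; for even `m` the power is integrated explicitly. -/
lemma exists_shell_bound (k : ℕ) (m : ℕ) (ε₀ : ℝ) :
    ∃ C, ∀ ε, 0 < ε → ε < ε₀ → |(∫ t in shell ε ε₀, (t ^ (2 * k))⁻¹ * t ^ m) -
      ∑ i ∈ Finset.Icc 1 k, expansionCoeff k (fun i => 2 / (2 * i - 1)) m i *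
        ε ^ (-(2 * (i : ℤ) - 1))| ≤ C := by
  have hint : ∀ ε, 0 < ε → ε < ε₀ → ∫ t in shell ε ε₀, (t ^ (2 * k))⁻¹ * t ^ m =
      (1 + (-1) ^ m) * ∫ t in ε..ε₀, t ^ ((m : ℤ) - 2 * k) := by
    intro ε hε h
    rw [integral_shell hε h.le (continuousOn_inv_pow_mul_pow k m),
      ← intervalIntegral.integral_const_mul]
    refine intervalIntegral.integral_congr fun t ht => ?_
    rw [uIcc_of_le h.le] at ht
    have ht0 : t ≠ 0 := by linarith [ht.1]
    rw [zpow_sub₀ ht0, zpow_natCast, Even.neg_pow ⟨k, two_mul k⟩, neg_pow t m,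
      show ((2 : ℤ) * k) = ((2 * k : ℕ) : ℤ) by push_cast; rfl, zpow_natCast]
    field_simp
  rcases Nat.even_or_odd m with he | ho
  · have hz : (m : ℤ) - 2 * k ≠ -1 := by
      obtain ⟨l, rfl⟩ := he
      omega
    have hz1 : ((m : ℝ) - 2 * k + 1) ≠ 0 := by
      intro h
      apply hz
      have : ((m : ℤ) : ℝ) - 2 * (k : ℤ) + 1 = 0 := by exact_mod_cast h
      have : (m : ℤ) - 2 * k + 1 = 0 := by exact_mod_cast this
      omega
    have hint' : ∀ ε, 0 < ε → ε < ε₀ → ∫ t in shell ε ε₀, (t ^ (2 * k))⁻¹ * t ^ m =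
        2 * ((ε₀ ^ ((m : ℤ) - 2 * k + 1) - ε ^ ((m : ℤ) - 2 * k + 1)) /
          ((m : ℝ) - 2 * k + 1)) := by
      intro ε hε h
      rw [hint ε hε h, integral_zpow (Or.inr ⟨hz, ?_⟩), he.neg_one_pow]
      · push_cast
        ring
      · rw [uIcc_of_le h.le]
        exact fun h' => by linarith [h'.1]
    by_cases hm : m < 2 * k
    · obtain ⟨i, hi, hik, rfl⟩ : ∃ i, 1 ≤ i ∧ i ≤ k ∧ m = 2 * (k - i) := by
        obtain ⟨l, rfl⟩ := he
        exact ⟨k - l, by omega, by omega, by omega⟩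
      have hexp : (((2 * (k - i) : ℕ) : ℤ) - 2 * k + 1) = -(2 * (i : ℤ) - 1) := by
        push_cast [Nat.cast_sub hik]
        ring
      have hexp' : (((2 * (k - i) : ℕ) : ℝ) - 2 * k + 1) = -(2 * (i : ℝ) - 1) := by
        push_cast [Nat.cast_sub hik]
        ring
      -- The constant is the contribution of the fixed endpoint `ε₀`; the endpoint `ε` gives exactly
      -- the singular term.
      refine ⟨|2 * (ε₀ ^ (-(2 * (i : ℤ) - 1)) / (-(2 * (i : ℝ) - 1)))|, fun ε hε h => le_of_eq ?_⟩
      rw [sum_expansionCoeff_of_lt _ hi hik, hint' ε hε h, hexp, hexp']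
      congr 1
      rw [hexp'] at hz1
      have : (2 * (i : ℝ) - 1) ≠ 0 := fun h => hz1 (by rw [h, neg_zero])
      field_simp
      ring
    -- For `m ≥ 2k` the integrand has no singularity, and the integral over all of `|t| < ε₀` is a
    -- bound.
    · refine ⟨2 * (ε₀ ^ ((m : ℤ) - 2 * k + 1) / ((m : ℝ) - 2 * k + 1)), fun ε hε h => ?_⟩
      rw [sum_expansionCoeff_eq_zero _ (by omega), hint' ε hε h, sub_zero]
      have hpos : 0 < (m : ℝ) - 2 * k + 1 := by
        have : ((2 * k : ℕ) : ℝ) ≤ m := by exact_mod_cast not_lt.1 hm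
        push_cast at this
        linarith
      have h1 : ε ^ ((m : ℤ) - 2 * k + 1) ≤ ε₀ ^ ((m : ℤ) - 2 * k + 1) :=
        zpow_le_zpow_left₀ (by omega) hε.le h.le
      have h2 : 0 < ε ^ ((m : ℤ) - 2 * k + 1) := zpow_pos hε _
      rw [abs_of_nonneg (mul_nonneg zero_le_two (div_nonneg (by linarith) hpos.le))]
      gcongr
      linarith
  · refine ⟨0, fun ε hε h => ?_⟩
    rw [hint ε hε h, ho.neg_one_pow, sum_expansionCoeff_eq_zero]
    · simp
    · intro i _ _ h
      rw [h] at ho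
      exact (Nat.not_even_iff_odd.2 ho) (even_two_mul _)

end OneDimensional

/-! ### The profile function and its scaling. -/

section Profile

variable {k : ℕ} {f : ℝ → ℝ}

lemma IsProfile.deriv_neg (hf : IsProfile k f) (t : ℝ) : deriv f (-t) = deriv f t := by
  have h : (fun s => f (-s)) = fun s => -f s := funext hf.odd
  have h1 := congrArg (fun g => deriv g t) h
  simp only [deriv_comp_neg, deriv.fun_neg] at h1
  linarith

lemma IsProfile.deriv_of_one_lt (hf : IsProfile k f) (hk : 1 ≤ k) {t : ℝ} (ht : 1 < t) :
    deriv f t = (t ^ (2 * k))⁻¹ := by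
  have h : f =ᶠ[𝓝 t] fun t => -1 / ((2 * k - 1) * t ^ (2 * k - 1)) + 2 :=
    Filter.eventually_of_mem (Ioi_mem_nhds ht) fun s hs => hf.right s hs
  rw [h.deriv_eq]
  have ht0 : t ≠ 0 := by linarith
  have hk0 : (2 * (k : ℝ) - 1) ≠ 0 := by
    have : (1 : ℝ) ≤ k := by exact_mod_cast hk
    linarith
  have h1 : HasDerivAt (fun t : ℝ => -1 / ((2 * (k : ℝ) - 1) * t ^ (2 * k - 1)) + 2) _ t :=
    (((hasDerivAt_const t (-1 : ℝ)).div ((hasDerivAt_pow (2 * k - 1) t).const_mul (2 * (k : ℝ) - 1))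
      (mul_ne_zero hk0 (pow_ne_zero _ ht0))).add_const 2)
  rw [h1.deriv]
  obtain ⟨l, rfl⟩ : ∃ l, k = l + 1 := ⟨k - 1, by omega⟩
  rw [show 2 * (l + 1) - 1 = 2 * l + 1 by omega, show 2 * l + 1 - 1 = 2 * l by omega]
  push_cast at hk0 ⊢
  field_simp
  ring

lemma IsProfile.continuous_deriv (hf : IsProfile k f) : Continuous (deriv f) :=
  hf.smooth.continuous_deriv (by simp)

/-- The formula for `f` is given only for `|t| > 1`; at `|t| = 1` the derivative follows by
continuity, and negative `t` by evenness of `f'`. -/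
lemma IsProfile.deriv_of_one_le_abs (hf : IsProfile k f) (hk : 1 ≤ k) {t : ℝ} (ht : 1 ≤ |t|) :
    deriv f t = (t ^ (2 * k))⁻¹ := by
  have h1 : ∀ s : ℝ, 1 ≤ s → deriv f s = (s ^ (2 * k))⁻¹ := by
    intro s hs
    have hcl : s ∈ closure (Ioi (1 : ℝ)) := by
      rw [closure_Ioi]
      exact hs
    have hc1 : ContinuousOn (deriv f) (Ici 1) := hf.continuous_deriv.continuousOn
    have hc2 : ContinuousOn (fun s : ℝ => (s ^ (2 * k))⁻¹) (Ici 1) :=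
      (continuous_pow _).continuousOn.inv₀ fun u hu => pow_ne_zero _ (by
        have : (1 : ℝ) ≤ u := hu
        linarith)
    have : EqOn (deriv f) (fun s : ℝ => (s ^ (2 * k))⁻¹) (Ioi 1) :=
      fun u hu => hf.deriv_of_one_lt hk hu
    exact this.of_subset_closure hc1 hc2 (fun u (hu : 1 < u) => hu.le) (by rw [closure_Ioi]) hs
  rcases le_total 0 t with h | h
  · rw [abs_of_nonneg h] at ht
    exact h1 t ht
  · rw [abs_of_nonpos h] at ht
    rw [← hf.deriv_neg, h1 _ ht, Even.neg_pow ⟨k, two_mul k⟩]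

lemma hasDerivAt_scaled (hf : IsProfile k f) (hk : 1 ≤ k) {ε : ℝ} (hε : 0 < ε) (t : ℝ) :
    HasDerivAt (scaled k f ε) ((ε ^ (2 * k))⁻¹ * deriv f (t / ε)) t := by
  have h1 : HasDerivAt f (deriv f (t / ε)) (t / ε) :=
    (hf.smooth.differentiable (by simp)).differentiableAt.hasDerivAt
  have h2 := (h1.comp t ((hasDerivAt_id t).div_const ε)).const_mul (1 / ε ^ (2 * k - 1))
  refine h2.congr_deriv ?_
  obtain ⟨l, rfl⟩ : ∃ l, k = l + 1 := ⟨k - 1, by omega⟩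
  rw [show 2 * (l + 1) - 1 = 2 * l + 1 by omega]
  have : ε ≠ 0 := hε.ne'
  field_simp
  ring

lemma deriv_scaled (hf : IsProfile k f) (hk : 1 ≤ k) {ε : ℝ} (hε : 0 < ε) (t : ℝ) :
    deriv (scaled k f ε) t = (ε ^ (2 * k))⁻¹ * deriv f (t / ε) :=
  (hasDerivAt_scaled hf hk hε t).deriv

lemma continuous_deriv_scaled (hf : IsProfile k f) (hk : 1 ≤ k) {ε : ℝ} (hε : 0 < ε) :
    Continuous (deriv (scaled k f ε)) := by
  rw [funext (deriv_scaled hf hk hε)]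
  exact continuous_const.mul (hf.continuous_deriv.comp (continuous_id.div_const ε))

/-- This is why desingularization changes nothing where `|x| ≥ ε`: the additive constants `±2`
disappear under `d`, and `d(f_ε ∘ x)` is exactly `x^{-2k} dx` there. -/
lemma deriv_scaled_of_le (hf : IsProfile k f) (hk : 1 ≤ k) {ε : ℝ} (hε : 0 < ε) {t : ℝ}
    (ht : ε ≤ |t|) : deriv (scaled k f ε) t = (t ^ (2 * k))⁻¹ := by
  rw [deriv_scaled hf hk hε, hf.deriv_of_one_le_abs hk, div_pow]
  · have : ε ≠ 0 := hε.ne'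
    have : t ≠ 0 := fun h => by
      rw [h, abs_zero] at ht
      linarith
    field_simp
  · rw [abs_div, abs_of_pos hε, le_div_iff₀ hε, one_mul]
    exact ht

/-- The factor `ε^{-2k}` of `f_ε'` is compensated by `|t|^{2k} ≤ ε^{2k}`, so the bound of `|f'|` on
`[-1, 1]` works for all `ε`. This controls the Taylor remainder near `Z`. -/
lemma exists_deriv_scaled_bound (hf : IsProfile k f) (hk : 1 ≤ k) :
    ∃ C, 0 ≤ C ∧ ∀ ε, 0 < ε → ∀ t, |t| ≤ ε → |deriv (scaled k f ε) t| * |t| ^ (2 * k) ≤ C := by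
  obtain ⟨C, hC⟩ := (isCompact_Icc (a := (-1 : ℝ)) (b := 1)).exists_bound_of_continuousOn
    hf.continuous_deriv.continuousOn
  refine ⟨C, (norm_nonneg _).trans (hC 0 (by simp)), fun ε hε t ht => ?_⟩
  have h1 : |t / ε| ≤ 1 := by
    rw [abs_div, abs_of_pos hε, div_le_one hε]
    exact ht
  have h2 := hC (t / ε) (abs_le.1 h1)
  rw [Real.norm_eq_abs] at h2
  rw [deriv_scaled hf hk hε, abs_mul, abs_inv, abs_of_pos (pow_pos hε _)]
  have h3 : |t| ^ (2 * k) ≤ ε ^ (2 * k) := pow_le_pow_left₀ (abs_nonneg _) ht _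
  have hC0 : 0 ≤ C := (norm_nonneg _).trans (hC 0 (by simp))
  calc (ε ^ (2 * k))⁻¹ * |deriv f (t / ε)| * |t| ^ (2 * k)
      ≤ (ε ^ (2 * k))⁻¹ * C * ε ^ (2 * k) := by gcongr
    _ = C := by field_simp

/-- Substituting `t = ε s` gives exactly `ε^{m-2k+1} ∫_{-1}^1 f'(s) s^m ds`. The error is zero for
`m < 2k` and for odd `m`, and bounded for even `m ≥ 2k`. -/
lemma exists_core_bound (hf : IsProfile k f) (hk : 1 ≤ k) (m : ℕ) (ε₀ : ℝ) :
    ∃ C, ∀ ε, 0 < ε → ε < ε₀ → |(∫ t in Ioo (-ε) ε, deriv (scaled k f ε) t * t ^ m) -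
      ∑ i ∈ Finset.Icc 1 k, expansionCoeff k
        (fun i => ∫ s in (-1 : ℝ)..1, deriv f s * s ^ (2 * (k - i))) m i *
        ε ^ (-(2 * (i : ℤ) - 1))| ≤ C := by
  set I : ℝ := ∫ s in (-1 : ℝ)..1, deriv f s * s ^ m with hI
  have hint : ∀ ε, 0 < ε → ∫ t in Ioo (-ε) ε, deriv (scaled k f ε) t * t ^ m =
      ε ^ ((m : ℤ) - 2 * k + 1) * I := by
    intro ε hε
    have hne : ε ≠ 0 := hε.ne'
    rw [← integral_Ioc_eq_integral_Ioo, ← intervalIntegral.integral_of_le (by linarith)]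
    have h1 : ∀ t, deriv (scaled k f ε) t * t ^ m =
        ε ^ ((m : ℤ) - 2 * k) * (fun s => deriv f s * s ^ m) (t / ε) := by
      intro t
      simp only
      rw [deriv_scaled hf hk hε, div_pow, zpow_sub₀ hne, zpow_natCast,
        show ((2 : ℤ) * k) = ((2 * k : ℕ) : ℤ) by push_cast; rfl, zpow_natCast]
      field_simp
    rw [intervalIntegral.integral_congr fun t _ => h1 t, intervalIntegral.integral_const_mul,
      intervalIntegral.integral_comp_div (fun s => deriv f s * s ^ m) hne, neg_div, div_self hne,
      zpow_add₀ hne, zpow_one,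
      smul_eq_mul, hI]
    ring
  rcases Nat.even_or_odd m with he | ho
  · by_cases hm : m < 2 * k
    · obtain ⟨i, hi, hik, rfl⟩ : ∃ i, 1 ≤ i ∧ i ≤ k ∧ m = 2 * (k - i) := by
        obtain ⟨l, rfl⟩ := he
        exact ⟨k - l, by omega, by omega, by omega⟩
      have hexp : (((2 * (k - i) : ℕ) : ℤ) - 2 * k + 1) = -(2 * (i : ℤ) - 1) := by
        push_cast [Nat.cast_sub hik]
        ring
      refine ⟨0, fun ε hε h => le_of_eq ?_⟩
      rw [sum_expansionCoeff_of_lt _ hi hik, hint ε hε, hexp, mul_comm, sub_self, abs_zero]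
    · refine ⟨ε₀ ^ ((m : ℤ) - 2 * k + 1) * |I|, fun ε hε h => ?_⟩
      rw [sum_expansionCoeff_eq_zero _ (by omega), hint ε hε, sub_zero, abs_mul,
        abs_of_pos (zpow_pos hε _)]
      have h1 : ε ^ ((m : ℤ) - 2 * k + 1) ≤ ε₀ ^ ((m : ℤ) - 2 * k + 1) :=
        zpow_le_zpow_left₀ (by omega) hε.le h.le
      gcongr
  · have hI0 : I = 0 := by
      have h1 : ∫ s in (-1 : ℝ)..1, (fun s => deriv f s * s ^ m) (-s) = I := by
        rw [intervalIntegral.integral_comp_neg fun s => deriv f s * s ^ m, neg_neg]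
      have h2 : ∫ s in (-1 : ℝ)..1, (fun s => deriv f s * s ^ m) (-s) = -I := by
        rw [hI, ← intervalIntegral.integral_neg]
        refine intervalIntegral.integral_congr fun s _ => ?_
        simp only
        rw [hf.deriv_neg, ho.neg_pow]
        ring
      linarith
    refine ⟨0, fun ε hε h => ?_⟩
    rw [hint ε hε, hI0, sum_expansionCoeff_eq_zero]
    · simp
    · intro i _ _ h
      rw [h] at ho
      exact (Nat.not_even_iff_odd.2 ho) (even_two_mul _)

end Profile

/-! ### Forms in parametrizations and change of variables. -/

section Coordinates

variable {d d' q : ℕ} {M : Type*} [TopologicalSpace M] [ChartedSpace (Euc d) M]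

/-- The value of `η` on the images of the vectors `v i` under the derivative of a map
`Φ : ℝ^{d'} → M`. -/
def coordValue (Φ : Euc d' → M) (η : DForm d M q) (v : Fin q → Euc d') (w : Euc d') : ℝ :=
  η (Φ w) fun i => mfderiv 𝓘(ℝ, Euc d') (𝓡 d) Φ w (v i)

/-- All tangent spaces are the model space by definition, so values at equal but not syntactically
identical base points can be compared. -/
lemma form_apply_congr (η : DForm d M q) {p p' : M} (h : p = p') {v v' : Fin q → Euc d}
    (hv : v = v') : (η p : Euc d [⋀^Fin q]→L[ℝ] ℝ) v = (η p' : Euc d [⋀^Fin q]→L[ℝ] ℝ) v' := by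
  subst h hv
  rfl

lemma inChart_apply (η : DForm d M q) (c : M) (y : Euc d) (v : Fin q → Euc d) :
    inChart η c y v = coordValue (extChartAt (𝓡 d) c).symm η v y := rfl

lemma mdifferentiableAt_of_contMDiffOn {Φ : Euc d' → M} {D : Set (Euc d')} (hD : IsOpen D)
    (hΦ : ContMDiffOn 𝓘(ℝ, Euc d') (𝓡 d) ∞ Φ D) {w : Euc d'} (hw : w ∈ D) :
    MDifferentiableAt 𝓘(ℝ, Euc d') (𝓡 d) Φ w :=
  (hΦ.contMDiffAt (hD.mem_nhds hw)).mdifferentiableAt (by simp)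

lemma isOpen_inter_preimage_source {Φ : Euc d' → M} {D : Set (Euc d')} (hD : IsOpen D)
    (hΦ : ContMDiffOn 𝓘(ℝ, Euc d') (𝓡 d) ∞ Φ D) (c : M) :
    IsOpen (D ∩ Φ ⁻¹' (extChartAt (𝓡 d) c).source) :=
  hΦ.continuousOn.isOpen_inter_preimage hD (isOpen_extChartAt_source c)

lemma image_extChartAt_comp {Φ : Euc d → M} {D : Set (Euc d)} {S : Set M} (hS : S ⊆ Φ '' D) (c : M) :
    (fun w => extChartAt (𝓡 d) c (Φ w)) '' (D ∩ Φ ⁻¹' (S ∩ (extChartAt (𝓡 d) c).source)) =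
      chartPart d S c := by
  ext y
  constructor
  · rintro ⟨w, hw, rfl⟩
    refine ⟨(extChartAt (𝓡 d) c).map_source hw.2.2, ?_⟩
    rw [mem_preimage, (extChartAt (𝓡 d) c).left_inv hw.2.2]
    exact hw.2.1
  · rintro ⟨hy, hyS⟩
    obtain ⟨w, hw, hwy⟩ := hS hyS
    refine ⟨w, ⟨hw, ?_⟩, ?_⟩
    · rw [mem_preimage, hwy]
      exact ⟨hyS, (extChartAt (𝓡 d) c).map_target hy⟩
    · simp only [hwy]
      exact (extChartAt (𝓡 d) c).right_inv hy

variable [IsManifold (𝓡 d) ∞ M]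

lemma mdifferentiableAt_extChartAt_symm_of_mem {c : M} {y : Euc d}
    (hy : y ∈ (extChartAt (𝓡 d) c).target) :
    MDifferentiableAt 𝓘(ℝ, Euc d) (𝓡 d) (extChartAt (𝓡 d) c).symm y :=
  ((contMDiffOn_extChartAt_symm (n := ∞) c).contMDiffAt
    ((isOpen_extChartAt_target c).mem_nhds hy)).mdifferentiableAt (by simp)

/-- Locally `Φ` is the inverse chart composed with the transition map `extChartAt ∘ Φ`; the chain
rule turns `dΦ` into the derivative of a map between Euclidean spaces. -/
lemma coordValue_eq_inChart (Φ : Euc d' → M) (η : DForm d M q) (v : Fin q → Euc d') {w : Euc d'}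
    (hΦ : MDifferentiableAt 𝓘(ℝ, Euc d') (𝓡 d) Φ w) {c : M}
    (hc : Φ w ∈ (extChartAt (𝓡 d) c).source) :
    coordValue Φ η v w = inChart η c (extChartAt (𝓡 d) c (Φ w))
      fun i => fderiv ℝ (fun w => extChartAt (𝓡 d) c (Φ w)) w (v i) := by
  rw [inChart_apply]
  have hs := (extChartAt (𝓡 d) c).left_inv hc
  refine form_apply_congr η hs.symm ?_
  funext i
  have h1 : MDifferentiableAt (𝓡 d) 𝓘(ℝ, Euc d) (extChartAt (𝓡 d) c) (Φ w) :=
    ((contMDiffOn_extChartAt (n := ∞)).contMDiffAt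
      ((chartAt (Euc d) c).open_source.mem_nhds (by simpa using hc))).mdifferentiableAt (by simp)
  have h2 : MDifferentiableAt 𝓘(ℝ, Euc d') 𝓘(ℝ, Euc d) (fun w => extChartAt (𝓡 d) c (Φ w)) w :=
    h1.comp w hΦ
  have h3 := mdifferentiableAt_extChartAt_symm_of_mem ((extChartAt (𝓡 d) c).map_source hc)
  have h4 : Φ =ᶠ[𝓝 w] fun w => (extChartAt (𝓡 d) c).symm (extChartAt (𝓡 d) c (Φ w)) := by
    filter_upwards [hΦ.continuousAt.preimage_mem_nhds
      ((isOpen_extChartAt_source c).mem_nhds hc)] with w' hw'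
    exact ((extChartAt (𝓡 d) c).left_inv hw').symm
  have h5 := mfderiv_comp w h3 h2
  have h6 := h4.mfderiv_eq (I := 𝓘(ℝ, Euc d')) (I' := 𝓡 d)
  have h7 := congrArg (fun L : Euc d' →L[ℝ] Euc d => L (v i)) (h6.trans h5)
  rw [mfderiv_eq_fderiv] at h7
  exact h7

/-- Expansion in the standard basis. It reduces smoothness of a varying form on varying vectors to
its values on constant vectors. -/
lemma alternating_apply_eq_sum (f : Euc d [⋀^Fin q]→L[ℝ] ℝ) (v : Fin q → Euc d) :
    f v = ∑ κ : Fin q → Fin d, (∏ i, v i (κ i)) * f fun i => EuclideanSpace.single (κ i) 1 := by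
  have h : v = fun i => ∑ j : Fin d, v i j • EuclideanSpace.single j (1 : ℝ) := by
    funext i
    have := (EuclideanSpace.basisFun (Fin d) ℝ).sum_repr (v i)
    simpa using this.symm
  have h1 := f.toMultilinearMap.map_sum (fun i (j : Fin d) => v i j • EuclideanSpace.single j (1 : ℝ))
  have h2 : f v = ∑ κ : Fin q → Fin d,
      f.toMultilinearMap fun i => v i (κ i) • EuclideanSpace.single (κ i) (1 : ℝ) := by
    rw [← h1, ← h]
    rfl
  rw [h2]
  refine Finset.sum_congr rfl fun κ _ => ?_
  rw [MultilinearMap.map_smul_univ]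
  rfl

lemma contDiffOn_alternating_apply {E : Type*} [NormedAddCommGroup E] [NormedSpace ℝ E] {s : Set E}
    {f : E → Euc d [⋀^Fin q]→L[ℝ] ℝ} {g : Fin q → E → Euc d} (hf : ContDiffOn ℝ ∞ f s)
    (hg : ∀ i, ContDiffOn ℝ ∞ (g i) s) : ContDiffOn ℝ ∞ (fun w => f w fun i => g i w) s := by
  have h : (fun w => f w fun i => g i w) = fun w => ∑ κ : Fin q → Fin d,
      (∏ i, g i w (κ i)) * f w fun i => EuclideanSpace.single (κ i) 1 :=
    funext fun w => alternating_apply_eq_sum (f w) fun i => g i w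
  rw [h]
  refine ContDiffOn.sum fun κ _ => ContDiffOn.mul (contDiffOn_prod fun i _ => ?_) ?_
  · exact (EuclideanSpace.proj (κ i) : Euc d →L[ℝ] ℝ).contDiff.comp_contDiffOn (hg i)
  · exact (ContinuousAlternatingMap.apply ℝ (Euc d) ℝ fun i =>
      EuclideanSpace.single (κ i) 1).contDiff.comp_contDiffOn hf

lemma contDiffOn_extChartAt_comp {Φ : Euc d' → M} {D : Set (Euc d')}
    (hΦ : ContMDiffOn 𝓘(ℝ, Euc d') (𝓡 d) ∞ Φ D) (c : M) :
    ContDiffOn ℝ ∞ (fun w => extChartAt (𝓡 d) c (Φ w))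
      (D ∩ Φ ⁻¹' (extChartAt (𝓡 d) c).source) := by
  rw [← contMDiffOn_iff_contDiffOn]
  refine (contMDiffOn_extChartAt (n := ∞)).comp (hΦ.mono inter_subset_left) fun w hw => ?_
  simpa using hw.2

lemma contDiffOn_coordValue {Φ : Euc d' → M} {D : Set (Euc d')} (hD : IsOpen D)
    (hΦ : ContMDiffOn 𝓘(ℝ, Euc d') (𝓡 d) ∞ Φ D) {η : DForm d M q} {U : Set M}
    (hη : IsSmoothOn η U) (hU : MapsTo Φ D U) (v : Fin q → Euc d') :
    ContDiffOn ℝ ∞ (coordValue Φ η v) D := by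
  intro w hw
  set c := Φ w
  have hO := isOpen_inter_preimage_source hD hΦ c
  have hψ := contDiffOn_extChartAt_comp hΦ c
  have hwO : w ∈ D ∩ Φ ⁻¹' (extChartAt (𝓡 d) c).source := ⟨hw, mem_extChartAt_source c⟩
  have h1 : ContDiffOn ℝ ∞ (fun w => inChart η c (extChartAt (𝓡 d) c (Φ w)))
      (D ∩ Φ ⁻¹' (extChartAt (𝓡 d) c).source) := by
    refine (hη c).comp hψ fun w hw => ⟨(extChartAt (𝓡 d) c).map_source hw.2, ?_⟩
    rw [mem_preimage, (extChartAt (𝓡 d) c).left_inv hw.2]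
    exact hU hw.1
  have h2 := contDiffOn_alternating_apply h1 (g := fun i w =>
    fderiv ℝ (fun w => extChartAt (𝓡 d) c (Φ w)) w (v i)) fun i =>
      (hψ.fderiv_of_isOpen (m := ∞) hO (by simp)).clm_apply contDiffOn_const
  have h3 : ContDiffOn ℝ ∞ (coordValue Φ η v) (D ∩ Φ ⁻¹' (extChartAt (𝓡 d) c).source) :=
    h2.congr fun w hw => coordValue_eq_inChart Φ η v
      (mdifferentiableAt_of_contMDiffOn hD hΦ hw.1) hw.2
  exact (h3.contDiffAt (hO.mem_nhds hwO)).contDiffWithinAt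

/-- The density of a top degree form in a parametrization `Φ`, with the sign of the orientation. -/
def signedValue (Φ : Euc d → M) (μ : DForm d M d) (hq : q = d) (η : DForm d M q) (w : Euc d) : ℝ :=
  (SignType.sign (coordValue Φ μ (fun i => EuclideanSpace.single i 1) w) : ℝ) *
    coordValue Φ η (fun i => EuclideanSpace.single (Fin.cast hq i) 1) w

lemma alternating_apply_map (f : Euc d [⋀^Fin d]→L[ℝ] ℝ) (A : Euc d →L[ℝ] Euc d) :
    f (fun i => A (EuclideanSpace.single i 1)) = A.det * f fun i => EuclideanSpace.single i 1 := by
  set e := (EuclideanSpace.basisFun (Fin d) ℝ).toBasis with he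
  have he' : ∀ i, e i = EuclideanSpace.single i 1 := fun i => by simp [he]
  have h := f.toAlternatingMap.eq_smul_basis_det e
  have h1 : ∀ v, f v = f (fun i => EuclideanSpace.single i 1) * e.det v := by
    intro v
    have := congrArg (fun g : Euc d [⋀^Fin d]→ₗ[ℝ] ℝ => g v) h
    simp only [AlternatingMap.smul_apply, smul_eq_mul] at this
    rw [← funext he']
    exact this
  rw [h1]
  have h2 := e.det_comp (A : Euc d →ₗ[ℝ] Euc d) e
  rw [e.det_self, mul_one] at h2
  have h3 : e.det (fun i => A (EuclideanSpace.single i 1)) = A.det := by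
    simp only [← he']
    exact h2
  rw [h3, mul_comm]

/-- Both the orientation form and the integrand pick up the determinant of the transition map, and
`sign(det) · det = |det|`. Hence the signed density transforms like a measure, whether or not `Φ`
preserves orientation. -/
lemma signedValue_eq_abs_det (Φ : Euc d → M) (μ : DForm d M d) (hq : q = d) (η : DForm d M q)
    {w : Euc d} (hΦ : MDifferentiableAt 𝓘(ℝ, Euc d) (𝓡 d) Φ w) {c : M}
    (hc : Φ w ∈ (extChartAt (𝓡 d) c).source) :
    signedValue Φ μ hq η w = |(fderiv ℝ (fun w => extChartAt (𝓡 d) c (Φ w)) w).det| *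
      signedValue (extChartAt (𝓡 d) c).symm μ hq η (extChartAt (𝓡 d) c (Φ w)) := by
  subst hq
  simp only [signedValue, Fin.cast_eq_self]
  rw [coordValue_eq_inChart Φ μ _ hΦ hc, coordValue_eq_inChart Φ η _ hΦ hc, alternating_apply_map,
    alternating_apply_map, sign_mul, ← inChart_apply, ← inChart_apply, SignType.coe_mul,
    ← sign_mul_self (ContinuousLinearMap.det _)]
  ring

/-- Change of variables from a chart to a parametrization `Φ`. -/
lemma setIntegral_chartPart {Φ : Euc d → M} {D : Set (Euc d)} (hD : IsOpen D)
    (hΦ : ContMDiffOn 𝓘(ℝ, Euc d) (𝓡 d) ∞ Φ D) (hinj : InjOn Φ D) {S : Set M} (hS : S ⊆ Φ '' D)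
    (hmeas : MeasurableSet (D ∩ Φ ⁻¹' S)) (μ : DForm d M d) (hq : q = d) (η : DForm d M q)
    (g : M → ℝ) (c : M) :
    (∫ y in chartPart d S c, g ((extChartAt (𝓡 d) c).symm y) *
        signedValue (extChartAt (𝓡 d) c).symm μ hq η y =
      ∫ w in D ∩ Φ ⁻¹' (S ∩ (extChartAt (𝓡 d) c).source), g (Φ w) * signedValue Φ μ hq η w) ∧
    (IntegrableOn (fun y => g ((extChartAt (𝓡 d) c).symm y) *
        signedValue (extChartAt (𝓡 d) c).symm μ hq η y) (chartPart d S c) ↔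
      IntegrableOn (fun w => g (Φ w) * signedValue Φ μ hq η w)
        (D ∩ Φ ⁻¹' (S ∩ (extChartAt (𝓡 d) c).source))) := by
  have hO := isOpen_inter_preimage_source hD hΦ c
  have hs : D ∩ Φ ⁻¹' (S ∩ (extChartAt (𝓡 d) c).source) =
      (D ∩ Φ ⁻¹' S) ∩ (D ∩ Φ ⁻¹' (extChartAt (𝓡 d) c).source) := by
    ext w
    simp only [mem_inter_iff, mem_preimage]
    tauto
  have hm : MeasurableSet (D ∩ Φ ⁻¹' (S ∩ (extChartAt (𝓡 d) c).source)) := by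
    rw [hs]
    exact hmeas.inter hO.measurableSet
  have hf : ∀ w ∈ D ∩ Φ ⁻¹' (S ∩ (extChartAt (𝓡 d) c).source),
      HasFDerivWithinAt (fun w => extChartAt (𝓡 d) c (Φ w))
        (fderiv ℝ (fun w => extChartAt (𝓡 d) c (Φ w)) w)
        (D ∩ Φ ⁻¹' (S ∩ (extChartAt (𝓡 d) c).source)) w := fun w hw =>
    (((contDiffOn_extChartAt_comp hΦ c).differentiableOn (by simp)).differentiableAt
      (hO.mem_nhds ⟨hw.1, hw.2.2⟩)).hasFDerivAt.hasFDerivWithinAt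
  have hi : InjOn (fun w => extChartAt (𝓡 d) c (Φ w))
      (D ∩ Φ ⁻¹' (S ∩ (extChartAt (𝓡 d) c).source)) := fun w hw w' hw' h =>
    hinj hw.1 hw'.1 ((extChartAt (𝓡 d) c).injOn hw.2.2 hw'.2.2 h)
  have he : EqOn (fun w => |(fderiv ℝ (fun w => extChartAt (𝓡 d) c (Φ w)) w).det| •
      (g ((extChartAt (𝓡 d) c).symm (extChartAt (𝓡 d) c (Φ w))) *
        signedValue (extChartAt (𝓡 d) c).symm μ hq η (extChartAt (𝓡 d) c (Φ w))))
      (fun w => g (Φ w) * signedValue Φ μ hq η w)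
      (D ∩ Φ ⁻¹' (S ∩ (extChartAt (𝓡 d) c).source)) := by
    intro w hw
    simp only [smul_eq_mul]
    rw [signedValue_eq_abs_det Φ μ hq η (mdifferentiableAt_of_contMDiffOn hD hΦ hw.1) hw.2.2,
      (extChartAt (𝓡 d) c).left_inv hw.2.2]
    ring
  rw [← image_extChartAt_comp hS c]
  constructor
  · rw [integral_image_eq_integral_abs_det_fderiv_smul volume hm hf hi]
    exact setIntegral_congr_fun hm he
  · rw [integrableOn_image_iff_integrableOn_abs_det_fderiv_smul volume hm hf hi]
    exact integrableOn_congr_fun he hm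

end Coordinates

/-! ### The integral over a manifold and its independence of the parametrization. -/

section Partition

variable {d q : ℕ} {M : Type*} [TopologicalSpace M] [ChartedSpace (Euc d) M]

lemma chartPart_union (S S' : Set M) (c : M) :
    chartPart d (S ∪ S') c = chartPart d S c ∪ chartPart d S' c := by
  rw [chartPart, preimage_union, inter_union_distrib_left]
  rfl

variable [IsManifold (𝓡 d) ∞ M] [T2Space M]

lemma tsupport_chartPartition_subset [SigmaCompactSpace M] (c : M) :
    tsupport (chartPartition d M c) ⊆ (extChartAt (𝓡 d) c).source := by
  rw [extChartAt_source]
  exact (SmoothPartitionOfUnity.exists_isSubordinate_chartAt_source (𝓡 d) M).choose_spec c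

lemma chartPartition_eq_zero [SigmaCompactSpace M] {c p : M}
    (hp : p ∉ (extChartAt (𝓡 d) c).source) : chartPartition d M c p = 0 :=
  image_eq_zero_of_notMem_tsupport fun h => hp (tsupport_chartPartition_subset c h)

lemma continuous_chartPartition [SigmaCompactSpace M] (c : M) :
    Continuous (chartPartition d M c) :=
  (chartPartition d M c).contMDiff.continuous

/-- The density whose integral over a part of the chart at `c` enters the definition of
`integralOn`. -/
def chartDensity [SigmaCompactSpace M] (μ : DForm d M d) (hq : q = d) (η : DForm d M q) (c : M)
    (y : Euc d) : ℝ :=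
  chartPartition d M c ((extChartAt (𝓡 d) c).symm y) *
    signedValue (extChartAt (𝓡 d) c).symm μ hq η y

/-- Integrability of a top degree form over a set, chart by chart. -/
def IsIntegrableOn [SigmaCompactSpace M] (μ : DForm d M d) (S : Set M) (hq : q = d)
    (η : DForm d M q) : Prop :=
  ∀ c, IntegrableOn (chartDensity μ hq η c) (chartPart d S c)

variable [CompactSpace M]

lemma exists_finset_chartPartition (d : ℕ) (M : Type*) [TopologicalSpace M]
    [ChartedSpace (Euc d) M] [IsManifold (𝓡 d) ∞ M] [T2Space M] [CompactSpace M] :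
    ∃ F : Finset M, (∀ c, c ∉ F → ∀ p, chartPartition d M c p = 0) ∧
      ∀ p, ∑ c ∈ F, chartPartition d M c p = 1 := by
  have hfin := (chartPartition d M).locallyFinite.finite_nonempty_of_compact
  have h0 : ∀ c, c ∉ hfin.toFinset → ∀ p, chartPartition d M c p = 0 := by
    intro c hc p
    by_contra h
    exact hc (hfin.mem_toFinset.2 ⟨p, h⟩)
  refine ⟨hfin.toFinset, h0, fun p => ?_⟩
  rw [← (chartPartition d M).sum_eq_one (mem_univ p), finsum_eq_sum_of_support_subset]
  intro c hc
  by_contra h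
  exact hc (h0 c h p)

lemma integralOn_eq_sum {F : Finset M} (hF : ∀ c, c ∉ F → ∀ p, chartPartition d M c p = 0)
    (μ : DForm d M d) (S : Set M) (hq : q = d) (η : DForm d M q) :
    integralOn μ S hq η = ∑ c ∈ F, ∫ y in chartPart d S c, chartDensity μ hq η c y := by
  refine finsum_eq_sum_of_support_subset _ fun c hc => ?_
  by_contra h
  refine hc ?_
  simp only
  rw [← integral_zero (Euc d) ℝ]
  congr 1
  funext y
  rw [hF c h, zero_mul]

lemma IsIntegrableOn.union {μ : DForm d M d} {S S' : Set M} {hq : q = d} {η : DForm d M q}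
    (h : IsIntegrableOn μ S hq η) (h' : IsIntegrableOn μ S' hq η) :
    IsIntegrableOn μ (S ∪ S') hq η := fun c => by
  rw [chartPart_union]
  exact (h c).union (h' c)

lemma integralOn_union {μ : DForm d M d} {S S' : Set M} {hq : q = d} {η : DForm d M q}
    (hd : Disjoint S S') (hS' : ∀ c, MeasurableSet (chartPart d S' c))
    (h : IsIntegrableOn μ S hq η) (h' : IsIntegrableOn μ S' hq η) :
    integralOn μ (S ∪ S') hq η = integralOn μ S hq η + integralOn μ S' hq η := by
  obtain ⟨F, hF, -⟩ := exists_finset_chartPartition d M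
  rw [integralOn_eq_sum hF, integralOn_eq_sum hF, integralOn_eq_sum hF, ← Finset.sum_add_distrib]
  refine Finset.sum_congr rfl fun c _ => ?_
  rw [chartPart_union]
  refine setIntegral_union ?_ (hS' c) (h c) (h' c)
  rw [Set.disjoint_left] at hd ⊢
  exact fun y hy hy' => hd hy.2 hy'.2

lemma chartDensity_congr {μ : DForm d M d} {S : Set M} {hq : q = d} {η η' : DForm d M q}
    (h : ∀ p ∈ S, η p = η' p) (c : M) :
    EqOn (chartDensity μ hq η c) (chartDensity μ hq η' c) (chartPart d S c) := by
  intro y hy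
  simp only [chartDensity, signedValue, coordValue]
  rw [h _ hy.2]

lemma integralOn_congr {μ : DForm d M d} {S : Set M} {hq : q = d} {η η' : DForm d M q}
    (hS : ∀ c, MeasurableSet (chartPart d S c)) (h : ∀ p ∈ S, η p = η' p) :
    integralOn μ S hq η = integralOn μ S hq η' := by
  obtain ⟨F, hF, -⟩ := exists_finset_chartPartition d M
  rw [integralOn_eq_sum hF, integralOn_eq_sum hF]
  exact Finset.sum_congr rfl fun c _ => setIntegral_congr_fun (hS c) (chartDensity_congr h c)

lemma IsIntegrableOn.congr {μ : DForm d M d} {S : Set M} {hq : q = d} {η η' : DForm d M q}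
    (hS : ∀ c, MeasurableSet (chartPart d S c)) (h : ∀ p ∈ S, η p = η' p)
    (hη : IsIntegrableOn μ S hq η) : IsIntegrableOn μ S hq η' := fun c =>
  (integrableOn_congr_fun (chartDensity_congr h c) (hS c)).1 (hη c)

/-- The integral of a top degree form is the sum of the integrals over parametrized pieces, cut out
by a partition of unity. -/
lemma integralOn_eq_sum_parametrizations {I : Type*} (E : Finset I) (χ : I → M → ℝ)
    (Φ : I → Euc d → M) (D : I → Set (Euc d)) {S : Set M} (hD : ∀ e, IsOpen (D e))
    (hΦ : ∀ e, ContMDiffOn 𝓘(ℝ, Euc d) (𝓡 d) ∞ (Φ e) (D e)) (hinj : ∀ e, InjOn (Φ e) (D e))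
    (hS : ∀ c, MeasurableSet (chartPart d S c)) (hDS : ∀ e, MeasurableSet (D e ∩ Φ e ⁻¹' S))
    (hχ : ∀ p ∈ S, ∑ e ∈ E, χ e p = 1) (hχ0 : ∀ e, ∀ p ∈ S, p ∉ Φ e '' D e → χ e p = 0)
    (μ : DForm d M d) (hq : q = d) (η : DForm d M q)
    (hint : ∀ e ∈ E, IntegrableOn (fun w => χ e (Φ e w) * signedValue (Φ e) μ hq η w)
      (D e ∩ Φ e ⁻¹' S)) :
    IsIntegrableOn μ S hq η ∧ integralOn μ S hq η =
      ∑ e ∈ E, ∫ w in D e ∩ Φ e ⁻¹' S, χ e (Φ e w) * signedValue (Φ e) μ hq η w := by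
  have hset : ∀ e, D e ∩ Φ e ⁻¹' (S ∩ Φ e '' D e) = D e ∩ Φ e ⁻¹' S := by
    intro e
    ext w
    simp only [mem_inter_iff, mem_preimage]
    exact ⟨fun h => ⟨h.1, h.2.1⟩, fun h => ⟨h.1, h.2, mem_image_of_mem _ h.1⟩⟩
  -- Each chart density is split by inserting `∑ χ e = 1`, so that every piece lies in the
  -- intersection of a chart with one parametrized piece.
  have hsplit : ∀ c, EqOn (chartDensity μ hq η c) (fun y => ∑ e ∈ E,
      (fun p => chartPartition d M c p * χ e p) ((extChartAt (𝓡 d) c).symm y) *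
        signedValue (extChartAt (𝓡 d) c).symm μ hq η y) (chartPart d S c) := by
    intro c y hy
    simp only [chartDensity]
    rw [← Finset.sum_mul, ← Finset.mul_sum, hχ _ hy.2, mul_one]
  have hsub : ∀ c e, chartPart d (S ∩ Φ e '' D e) c ⊆ chartPart d S c := fun c e y hy =>
    ⟨hy.1, hy.2.1⟩
  have hzero : ∀ c e, ∀ y ∈ chartPart d S c \ chartPart d (S ∩ Φ e '' D e) c,
      (fun p => chartPartition d M c p * χ e p) ((extChartAt (𝓡 d) c).symm y) *
        signedValue (extChartAt (𝓡 d) c).symm μ hq η y = 0 := by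
    intro c e y hy
    simp only
    rw [hχ0 e _ hy.1.2 fun h => hy.2 ⟨hy.1.1, hy.1.2, h⟩, mul_zero, zero_mul]
  have hcov := fun c e => setIntegral_chartPart (hD e) (hΦ e) (hinj e)
    (S := S ∩ Φ e '' D e) inter_subset_right (by rw [hset e]; exact hDS e) μ hq η
    (fun p => chartPartition d M c p * χ e p) c
  have hint' : ∀ c, ∀ e ∈ E, IntegrableOn (fun w => chartPartition d M c (Φ e w) *
      (χ e (Φ e w) * signedValue (Φ e) μ hq η w)) (D e ∩ Φ e ⁻¹' S) := by
    intro c e he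
    refine (hint e he).bdd_mul (c := 1) ?_ ?_
    · exact (((continuous_chartPartition c).comp_continuousOn (hΦ e).continuousOn).mono
        inter_subset_left).aestronglyMeasurable (hDS e)
    · refine Filter.Eventually.of_forall fun w => ?_
      rw [Real.norm_eq_abs, abs_of_nonneg ((chartPartition d M).nonneg c _)]
      exact (chartPartition d M).le_one c _
  have hsub2 : ∀ c e, D e ∩ Φ e ⁻¹' (S ∩ Φ e '' D e ∩ (extChartAt (𝓡 d) c).source) ⊆
      D e ∩ Φ e ⁻¹' S := fun c e w hw => ⟨hw.1, hw.2.1.1⟩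
  have hIe : ∀ c, ∀ e ∈ E, IntegrableOn (fun y =>
      (fun p => chartPartition d M c p * χ e p) ((extChartAt (𝓡 d) c).symm y) *
        signedValue (extChartAt (𝓡 d) c).symm μ hq η y) (chartPart d S c) := by
    intro c e he
    refine IntegrableOn.of_forall_sdiff_eq_zero ((hcov c e).2.2 ?_) (hS c) (hzero c e)
    simp only [mul_assoc]
    exact (hint' c e he).mono_set (hsub2 c e)
  refine ⟨fun c => (integrableOn_congr_fun (hsplit c) (hS c)).2
    (integrable_finsetSum _ fun e he => hIe c e he), ?_⟩
  obtain ⟨F, hF, hF1⟩ := exists_finset_chartPartition d M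
  rw [integralOn_eq_sum hF]
  have h1 : ∀ c, ∫ y in chartPart d S c, chartDensity μ hq η c y =
      ∑ e ∈ E, ∫ w in D e ∩ Φ e ⁻¹' S, chartPartition d M c (Φ e w) *
        (χ e (Φ e w) * signedValue (Φ e) μ hq η w) := by
    intro c
    rw [setIntegral_congr_fun (hS c) (hsplit c), integral_finsetSum _ fun e he => hIe c e he]
    refine Finset.sum_congr rfl fun e he => ?_
    rw [setIntegral_eq_of_subset_of_forall_sdiff_eq_zero (hS c) (hsub c e) (hzero c e),
      (hcov c e).1]
    simp only [mul_assoc]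
    symm
    refine setIntegral_eq_of_subset_of_forall_sdiff_eq_zero (hDS e) (hsub2 c e) fun w hw => ?_
    rw [chartPartition_eq_zero, zero_mul]
    exact fun h => hw.2 ⟨hw.1.1, ⟨hw.1.2, mem_image_of_mem _ hw.1.1⟩, h⟩
  -- After the change of variables the chart partition of `M` is summed first; it adds up to `1` and
  -- disappears from the formula.
  rw [Finset.sum_congr rfl fun c _ => h1 c, Finset.sum_comm]
  refine Finset.sum_congr rfl fun e he => ?_
  rw [← integral_finsetSum _ fun c _ => hint' c e he]
  congr 1
  funext w
  rw [← Finset.sum_mul, hF1, one_mul]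

end Partition

/-! ### Splitting off the first coordinate, with its measure. -/

section ConsCoordinates

variable {d : ℕ}

/-- The identification of `ℝ × ℝ^d` with `ℝ^{d+1}`. -/
def consEquiv (d : ℕ) : (ℝ × Euc d) ≃L[ℝ] Euc (d + 1) :=
  LinearEquiv.toContinuousLinearEquiv
    { toFun := fun p => WithLp.toLp 2 (Fin.cons p.1 p.2)
      invFun := fun w => (w 0, WithLp.toLp 2 fun i => w i.succ)
      map_add' := fun p p' => by
        ext i
        refine Fin.cases ?_ (fun i => ?_) i <;> simp
      map_smul' := fun c p => by
        ext i
        refine Fin.cases ?_ (fun i => ?_) i <;> simp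
      left_inv := fun p => by
        ext <;> simp
      right_inv := fun w => by
        ext i
        refine Fin.cases ?_ (fun i => ?_) i <;> simp }

lemma consEquiv_one : consEquiv d (1, 0) = EuclideanSpace.single 0 1 := by
  ext i
  change (Fin.cons (1 : ℝ) (0 : Euc d) : Fin (d + 1) → ℝ) i = _
  refine Fin.cases ?_ (fun i => ?_) i <;> simp [EuclideanSpace.single]

lemma consEquiv_single (i : Fin d) :
    consEquiv d (0, EuclideanSpace.single i 1) = EuclideanSpace.single i.succ 1 := by
  ext j
  change (Fin.cons (0 : ℝ) (EuclideanSpace.single i (1 : ℝ)) : Fin (d + 1) → ℝ) j = _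
  refine Fin.cases ?_ (fun j => ?_) j
  · simp [(Fin.succ_ne_zero i).symm]
  · simp [Pi.single_apply]

lemma measurePreserving_consEquiv_symm (d : ℕ) :
    MeasurePreserving (consEquiv d).symm := by
  have h1 := PiLp.volume_preserving_ofLp (Fin (d + 1))
  have h2 := volume_preserving_piFinSuccAbove (fun _ : Fin (d + 1) => ℝ) 0
  have h3 := (MeasurePreserving.id (volume : Measure ℝ)).prod (PiLp.volume_preserving_toLp (Fin d))
  exact (h3.comp h2).comp h1

lemma measurableEmbedding_consEquiv_symm (d : ℕ) : MeasurableEmbedding (consEquiv d).symm :=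
  (consEquiv d).symm.toHomeomorph.measurableEmbedding

end ConsCoordinates

/-! ### Product coordinates on the tubular neighbourhood. -/

section Tube

variable {d : ℕ} {M : Type*} [TopologicalSpace M]
  {Z : Type*} [TopologicalSpace Z] [ChartedSpace (Euc d) Z]
  {x : M → ℝ} {ι : Z → M} {r : ℝ} {T : OpenPartialHomeomorph M (Z × ℝ)}

/-- The parametrization of the part of a tubular neighbourhood over the chart at `e`. -/
def tubeParam (T : OpenPartialHomeomorph M (Z × ℝ)) (e : Z) (w : Euc (d + 1)) : M :=
  T.symm ((extChartAt (𝓡 d) e).symm ((consEquiv d).symm w).2, ((consEquiv d).symm w).1)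

lemma tubeParam_consEquiv (e : Z) (t : ℝ) (y : Euc d) :
    tubeParam T e (consEquiv d (t, y)) = T.symm ((extChartAt (𝓡 d) e).symm y, t) := by
  rw [tubeParam, (consEquiv d).symm_apply_apply]

variable [ChartedSpace (Euc (d + 1)) M]

/-- The domain of `tubeParam`. -/
def tubeDomain (d : ℕ) {Z : Type*} [TopologicalSpace Z] [ChartedSpace (Euc d) Z] (r : ℝ) (e : Z) :
    Set (Euc (d + 1)) :=
  (consEquiv d).symm ⁻¹' (Ioo (-r) r ×ˢ (extChartAt (𝓡 d) e).target)

lemma isOpen_tubeDomain (r : ℝ) (e : Z) : IsOpen (tubeDomain d r e) :=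
  (isOpen_Ioo.prod (isOpen_extChartAt_target e)).preimage (consEquiv d).symm.continuous

lemma consEquiv_mem_tubeDomain {e : Z} {t : ℝ} {y : Euc d} :
    consEquiv d (t, y) ∈ tubeDomain d r e ↔ t ∈ Ioo (-r) r ∧ y ∈ (extChartAt (𝓡 d) e).target := by
  rw [tubeDomain, mem_preimage, (consEquiv d).symm_apply_apply, mem_prod]

namespace IsTube

variable (hT : IsTube (d := d) x ι r T)
include hT

lemma mem_target {z : Z} {t : ℝ} : (z, t) ∈ T.target ↔ t ∈ Ioo (-r) r := by
  rw [hT.target_eq]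
  simp

lemma tubeParam_mem {e : Z} {w : Euc (d + 1)} (hw : w ∈ tubeDomain d r e) :
    tubeParam T e w ∈ T.source :=
  T.map_target (hT.mem_target.2 hw.1)

lemma apply_tubeParam {e : Z} {w : Euc (d + 1)} (hw : w ∈ tubeDomain d r e) :
    T (tubeParam T e w) =
      ((extChartAt (𝓡 d) e).symm ((consEquiv d).symm w).2, ((consEquiv d).symm w).1) :=
  T.right_inv (hT.mem_target.2 hw.1)

lemma x_tubeParam {e : Z} {w : Euc (d + 1)} (hw : w ∈ tubeDomain d r e) :
    x (tubeParam T e w) = ((consEquiv d).symm w).1 := by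
  rw [← hT.snd_eq _ (hT.tubeParam_mem hw), hT.apply_tubeParam hw]

lemma injOn_tubeParam (e : Z) : InjOn (tubeParam T e) (tubeDomain d r e) := by
  intro w hw w' hw' h
  have h1 := congrArg T h
  rw [hT.apply_tubeParam hw, hT.apply_tubeParam hw', Prod.mk.injEq] at h1
  refine (consEquiv d).symm.injective (Prod.ext h1.2 ?_)
  exact (extChartAt (𝓡 d) e).symm.injOn hw.2 hw'.2 h1.1

lemma mem_image_tubeParam {e : Z} {p : M} (hp : p ∈ T.source)
    (he : (T p).1 ∈ (extChartAt (𝓡 d) e).source) : p ∈ tubeParam T e '' tubeDomain d r e := by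
  have h1 : T p ∈ T.target := T.map_source hp
  refine ⟨consEquiv d ((T p).2, extChartAt (𝓡 d) e (T p).1),
    consEquiv_mem_tubeDomain.2 ⟨hT.mem_target.1 h1, (extChartAt (𝓡 d) e).map_source he⟩, ?_⟩
  rw [tubeParam_consEquiv, (extChartAt (𝓡 d) e).left_inv he]
  exact T.left_inv hp

variable [IsManifold (𝓡 d) ∞ Z]

lemma contMDiffOn_tubeParam (e : Z) :
    ContMDiffOn 𝓘(ℝ, Euc (d + 1)) (𝓡 (d + 1)) ∞ (tubeParam T e) (tubeDomain d r e) := by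
  refine hT.smooth_symm.comp (t := T.target) (f := fun w : Euc (d + 1) =>
    ((extChartAt (𝓡 d) e).symm ((consEquiv d).symm w).2, ((consEquiv d).symm w).1)) ?_
    fun w hw => hT.mem_target.2 hw.1
  refine ContMDiffOn.prodMk ?_ ?_
  · exact (contMDiffOn_extChartAt_symm (n := ∞) e).comp
      (contDiff_snd.comp (consEquiv d).symm.contDiff).contMDiff.contMDiffOn fun w hw => hw.2
  · exact (contDiff_fst.comp (consEquiv d).symm.contDiff).contMDiff.contMDiffOn

lemma mdifferentiableAt_tubeParam {e : Z} {w : Euc (d + 1)} (hw : w ∈ tubeDomain d r e) :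
    MDifferentiableAt 𝓘(ℝ, Euc (d + 1)) (𝓡 (d + 1)) (tubeParam T e) w :=
  mdifferentiableAt_of_contMDiffOn (isOpen_tubeDomain r e) (hT.contMDiffOn_tubeParam e) hw

/-- In these coordinates `x` is the first coordinate and `π` is the inverse chart of the remaining
ones. This lemma and the next two differentiate these identities and the corresponding one for a
slice by the chain rule. -/
lemma mfderiv_apply_tubeParam (hx : ContMDiff (𝓡 (d + 1)) 𝓘(ℝ) ∞ x) {e : Z} {w : Euc (d + 1)}
    (hw : w ∈ tubeDomain d r e) (v : Euc (d + 1)) :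
    (mfderiv (𝓡 (d + 1)) 𝓘(ℝ) x (tubeParam T e w)
      (mfderiv 𝓘(ℝ, Euc (d + 1)) (𝓡 (d + 1)) (tubeParam T e) w v) : ℝ) =
      ((consEquiv d).symm v).1 := by
  have h1 := mfderiv_comp w ((hx _).mdifferentiableAt (by simp)) (hT.mdifferentiableAt_tubeParam hw)
  have h2 : x ∘ tubeParam T e =ᶠ[𝓝 w] fun w => ((consEquiv d).symm w).1 := by
    filter_upwards [(isOpen_tubeDomain r e).mem_nhds hw] with w' hw'
    exact hT.x_tubeParam hw'
  have h3 := h2.mfderiv_eq (I := 𝓘(ℝ, Euc (d + 1))) (I' := 𝓘(ℝ))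
  have h4 : HasFDerivAt (fun w => ((consEquiv d).symm w).1)
      ((ContinuousLinearMap.fst ℝ ℝ (Euc d)).comp (consEquiv d).symm.toContinuousLinearMap) w :=
    ((ContinuousLinearMap.fst ℝ ℝ (Euc d)).comp
      (consEquiv d).symm.toContinuousLinearMap).hasFDerivAt
  exact (congrArg (fun L : Euc (d + 1) →L[ℝ] ℝ => L v)
    (h1.symm.trans (h3.trans h4.hasMFDerivAt.mfderiv)))

lemma mfderiv_tubeProj {e : Z} {w : Euc (d + 1)} (hw : w ∈ tubeDomain d r e) (v : Euc (d + 1)) :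
    (mfderiv (𝓡 (d + 1)) (𝓡 d) (tubeProj T) (tubeParam T e w)
      (mfderiv 𝓘(ℝ, Euc (d + 1)) (𝓡 (d + 1)) (tubeParam T e) w v) : Euc d) =
      mfderiv 𝓘(ℝ, Euc d) (𝓡 d) (extChartAt (𝓡 d) e).symm ((consEquiv d).symm w).2
        ((consEquiv d).symm v).2 := by
  have h0 : MDifferentiableAt (𝓡 (d + 1)) (𝓡 d) (tubeProj T) (tubeParam T e w) := by
    have := (hT.smooth.contMDiffAt (T.open_source.mem_nhds (hT.tubeParam_mem hw))).mdifferentiableAt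
      (by simp)
    exact this.fst
  have h1 := mfderiv_comp w h0 (hT.mdifferentiableAt_tubeParam hw)
  have h2 : tubeProj T ∘ tubeParam T e =ᶠ[𝓝 w]
      (extChartAt (𝓡 d) e).symm ∘ fun w => ((consEquiv d).symm w).2 := by
    filter_upwards [(isOpen_tubeDomain r e).mem_nhds hw] with w' hw'
    exact congrArg Prod.fst (hT.apply_tubeParam hw')
  have h3 := h2.mfderiv_eq (I := 𝓘(ℝ, Euc (d + 1))) (I' := 𝓡 d)
  have h4 : HasFDerivAt (fun w => ((consEquiv d).symm w).2)
      ((ContinuousLinearMap.snd ℝ ℝ (Euc d)).comp (consEquiv d).symm.toContinuousLinearMap) w :=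
    ((ContinuousLinearMap.snd ℝ ℝ (Euc d)).comp
      (consEquiv d).symm.toContinuousLinearMap).hasFDerivAt
  have h5 := mfderiv_comp w (mdifferentiableAt_extChartAt_symm_of_mem hw.2)
    h4.differentiableAt.mdifferentiableAt
  rw [h4.hasMFDerivAt.mfderiv] at h5
  exact (congrArg (fun L : Euc (d + 1) →L[ℝ] Euc d => L v) (h1.symm.trans (h3.trans h5)))

lemma mfderiv_slice {e : Z} {t : ℝ} {y : Euc d} (ht : t ∈ Ioo (-r) r)
    (hy : y ∈ (extChartAt (𝓡 d) e).target) (v : Euc d) :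
    (mfderiv (𝓡 d) (𝓡 (d + 1)) (fun z => T.symm (z, t)) ((extChartAt (𝓡 d) e).symm y)
      (mfderiv 𝓘(ℝ, Euc d) (𝓡 d) (extChartAt (𝓡 d) e).symm y v) : Euc (d + 1)) =
      mfderiv 𝓘(ℝ, Euc (d + 1)) (𝓡 (d + 1)) (tubeParam T e) (consEquiv d (t, y))
        (consEquiv d (0, v)) := by
  have h0 : MDifferentiableAt (𝓡 d) (𝓡 (d + 1)) (fun z => T.symm (z, t))
      ((extChartAt (𝓡 d) e).symm y) := by
    have h1 := (hT.smooth_symm.contMDiffAt (T.open_target.mem_nhds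
      (hT.mem_target (z := (extChartAt (𝓡 d) e).symm y).2 ht))).mdifferentiableAt (by simp)
    exact h1.comp (f := fun z : Z => (z, t)) ((extChartAt (𝓡 d) e).symm y)
      (mdifferentiableAt_id.prodMk mdifferentiableAt_const)
  have h1 := mfderiv_comp y h0 (mdifferentiableAt_extChartAt_symm_of_mem hy)
  have h4 : HasFDerivAt (fun y : Euc d => consEquiv d (t, y))
      ((consEquiv d).toContinuousLinearMap.comp (ContinuousLinearMap.inr ℝ ℝ (Euc d))) y :=
    (consEquiv d).toContinuousLinearMap.hasFDerivAt.comp y (hasFDerivAt_prodMk_right t y)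
  have h5 := mfderiv_comp y (hT.mdifferentiableAt_tubeParam
    (consEquiv_mem_tubeDomain.2 ⟨ht, hy⟩)) h4.differentiableAt.mdifferentiableAt
  rw [h4.hasMFDerivAt.mfderiv] at h5
  have h6 : (fun z => T.symm (z, t)) ∘ (extChartAt (𝓡 d) e).symm =
      tubeParam T e ∘ fun y : Euc d => consEquiv d (t, y) := by
    funext y'
    exact (tubeParam_consEquiv e t y').symm
  rw [h6] at h1
  exact (congrArg (fun L : Euc d →L[ℝ] Euc (d + 1) => L v) (h1.symm.trans h5))

end IsTube

end Tube

/-! ### The wedge product as a polynomial in the values of its factors. -/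

section WedgeSum

/-- The evaluation of `a ∧ B 0 ∧ ⋯ ∧ B (m - 1)` on `1 + 2 m` vectors in terms of the values of the
factors. -/
def wedgeSum (m : ℕ) (a : Fin (1 + 2 * m) → ℝ)
    (B : Fin m → Fin (1 + 2 * m) → Fin (1 + 2 * m) → ℝ) : ℝ :=
  (2⁻¹ : ℝ) ^ m * ∑ σ : Equiv.Perm (Fin (1 + 2 * m)), ((Equiv.Perm.sign σ : ℤ) : ℝ) *
    (a (σ (Fin.castAdd (2 * m) 0)) *
      ∏ i, B i (σ (Fin.natAdd 1 (pairFst i))) (σ (Fin.natAdd 1 (pairSnd i))))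

end WedgeSum

/-! ### Evaluation of forms on coordinate vectors. -/

section CoordValue

variable {d d' : ℕ} {M : Type*} [TopologicalSpace M] [ChartedSpace (Euc d) M]

lemma coordValue_one (Φ : Euc d' → M) (η : DForm d M 1) (v w : Euc d') :
    coordValue Φ η ![v] w = η (Φ w) ![mfderiv 𝓘(ℝ, Euc d') (𝓡 d) Φ w v] := by
  rw [coordValue]
  congr 1
  funext i
  fin_cases i
  rfl

lemma coordValue_two (Φ : Euc d' → M) (η : DForm d M 2) (v v' w : Euc d') :
    coordValue Φ η ![v, v'] w = η (Φ w) ![mfderiv 𝓘(ℝ, Euc d') (𝓡 d) Φ w v,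
      mfderiv 𝓘(ℝ, Euc d') (𝓡 d) Φ w v'] := by
  rw [coordValue]
  congr 1
  funext i
  fin_cases i <;> rfl

lemma dFun_apply (g : M → ℝ) (p : M) (v : TangentSpace (𝓡 d) p) :
    dFun d g p ![v] = (mfderiv (𝓡 d) 𝓘(ℝ) g p v : ℝ) := rfl

/-- Writing a 2-form with scalar coefficients against fixed forms deduces smoothness of a curve of
forms from smoothness of its values. The factor `2⁻¹` appears because both orders of each pair of
indices are summed. -/
lemma two_form_eq_sum (f : Euc d [⋀^Fin 2]→L[ℝ] ℝ) :
    f = ∑ a : Fin d, ∑ b : Fin d, (2⁻¹ * f ![EuclideanSpace.single a 1, EuclideanSpace.single b 1]) •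
      wedge (toOneForm (EuclideanSpace.proj a : Euc d →L[ℝ] ℝ))
        (toOneForm (EuclideanSpace.proj b : Euc d →L[ℝ] ℝ)) := by
  have e : ∀ x : Fin 2 → Euc d, x = ![x 0, x 1] := fun x => by ext i; fin_cases i <;> rfl
  ext v
  rw [e v]
  generalize v 0 = u
  generalize v 1 = v
  simp only [ContinuousAlternatingMap.sum_apply, ContinuousAlternatingMap.smul_apply, wedge_one_one_apply, smul_eq_mul]
  have h1 : ∀ (u v : Euc d), f ![u, v] = ∑ a : Fin d, ∑ b : Fin d,
      u a * v b * f ![EuclideanSpace.single a 1, EuclideanSpace.single b 1] := by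
    intro u v
    rw [alternating_apply_eq_sum, ← Equiv.sum_comp (finTwoArrowEquiv (Fin d)).symm,
      Fintype.sum_prod_type]
    refine Finset.sum_congr rfl fun a _ => Finset.sum_congr rfl fun b _ => ?_
    rw [Fin.prod_univ_two, e fun i => EuclideanSpace.single _ _]
    rfl
  have h2 : f ![u, v] = - f ![v, u] := by
    have := f.toAlternatingMap.map_swap ![u, v] (i := 0) (j := 1) (by decide)
    change f (![u, v] ∘ Equiv.swap 0 1) = - f ![u, v] at this
    rw [e (![u, v] ∘ Equiv.swap 0 1)] at this
    simp only [Function.comp_apply, Equiv.swap_apply_left, Equiv.swap_apply_right,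
      Matrix.cons_val_zero, Matrix.cons_val_one] at this
    linarith
  have h3 : f ![u, v] = 2⁻¹ * (f ![u, v] - f ![v, u]) := by
    rw [h2]
    ring
  rw [h3, h1 u v, h1 v u, ← Finset.sum_sub_distrib, Finset.mul_sum]
  refine Finset.sum_congr rfl fun a _ => ?_
  rw [← Finset.sum_sub_distrib, Finset.mul_sum]
  refine Finset.sum_congr rfl fun b _ => ?_
  change _ = 2⁻¹ * f ![EuclideanSpace.single a 1, EuclideanSpace.single b 1] *
    (u a * v b - v a * u b)
  ring

lemma coordValue_wedge_wedgeFamily {m : ℕ} (hd' : 1 + 2 * m = d) (a : DForm d M 1)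
    (b : Fin m → DForm d M 2) (Φ : Euc d → M) (y : Euc d) :
    coordValue Φ (fun z => wedge (a z) (wedgeFamily m fun l => b l z))
        (fun i => EuclideanSpace.single (Fin.cast hd' i) 1) y =
      wedgeSum m (fun p => coordValue Φ a ![EuclideanSpace.single (Fin.cast hd' p) 1] y)
        (fun l p p' => coordValue Φ (b l) ![EuclideanSpace.single (Fin.cast hd' p) 1,
          EuclideanSpace.single (Fin.cast hd' p') 1] y) := by
  rw [coordValue, wedge_wedgeFamily_apply, wedgeSum]
  simp only [coordValue_one, coordValue_two]

end CoordValue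

/-! ### The forms of the theorem in tube coordinates. -/

section TubeForms

variable {d : ℕ} {M : Type*} [TopologicalSpace M] [ChartedSpace (Euc (d + 1)) M]
  {Z : Type*} [TopologicalSpace Z] [ChartedSpace (Euc d) Z] [IsManifold (𝓡 d) ∞ Z]
  {x : M → ℝ} {ι : Z → M} {r : ℝ} {T : OpenPartialHomeomorph M (Z × ℝ)}

namespace IsTube

variable (hT : IsTube (d := d) x ι r T)
include hT

lemma laurentSum_apply {m : ℕ} (α : Fin m → DForm d Z 1) {e : Z} {t : ℝ} {y : Euc d}
    (ht : t ∈ Ioo (-r) r) (hy : y ∈ (extChartAt (𝓡 d) e).target) (v : Euc d) :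
    laurentSum x T α (tubeParam T e (consEquiv d (t, y)))
      ![mfderiv 𝓘(ℝ, Euc (d + 1)) (𝓡 (d + 1)) (tubeParam T e) (consEquiv d (t, y))
        (consEquiv d (0, v))] =
      ∑ i : Fin m, t ^ (i : ℕ) * coordValue (extChartAt (𝓡 d) e).symm (α i) ![v] y := by
  have hw := consEquiv_mem_tubeDomain.2 ⟨ht, hy⟩
  refine (ContinuousAlternatingMap.sum_apply _ _).trans (Finset.sum_congr rfl fun i _ => ?_)
  rw [ContinuousAlternatingMap.smul_apply, smul_eq_mul, hT.x_tubeParam hw, (consEquiv d).symm_apply_apply, coordValue_one]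
  congr 1
  refine form_apply_congr (α i) ?_ ?_
  · change (T (tubeParam T e (consEquiv d (t, y)))).1 = _
    rw [hT.apply_tubeParam hw, (consEquiv d).symm_apply_apply]
  · funext l
    fin_cases l
    have := hT.mfderiv_tubeProj hw (consEquiv d (0, v))
    rw [(consEquiv d).symm_apply_apply, (consEquiv d).symm_apply_apply] at this
    exact this

lemma pullback_slice_apply {q : ℕ} (β : DForm (d + 1) M q) {e : Z} {t : ℝ} {y : Euc d}
    (ht : t ∈ Ioo (-r) r) (hy : y ∈ (extChartAt (𝓡 d) e).target) (v : Fin q → Euc d) :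
    (pullback (fun z : Z => T.symm (z, t)) β ((extChartAt (𝓡 d) e).symm y) fun i =>
      mfderiv 𝓘(ℝ, Euc d) (𝓡 d) (extChartAt (𝓡 d) e).symm y (v i)) =
      coordValue (tubeParam T e) β (fun i => consEquiv d (0, v i)) (consEquiv d (t, y)) := by
  refine form_apply_congr β (tubeParam_consEquiv e t y).symm ?_
  funext i
  exact hT.mfderiv_slice ht hy (v i)

lemma contDiffOn_coordValue_tube {q : ℕ} [IsManifold (𝓡 (d + 1)) ∞ M] {β : DForm (d + 1) M q}
    (hβ : IsSmoothOn β T.source) (e : Z) (v : Fin q → Euc (d + 1)) :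
    ContDiffOn ℝ ∞ (fun p : ℝ × Euc d => coordValue (tubeParam T e) β v (consEquiv d p))
      (Ioo (-r) r ×ˢ (extChartAt (𝓡 d) e).target) := by
  refine (contDiffOn_coordValue (isOpen_tubeDomain r e) (hT.contMDiffOn_tubeParam e) hβ
    (fun w hw => hT.tubeParam_mem hw) v).comp (consEquiv d).contDiff.contDiffOn fun p hp => ?_
  exact consEquiv_mem_tubeDomain.2 hp

/-- The `β_j` are defined as derivatives of a curve in a space of alternating forms. Its smoothness
is what allows evaluation on fixed vectors to commute with these derivatives. -/
lemma contDiffAt_pullback_slice [IsManifold (𝓡 (d + 1)) ∞ M] {β : DForm (d + 1) M 2}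
    (hβ : IsSmoothOn β T.source) (z : Z) (g : ℝ → Euc d [⋀^Fin 2]→L[ℝ] ℝ)
    (hg : ∀ t, g t = pullback (fun z' : Z => T.symm (z', t)) β z) : ContDiffAt ℝ ∞ g 0 := by
  have h0 : ∀ v : Fin 2 → Euc d, ContDiffAt ℝ ∞ (fun t : ℝ => g t v) 0 := by
    intro v
    set y := extChartAt (𝓡 d) z z with hy
    have hyt : y ∈ (extChartAt (𝓡 d) z).target := mem_extChartAt_target z
    have hyz : (extChartAt (𝓡 d) z).symm y = z := extChartAt_to_inv z
    have hinv : (mfderiv 𝓘(ℝ, Euc d) (𝓡 d) (extChartAt (𝓡 d) z).symm y).IsInvertible := by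
      have := isInvertible_mfderivWithin_extChartAt_symm (I := 𝓡 d) hyt
      simpa [mfderivWithin_univ] using this
    -- The chart derivative is invertible, so every tangent vector at `z` is the image of a
    -- coordinate vector and the scalar formula in tube coordinates applies.
    have hu : ∀ i, ∃ u : Euc d,
        (mfderiv 𝓘(ℝ, Euc d) (𝓡 d) (extChartAt (𝓡 d) z).symm y u : Euc d) = v i := fun i =>
      hinv.bijective.surjective (v i)
    choose u hu using hu
    have h1 : ∀ t ∈ Ioo (-r) r, g t v = coordValue (tubeParam T z) β
          (fun i => consEquiv d (0, u i)) (consEquiv d (t, y)) := by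
      intro t ht
      rw [← hT.pullback_slice_apply β ht hyt, hg]
      exact form_apply_congr _ hyz.symm (funext fun i => (hu i).symm)
    have h2 : ContDiffOn ℝ ∞ (fun t : ℝ => coordValue (tubeParam T z) β
          (fun i => consEquiv d (0, u i)) (consEquiv d (t, y))) (Ioo (-r) r) :=
      (hT.contDiffOn_coordValue_tube hβ z _).comp
        (contDiff_id.prodMk contDiff_const).contDiffOn fun t ht => ⟨ht, hyt⟩
    have h3 : Ioo (-r) r ∈ 𝓝 (0 : ℝ) := Ioo_mem_nhds (by linarith [hT.pos]) hT.pos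
    exact (h2.congr h1).contDiffAt h3
  rw [funext fun t : ℝ => two_form_eq_sum (g t)]
  exact ContDiffAt.sum fun a _ => ContDiffAt.sum fun b _ =>
    (contDiffAt_const.mul (h0 _)).smul contDiffAt_const

/-- This identifies the invariantly defined `β_j` with ordinary Taylor coefficients of coordinate
functions, to which the scalar estimates apply. -/
lemma coordValue_taylorCoeff [IsManifold (𝓡 (d + 1)) ∞ M] {β : DForm (d + 1) M 2}
    (hβ : IsSmoothOn β T.source) (j : ℕ) {e : Z} {y : Euc d}
    (hy : y ∈ (extChartAt (𝓡 d) e).target) (v : Fin 2 → Euc d) :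
    coordValue (extChartAt (𝓡 d) e).symm (taylorCoeff T β j) v y =
      (j.factorial : ℝ)⁻¹ * iteratedDeriv j (fun t => coordValue (tubeParam T e) β
        (fun i => consEquiv d (0, v i)) (consEquiv d (t, y))) 0 := by
  set z := (extChartAt (𝓡 d) e).symm y with hz
  set u : Fin 2 → Euc d := fun i =>
    mfderiv 𝓘(ℝ, Euc d) (𝓡 d) (extChartAt (𝓡 d) e).symm y (v i) with hu
  set g : ℝ → Euc d [⋀^Fin 2]→L[ℝ] ℝ := fun t => pullback (fun z' : Z => T.symm (z', t)) β z with hg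
  have hgs : ContDiffAt ℝ ∞ g 0 := hT.contDiffAt_pullback_slice hβ z g fun _ => rfl
  set A := ContinuousAlternatingMap.apply ℝ (Euc d) ℝ u with hA
  have h1 : coordValue (extChartAt (𝓡 d) e).symm (taylorCoeff T β j) v y =
      (j.factorial : ℝ)⁻¹ * A (iteratedDeriv j g 0) := rfl
  have h2 : A (iteratedDeriv j g 0) = iteratedDeriv j (A ∘ g) 0 := by
    rw [iteratedDeriv, iteratedDeriv,
      A.iteratedFDeriv_comp_left hgs (by exact_mod_cast le_top)]
    rfl
  have h3 : A ∘ g =ᶠ[𝓝 0] fun t => coordValue (tubeParam T e) β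
        (fun i => consEquiv d (0, v i)) (consEquiv d (t, y)) := by
    filter_upwards [Ioo_mem_nhds (neg_lt_zero.2 hT.pos) hT.pos] with t ht
    exact hT.pullback_slice_apply β ht hy v
  rw [h1, h2, h3.iteratedDeriv_eq]

/-- The top degree form `(s dx ∧ ∑ x^i π^* α_i + β)^n` in the parametrization of the tube. -/
lemma coordValue_wedgePow (hx : ContMDiff (𝓡 (d + 1)) 𝓘(ℝ) ∞ x) {n m : ℕ} (hd : d + 1 = 2 * n)
    (hd' : 1 + 2 * (n - 1) = d) (α : Fin m → DForm d Z 1) (β : DForm (d + 1) M 2) (s : ℝ)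
    (η : DForm (d + 1) M (2 * n)) {e : Z} {t : ℝ} {y : Euc d}
    (ht : t ∈ Ioo (-r) r) (hy : y ∈ (extChartAt (𝓡 d) e).target)
    (hη : η (tubeParam T e (consEquiv d (t, y))) = wedgePow n
      (s • wedge (dFun (d + 1) x (tubeParam T e (consEquiv d (t, y))))
        (laurentSum x T α (tubeParam T e (consEquiv d (t, y)))) +
        β (tubeParam T e (consEquiv d (t, y))))) :
    coordValue (tubeParam T e) η (fun i => EuclideanSpace.single (Fin.cast hd.symm i) 1)
        (consEquiv d (t, y)) =
      n * s * wedgeSum (n - 1)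
        (fun p => ∑ i : Fin m, t ^ (i : ℕ) * coordValue (extChartAt (𝓡 d) e).symm (α i)
          ![EuclideanSpace.single (Fin.cast hd' p) 1] y)
        (fun _ p p' => coordValue (tubeParam T e) β
          ![consEquiv d (0, EuclideanSpace.single (Fin.cast hd' p) 1),
            consEquiv d (0, EuclideanSpace.single (Fin.cast hd' p') 1)] (consEquiv d (t, y))) +
      coordValue (tubeParam T e) (fun p => wedgePow n (β p))
        (fun i => EuclideanSpace.single (Fin.cast hd.symm i) 1) (consEquiv d (t, y)) := by
  have hw := consEquiv_mem_tubeDomain.2 ⟨ht, hy⟩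
  rw [coordValue, hη]
  set E : Fin (d + 1) → TangentSpace (𝓡 (d + 1)) (tubeParam T e (consEquiv d (t, y))) := fun i =>
    mfderiv 𝓘(ℝ, Euc (d + 1)) (𝓡 (d + 1)) (tubeParam T e) (consEquiv d (t, y))
      (EuclideanSpace.single i 1) with hE
  have hEs : ∀ i : Fin d, E i.succ = mfderiv 𝓘(ℝ, Euc (d + 1)) (𝓡 (d + 1)) (tubeParam T e)
      (consEquiv d (t, y)) (consEquiv d (0, EuclideanSpace.single i 1)) := fun i => by
    rw [consEquiv_single]
  -- The coordinate frame is adapted to `dx`: the first vector has `dx = 1`, the others are tangent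
  -- to the slices. These are the hypotheses of the contraction formula.
  have h0 : dFun (d + 1) x (tubeParam T e (consEquiv d (t, y))) ![E 0] = 1 := by
    rw [dFun_apply]
    refine (hT.mfderiv_apply_tubeParam hx hw _).trans ?_
    rw [← consEquiv_one, (consEquiv d).symm_apply_apply]
  have h1 : ∀ i : Fin d, dFun (d + 1) x (tubeParam T e (consEquiv d (t, y))) ![E i.succ] = 0 := by
    intro i
    rw [dFun_apply]
    refine (hT.mfderiv_apply_tubeParam hx hw _).trans ?_
    rw [← consEquiv_single, (consEquiv d).symm_apply_apply]
  refine (wedgePow_smul_wedge_add_apply hd hd' _ _ _ s E h0 h1).trans ?_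
  congr 1
  congr 1
  rw [wedge_wedgeFamily_apply, wedgeSum]
  simp only [hEs, hT.laurentSum_apply α ht hy, coordValue_two]

end IsTube

end TubeForms

/-! ### Volume forms do not vanish on coordinate frames. -/

section Nonvanishing

variable {d : ℕ} {M : Type*} [TopologicalSpace M] [ChartedSpace (Euc d) M]

lemma alternating_apply_map_ne_zero {f : Euc d [⋀^Fin d]→L[ℝ] ℝ} (hf : f ≠ 0)
    (A : Euc d →L[ℝ] Euc d) (hA : ∀ v, A v = 0 → v = 0) :
    f (fun i => A (EuclideanSpace.single i 1)) ≠ 0 := by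
  rw [alternating_apply_map]
  refine mul_ne_zero (fun h => ?_) fun h => hf ?_
  · have h1 : LinearMap.det (A : Euc d →ₗ[ℝ] Euc d) = 0 := h
    refine (LinearMap.bot_lt_ker_of_det_eq_zero h1).ne' ?_
    rw [LinearMap.ker_eq_bot']
    exact hA
  · ext v
    rw [alternating_apply_eq_sum]
    refine Finset.sum_eq_zero fun κ _ => mul_eq_zero_of_right _ ?_
    by_cases hκ : Function.Injective κ
    · have hb := Finite.injective_iff_bijective.1 hκ
      have h2 := f.toAlternatingMap.map_perm (fun i => EuclideanSpace.single i (1 : ℝ))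
        (Equiv.ofBijective κ hb)
      change f (fun i => EuclideanSpace.single (κ i) (1 : ℝ)) =
        Equiv.Perm.sign (Equiv.ofBijective κ hb) • f (fun i => EuclideanSpace.single i (1 : ℝ)) at h2
      rw [h2, h, smul_zero]
    · obtain ⟨i, j, hij, hne⟩ : ∃ i j, κ i = κ j ∧ i ≠ j := by
        simpa [Function.Injective] using hκ
      exact f.map_eq_zero_of_eq _ (by simp only [hij]) hne

lemma IsVolumeForm.coordValue_ne_zero {μ : DForm d M d} (hμ : IsVolumeForm μ) (Φ : Euc d → M)
    (w : Euc d) (h : ∀ v : Euc d, (mfderiv 𝓘(ℝ, Euc d) (𝓡 d) Φ w v : Euc d) = 0 → v = 0) :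
    coordValue Φ μ (fun i => EuclideanSpace.single i 1) w ≠ 0 :=
  alternating_apply_map_ne_zero (f := μ (Φ w)) (hμ.ne_zero _)
    (mfderiv 𝓘(ℝ, Euc d) (𝓡 d) Φ w : Euc d →L[ℝ] Euc d) h

lemma mfderiv_extChartAt_symm_injective [IsManifold (𝓡 d) ∞ M] {c : M} {y : Euc d}
    (hy : y ∈ (extChartAt (𝓡 d) c).target) (v : Euc d)
    (hv : (mfderiv 𝓘(ℝ, Euc d) (𝓡 d) (extChartAt (𝓡 d) c).symm y v : Euc d) = 0) : v = 0 := by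
  have hinv : (mfderiv 𝓘(ℝ, Euc d) (𝓡 d) (extChartAt (𝓡 d) c).symm y).IsInvertible := by
    have := isInvertible_mfderivWithin_extChartAt_symm (I := 𝓡 d) hy
    simpa [mfderivWithin_univ] using this
  exact hinv.bijective.injective (hv.trans (map_zero _).symm)

lemma IsVolumeForm.coordValue_chart_ne_zero [IsManifold (𝓡 d) ∞ M] {μ : DForm d M d}
    (hμ : IsVolumeForm μ) {c : M} {y : Euc d} (hy : y ∈ (extChartAt (𝓡 d) c).target) :
    coordValue (extChartAt (𝓡 d) c).symm μ (fun i => EuclideanSpace.single i 1) y ≠ 0 :=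
  hμ.coordValue_ne_zero _ _ (mfderiv_extChartAt_symm_injective hy)

lemma contDiffOn_coordValue_chart [IsManifold (𝓡 d) ∞ M] {q : ℕ} {η : DForm d M q} {U : Set M}
    (hU : IsOpen U) (hη : IsSmoothOn η U) (c : M) (v : Fin q → Euc d) :
    ContDiffOn ℝ ∞ (coordValue (extChartAt (𝓡 d) c).symm η v) (chartPart d U c) :=
  contDiffOn_coordValue ((continuousOn_extChartAt_symm c).isOpen_inter_preimage
    (isOpen_extChartAt_target c) hU) ((contMDiffOn_extChartAt_symm (n := ∞) c).mono
    inter_subset_left) hη (fun _ hy => hy.2) v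

lemma chartPart_univ (c : M) : chartPart d univ c = (extChartAt (𝓡 d) c).target := by
  rw [chartPart, preimage_univ, inter_univ]

/-- The sign is locally constant away from zero. The sign factor in the densities is therefore
continuous, and constant along connected sets. -/
lemma continuousOn_sign_comp {X : Type*} [TopologicalSpace X] {g : X → ℝ} {s : Set X}
    (hg : ContinuousOn g s) (h0 : ∀ y ∈ s, g y ≠ 0) :
    ContinuousOn (fun y => SignType.sign (g y)) s := fun y hy =>
  ContinuousAt.comp_continuousWithinAt (f := g) (g := fun r : ℝ => SignType.sign r)
    (continuousAt_sign_of_ne_zero (h0 y hy)) (hg y hy)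

lemma IsVolumeForm.continuousOn_sign [IsManifold (𝓡 d) ∞ M] {μ : DForm d M d}
    (hμ : IsVolumeForm μ) (c : M) :
    ContinuousOn (fun y => ((SignType.sign (coordValue (extChartAt (𝓡 d) c).symm μ
      (fun i => EuclideanSpace.single i 1) y) : SignType) : ℝ)) (extChartAt (𝓡 d) c).target := by
  have h1 := (contDiffOn_coordValue_chart isOpen_univ hμ.smooth c
    fun i => EuclideanSpace.single i 1).continuousOn
  rw [chartPart_univ] at h1
  exact (continuous_of_discreteTopology (f := fun s : SignType => (s : ℝ))).comp_continuousOn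
    (continuousOn_sign_comp h1 fun y hy => hμ.coordValue_chart_ne_zero hy)

end Nonvanishing

/-! ### Comparison of the orientations of `M` and `Z`. -/

section Orientation

variable {d : ℕ} {M : Type*} [TopologicalSpace M] [ChartedSpace (Euc (d + 1)) M]
  {Z : Type*} [TopologicalSpace Z] [ChartedSpace (Euc d) Z] [IsManifold (𝓡 d) ∞ Z]
  {x : M → ℝ} {ι : Z → M} {r : ℝ} {T : OpenPartialHomeomorph M (Z × ℝ)}

lemma IsTube.coordValue_volume_ne_zero (hT : IsTube (d := d) x ι r T)
    (hx : ContMDiff (𝓡 (d + 1)) 𝓘(ℝ) ∞ x) {μ : DForm (d + 1) M (d + 1)} (hμ : IsVolumeForm μ)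
    {e : Z} {w : Euc (d + 1)} (hw : w ∈ tubeDomain d r e) :
    coordValue (tubeParam T e) μ (fun i => EuclideanSpace.single i 1) w ≠ 0 := by
  refine hμ.coordValue_ne_zero _ _ fun v hv => ?_
  have h1 := hT.mfderiv_apply_tubeParam hx hw v
  have h2 := hT.mfderiv_tubeProj hw v
  have h3 : ((consEquiv d).symm v).1 = 0 := by
    refine h1.symm.trans ?_
    refine (congrArg (fun u : Euc (d + 1) => (mfderiv (𝓡 (d + 1)) 𝓘(ℝ) x (tubeParam T e w) u : ℝ))
      hv).trans (map_zero _)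
  have h4 : ((consEquiv d).symm v).2 = 0 := by
    refine mfderiv_extChartAt_symm_injective hw.2 _ (h2.symm.trans ?_)
    refine (congrArg (fun u : Euc (d + 1) =>
      (mfderiv (𝓡 (d + 1)) (𝓡 d) (tubeProj T) (tubeParam T e w) u : Euc d)) hv).trans (map_zero _)
  exact (consEquiv d).symm.map_eq_zero_iff.1 (Prod.ext h3 h4)

/-- In the parametrization of the tube, the orientation of `M` is the one induced by `Z`. -/
lemma IsTube.sign_coordValue [IsManifold (𝓡 (d + 1)) ∞ M] (hT : IsTube (d := d) x ι r T)
    (hx : ContMDiff (𝓡 (d + 1)) 𝓘(ℝ) ∞ x) {μ : DForm (d + 1) M (d + 1)} (hμ : IsVolumeForm μ)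
    {ν : DForm d Z d} (hν : IsVolumeForm ν) (hind : IsInducedOrientation x ι μ ν)
    {e : Z} {t : ℝ} {y : Euc d} (ht : t ∈ Ioo (-r) r) (hy : y ∈ (extChartAt (𝓡 d) e).target) :
    SignType.sign (coordValue (tubeParam T e) μ (fun i => EuclideanSpace.single i 1)
      (consEquiv d (t, y))) =
    SignType.sign (coordValue (extChartAt (𝓡 d) e).symm ν (fun i => EuclideanSpace.single i 1) y) := by
  have h0 : (0 : ℝ) ∈ Ioo (-r) r := ⟨neg_lt_zero.2 hT.pos, hT.pos⟩
  have hw := consEquiv_mem_tubeDomain.2 ⟨h0, hy⟩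
  have hc : ContinuousOn (fun t : ℝ => coordValue (tubeParam T e) μ
      (fun i => EuclideanSpace.single i 1) (consEquiv d (t, y))) (Ioo (-r) r) :=
    ((contDiffOn_coordValue (isOpen_tubeDomain r e) (hT.contMDiffOn_tubeParam e) hμ.smooth
      (fun _ _ => mem_univ _) _).continuousOn).comp
      ((consEquiv d).continuous.comp (by fun_prop : Continuous fun t : ℝ => (t, y))).continuousOn
      fun t ht => consEquiv_mem_tubeDomain.2 ⟨ht, hy⟩
  -- The volume form never vanishes on the coordinate frame, so its sign is constant along the
  -- interval and it suffices to compare orientations at `t = 0`.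
  have hs := continuousOn_sign_comp hc fun t ht =>
    hT.coordValue_volume_ne_zero hx hμ (consEquiv_mem_tubeDomain.2 ⟨ht, hy⟩)
  rw [isPreconnected_Ioo.constant hs ht h0]
  have hι : T.symm ((extChartAt (𝓡 d) e).symm y, 0) = ι ((extChartAt (𝓡 d) e).symm y) :=
    hT.zero_section _
  have hιfun : (fun z => T.symm (z, 0)) = ι := funext hT.zero_section
  have hp : tubeParam T e (consEquiv d (0, y)) = ι ((extChartAt (𝓡 d) e).symm y) :=
    (tubeParam_consEquiv e 0 y).trans hι
  set E : Fin (d + 1) → Euc (d + 1) := fun i =>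
    mfderiv 𝓘(ℝ, Euc (d + 1)) (𝓡 (d + 1)) (tubeParam T e) (consEquiv d (0, y))
      (EuclideanSpace.single i 1) with hE
  -- The first frame vector serves as the transverse vector `u` in the definition of the induced
  -- orientation, since `dx` takes the value `1` on it.
  have hu : 0 < dFun (d + 1) x (ι ((extChartAt (𝓡 d) e).symm y)) ![E 0] := by
    have h1 : dFun (d + 1) x (tubeParam T e (consEquiv d (0, y))) ![E 0] = 1 := by
      rw [dFun_apply]
      refine (hT.mfderiv_apply_tubeParam hx hw _).trans ?_
      rw [← consEquiv_one, (consEquiv d).symm_apply_apply]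
    have h2 : dFun (d + 1) x (ι ((extChartAt (𝓡 d) e).symm y)) ![E 0] = 1 :=
      (form_apply_congr _ hp rfl).symm.trans h1
    rw [h2]
    exact one_pos
  have h1 := hind _ (E 0) hu fun i => mfderiv 𝓘(ℝ, Euc d) (𝓡 d) (extChartAt (𝓡 d) e).symm y
    (EuclideanSpace.single i 1)
  have h2 : (μ (ι ((extChartAt (𝓡 d) e).symm y)) : Euc (d + 1) [⋀^Fin (d + 1)]→L[ℝ] ℝ)
      (Fin.cons (E 0) fun i => mfderiv (𝓡 d) (𝓡 (d + 1)) ι ((extChartAt (𝓡 d) e).symm y)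
        (mfderiv 𝓘(ℝ, Euc d) (𝓡 d) (extChartAt (𝓡 d) e).symm y (EuclideanSpace.single i 1))) =
      coordValue (tubeParam T e) μ (fun i => EuclideanSpace.single i 1) (consEquiv d (0, y)) := by
    refine form_apply_congr μ hp.symm ?_
    funext i
    refine Fin.cases rfl (fun i => ?_) i
    have h3 := hT.mfderiv_slice h0 hy (EuclideanSpace.single i 1)
    rw [consEquiv_single] at h3
    rw [← hιfun]
    exact h3
  have h3 : (0 < coordValue (extChartAt (𝓡 d) e).symm ν (fun i => EuclideanSpace.single i 1) y ↔
      0 < coordValue (tubeParam T e) μ (fun i => EuclideanSpace.single i 1)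
        (consEquiv d (0, y))) := by
    rw [← h2]
    exact h1
  -- The orientation condition only matches positivity; as neither value is zero, the signs agree in
  -- the negative case too.
  have n1 := hT.coordValue_volume_ne_zero hx hμ hw
  have n2 := hν.coordValue_chart_ne_zero hy
  rcases lt_or_gt_of_ne n1 with h | h
  · rcases lt_or_gt_of_ne n2 with h' | h'
    · rw [sign_neg h, sign_neg h']
    · exact absurd (h3.1 h') h.not_gt
  · rw [sign_pos h, sign_pos (h3.2 h)]

end Orientation

/-! ### Measurability and integrability in charts. -/

section ChartIntegrability

lemma measurableSet_inter_preimage_of_continuousOn {X Y : Type*} [TopologicalSpace X]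
    [MeasurableSpace X] [BorelSpace X] [TopologicalSpace Y] [MeasurableSpace Y] [BorelSpace Y]
    {A : Set X} (hA : MeasurableSet A) {f : X → Y} (hf : ContinuousOn f A) {J : Set Y}
    (hJ : MeasurableSet J) : MeasurableSet (A ∩ f ⁻¹' J) := by
  have h1 : Measurable (fun a : A => f a) := (continuousOn_iff_continuous_domRestrict.1 hf).measurable
  have h2 := MeasurableSet.subtype_image hA (h1 hJ)
  convert h2 using 1
  ext a
  simp only [mem_inter_iff, mem_preimage, mem_image, Subtype.exists, exists_and_left, exists_prop,
    exists_eq_right_right]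
  tauto

variable {d : ℕ} {M : Type*} [TopologicalSpace M] [ChartedSpace (Euc d) M]

lemma measurableSet_chartPart_inter_preimage {U : Set M} (hU : IsOpen U) {g : M → ℝ}
    (hg : ContinuousOn g U) {J : Set ℝ} (hJ : MeasurableSet J) (c : M) :
    MeasurableSet (chartPart d (U ∩ g ⁻¹' J) c) := by
  have h1 : chartPart d (U ∩ g ⁻¹' J) c =
      chartPart d U c ∩ (fun y => g ((extChartAt (𝓡 d) c).symm y)) ⁻¹' J := by
    ext y
    simp only [chartPart, mem_inter_iff, mem_preimage]
    tauto
  rw [h1]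
  have h2 : IsOpen (chartPart d U c) := (continuousOn_extChartAt_symm c).isOpen_inter_preimage
    (isOpen_extChartAt_target c) hU
  exact measurableSet_inter_preimage_of_continuousOn h2.measurableSet
    (hg.comp ((continuousOn_extChartAt_symm c).mono inter_subset_left) fun y hy => hy.2) hJ

lemma measurableSet_chartPart_of_isClosed {C : Set M} (hC : IsClosed C) (c : M) :
    MeasurableSet (chartPart d C c) := by
  have h1 : chartPart d C c = (extChartAt (𝓡 d) c).target \ chartPart d Cᶜ c := by
    ext y
    simp only [chartPart, mem_inter_iff, mem_preimage, mem_sdiff, mem_compl_iff]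
    tauto
  rw [h1]
  exact (isOpen_extChartAt_target c).measurableSet.diff
    ((continuousOn_extChartAt_symm c).isOpen_inter_preimage
      (isOpen_extChartAt_target c) hC.isOpen_compl).measurableSet

lemma continuousOn_coordValue_wedgePow {d' n : ℕ} {Φ : Euc d' → M} {β : DForm d M 2}
    {X : Type*} [TopologicalSpace X] {φ : X → Euc d'} {s : Set X}
    (h : ∀ v v', ContinuousOn (fun a => coordValue Φ β ![v, v'] (φ a)) s)
    (v : Fin (2 * n) → Euc d') :
    ContinuousOn (fun a => coordValue Φ (fun p => wedgePow n (β p)) v (φ a)) s := by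
  have h1 : ∀ w, coordValue Φ (fun p => wedgePow n (β p)) v w = (2⁻¹ : ℝ) ^ n *
      ∑ σ : Equiv.Perm (Fin (2 * n)), ((Equiv.Perm.sign σ : ℤ) : ℝ) *
        ∏ i, coordValue Φ β ![v (σ (pairFst i)), v (σ (pairSnd i))] w := by
    intro w
    rw [coordValue, wedgePow, wedgeFamily_apply]
    simp only [coordValue_two]
  simp only [h1]
  exact continuousOn_const.mul (continuousOn_finsetSum _ fun σ _ =>
    continuousOn_const.mul (continuousOn_finsetProd _ fun i _ => h _ _))

variable [IsManifold (𝓡 d) ∞ M]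

lemma contDiffOn_coordValue_dFun {x : M → ℝ} (hx : ContMDiff (𝓡 d) 𝓘(ℝ) ∞ x) (c : M) (v : Euc d) :
    ContDiffOn ℝ ∞ (coordValue (extChartAt (𝓡 d) c).symm (dFun d x) ![v])
      (extChartAt (𝓡 d) c).target := by
  have h1 : ContDiffOn ℝ ∞ (fun y => x ((extChartAt (𝓡 d) c).symm y))
      (extChartAt (𝓡 d) c).target := by
    rw [← contMDiffOn_iff_contDiffOn]
    exact hx.comp_contMDiffOn (contMDiffOn_extChartAt_symm (n := ∞) c)
  refine ((h1.fderiv_of_isOpen (m := ∞) (isOpen_extChartAt_target c) (by simp)).clm_apply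
    (contDiffOn_const (c := v))).congr fun y hy => ?_
  rw [coordValue_one, dFun_apply]
  have h2 := mfderiv_comp y ((hx _).mdifferentiableAt (by simp))
    (mdifferentiableAt_extChartAt_symm_of_mem hy)
  rw [mfderiv_eq_fderiv] at h2
  exact (congrArg (fun L : Euc d →L[ℝ] ℝ => L v) h2).symm

variable [T2Space M] [CompactSpace M]

/-- A top degree form which is continuous on a neighbourhood of a closed set is integrable on it. -/
lemma isIntegrableOn_of_isClosed {q : ℕ} {μ : DForm d M d} (hμ : IsVolumeForm μ) (hq : q = d)
    (η : DForm d M q) {C O : Set M} (hC : IsClosed C) (hCO : C ⊆ O)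
    (hη : ∀ c, ContinuousOn (coordValue (extChartAt (𝓡 d) c).symm η
      fun i => EuclideanSpace.single (Fin.cast hq i) 1) (chartPart d O c)) :
    IsIntegrableOn μ C hq η := by
  intro c
  have h1 : ContinuousOn (chartDensity μ hq η c) (chartPart d O c) :=
    (((continuous_chartPartition c).comp_continuousOn (continuousOn_extChartAt_symm c)).mono
      inter_subset_left).mul (((hμ.continuousOn_sign c).mono inter_subset_left).mul (hη c))
  -- The density lives on the image of the support of the partition function within `C`. This is
  -- compact, although the part of the chart over `C` need not be.
  set K : Set (Euc d) := extChartAt (𝓡 d) c '' (tsupport (chartPartition d M c) ∩ C) with hK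
  have hKc : IsCompact K := (((isClosed_tsupport _).inter hC).isCompact).image_of_continuousOn
    ((continuousOn_extChartAt c).mono (inter_subset_left.trans (tsupport_chartPartition_subset c)))
  have hKC : K ⊆ chartPart d C c := by
    rintro _ ⟨p, ⟨hp, hpC⟩, rfl⟩
    have hps := tsupport_chartPartition_subset c hp
    refine ⟨(extChartAt (𝓡 d) c).map_source hps, ?_⟩
    rw [mem_preimage, (extChartAt (𝓡 d) c).left_inv hps]
    exact hpC
  have hKO : K ⊆ chartPart d O c := fun y hy => ⟨(hKC hy).1, hCO (hKC hy).2⟩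
  refine IntegrableOn.of_forall_sdiff_eq_zero ((h1.mono hKO).integrableOn_compact hKc)
    (measurableSet_chartPart_of_isClosed hC c) fun y hy => ?_
  have h0 : chartPartition d M c ((extChartAt (𝓡 d) c).symm y) = 0 :=
    image_eq_zero_of_notMem_tsupport fun h =>
      hy.2 ⟨_, ⟨h, hy.1.2⟩, (extChartAt (𝓡 d) c).right_inv hy.1.1⟩
  rw [chartDensity, h0, zero_mul]

end ChartIntegrability

/-! ### Integration over the part of the tube where `x` lies in `J`. -/

section TubeIntegral

variable {d : ℕ} {M : Type*} [TopologicalSpace M] [ChartedSpace (Euc (d + 1)) M]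
  [IsManifold (𝓡 (d + 1)) ∞ M] [T2Space M] [CompactSpace M]
  {Z : Type*} [TopologicalSpace Z] [ChartedSpace (Euc d) Z] [IsManifold (𝓡 d) ∞ Z]
  [T2Space Z] [CompactSpace Z]
  {x : M → ℝ} {ι : Z → M} {r : ℝ} {T : OpenPartialHomeomorph M (Z × ℝ)}

/-- The weight of the chart at `e` in the integral over `Z`: the partition of unity and the sign of
the orientation. -/
def chartWeight (ν : DForm d Z d) (e : Z) (y : Euc d) : ℝ :=
  chartPartition d Z e ((extChartAt (𝓡 d) e).symm y) *
    (SignType.sign (coordValue (extChartAt (𝓡 d) e).symm ν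
      (fun i => EuclideanSpace.single i 1) y) : ℝ)

/-- The integral of a top degree form over the part `x ∈ J` of a tube. -/
lemma IsTube.integralOn_eq_sum (hT : IsTube (d := d) x ι r T)
    (hx : ContMDiff (𝓡 (d + 1)) 𝓘(ℝ) ∞ x) {μ : DForm (d + 1) M (d + 1)} (hμ : IsVolumeForm μ)
    {ν : DForm d Z d} (hν : IsVolumeForm ν) (hind : IsInducedOrientation x ι μ ν)
    {E : Finset Z} (hE : ∀ p, ∑ e ∈ E, chartPartition d Z e p = 1)
    {q : ℕ} (hq : q = d + 1) (η : DForm (d + 1) M q) {J : Set ℝ} (hJ : MeasurableSet J)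
    (hJr : J ⊆ Ioo (-r) r) (D : Z → ℝ × Euc d → ℝ)
    (hD : ∀ e, ∀ t ∈ J, ∀ y ∈ (extChartAt (𝓡 d) e).target,
      coordValue (tubeParam T e) η (fun i => EuclideanSpace.single (Fin.cast hq i) 1)
        (consEquiv d (t, y)) = D e (t, y))
    (hint : ∀ e, IntegrableOn (fun p : ℝ × Euc d => chartWeight ν e p.2 * D e p)
      (J ×ˢ (extChartAt (𝓡 d) e).target)) :
    IsIntegrableOn μ (T.source ∩ x ⁻¹' J) hq η ∧
    integralOn μ (T.source ∩ x ⁻¹' J) hq η = ∑ e ∈ E,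
      ∫ p in J ×ˢ (extChartAt (𝓡 d) e).target, chartWeight ν e p.2 * D e p := by
  have hset : ∀ e : Z, tubeDomain d r e ∩ tubeParam T e ⁻¹' (T.source ∩ x ⁻¹' J) =
      (consEquiv d).symm ⁻¹' (J ×ˢ (extChartAt (𝓡 d) e).target) := by
    intro e
    ext w
    constructor
    · rintro ⟨hw, hw', hw''⟩
      refine ⟨?_, hw.2⟩
      rw [mem_preimage, hT.x_tubeParam hw] at hw''
      exact hw''
    · intro hw
      have hw' : w ∈ tubeDomain d r e := ⟨hJr hw.1, hw.2⟩
      refine ⟨hw', hT.tubeParam_mem hw', ?_⟩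
      rw [mem_preimage, hT.x_tubeParam hw']
      exact hw.1
  have hJm : ∀ e : Z, MeasurableSet (J ×ˢ (extChartAt (𝓡 d) e).target) := fun e =>
    hJ.prod (isOpen_extChartAt_target e).measurableSet
  have hDm : ∀ e : Z, MeasurableSet (tubeDomain d r e ∩ tubeParam T e ⁻¹' (T.source ∩ x ⁻¹' J)) := by
    intro e
    rw [hset]
    exact (consEquiv d).symm.continuous.measurable (hJm e)
  have hcongr : ∀ e : Z, EqOn (fun w => chartPartition d Z e (T (tubeParam T e w)).1 *
      signedValue (tubeParam T e) μ hq η w)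
      (fun w => (fun p : ℝ × Euc d => chartWeight ν e p.2 * D e p) ((consEquiv d).symm w))
      ((consEquiv d).symm ⁻¹' (J ×ˢ (extChartAt (𝓡 d) e).target)) := by
    intro e w hw
    obtain ⟨⟨t, y⟩, rfl⟩ := (consEquiv d).surjective w
    rw [mem_preimage, (consEquiv d).symm_apply_apply] at hw
    have hw' := consEquiv_mem_tubeDomain.2 ⟨hJr hw.1, hw.2⟩
    simp only [(consEquiv d).symm_apply_apply]
    rw [hT.apply_tubeParam hw', (consEquiv d).symm_apply_apply, signedValue,
      hT.sign_coordValue hx hμ hν hind (hJr hw.1) hw.2, hD e t hw.1 y hw.2, chartWeight, mul_assoc]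
  have hmp := measurePreserving_consEquiv_symm d
  have hme := measurableEmbedding_consEquiv_symm d
  have hint' : ∀ e ∈ E, IntegrableOn (fun w => chartPartition d Z e (T (tubeParam T e w)).1 *
      signedValue (tubeParam T e) μ hq η w)
      (tubeDomain d r e ∩ tubeParam T e ⁻¹' (T.source ∩ x ⁻¹' J)) := by
    intro e _
    have h := hDm e
    rw [hset] at h ⊢
    exact (integrableOn_congr_fun (hcongr e) h).2
      ((hmp.integrableOn_comp_preimage hme).2 (hint e))
  -- The partition of unity used on the tube is the chart partition of `Z` pulled back by `π`; its
  -- weights depend only on the `Z`-coordinates.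
  have key := integralOn_eq_sum_parametrizations E
    (fun e p => chartPartition d Z e (T p).1) (fun e => tubeParam T e) (fun e => tubeDomain d r e)
    (S := T.source ∩ x ⁻¹' J) (fun e => isOpen_tubeDomain r e) (fun e => hT.contMDiffOn_tubeParam e)
    (fun e => hT.injOn_tubeParam e)
    (measurableSet_chartPart_inter_preimage T.open_source hx.continuous.continuousOn hJ) hDm
    (fun p _ => hE _) (fun e p hp hpe => chartPartition_eq_zero fun h =>
      hpe (hT.mem_image_tubeParam hp.1 h)) μ hq η hint'
  refine ⟨key.1, key.2.trans (Finset.sum_congr rfl fun e _ => ?_)⟩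
  have h := hDm e
  rw [hset] at h ⊢
  rw [setIntegral_congr_fun h (hcongr e)]
  exact hmp.setIntegral_preimage_emb hme
    (fun p : ℝ × Euc d => chartWeight ν e p.2 * D e p) _

end TubeIntegral

/-! ### Replacing `β` by its Taylor polynomial inside the wedge product. -/

section WedgeSumEstimates

lemma wedgeSum_expand (m N : ℕ) (A : Fin N → Fin (1 + 2 * m) → ℝ)
    (b : Fin N → Fin (1 + 2 * m) → Fin (1 + 2 * m) → ℝ) (t : ℝ) :
    wedgeSum m (fun p => ∑ i : Fin N, t ^ (i : ℕ) * A i p) (fun _ p q => ∑ j : Fin N, t ^ (j : ℕ) * b j p q) =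
      ∑ j : Fin N, ∑ J : Fin m → Fin N, t ^ ((j : ℕ) + ∑ l, (J l : ℕ)) *
        wedgeSum m (A j) fun l => b (J l) := by
  have h1 : ∀ σ : Equiv.Perm (Fin (1 + 2 * m)),
      (∑ i : Fin N, t ^ (i : ℕ) * A i (σ (Fin.castAdd (2 * m) 0))) * ∏ l : Fin m, ∑ j : Fin N,
        t ^ (j : ℕ) * b j (σ (Fin.natAdd 1 (pairFst l))) (σ (Fin.natAdd 1 (pairSnd l))) =
      ∑ j : Fin N, ∑ J : Fin m → Fin N, t ^ ((j : ℕ) + ∑ l, (J l : ℕ)) *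
        (A j (σ (Fin.castAdd (2 * m) 0)) * ∏ l : Fin m,
          b (J l) (σ (Fin.natAdd 1 (pairFst l))) (σ (Fin.natAdd 1 (pairSnd l)))) := by
    intro σ
    rw [Finset.prod_univ_sum, Fintype.piFinset_univ, Finset.sum_mul]
    refine Finset.sum_congr rfl fun j _ => ?_
    rw [Finset.mul_sum]
    refine Finset.sum_congr rfl fun J _ => ?_
    rw [Finset.prod_mul_distrib, Finset.prod_pow_eq_pow_sum, pow_add]
    ring
  simp only [wedgeSum]
  rw [Finset.sum_congr rfl fun σ _ => by rw [h1 σ, Finset.mul_sum], Finset.sum_comm, Finset.mul_sum]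
  refine Finset.sum_congr rfl fun j _ => ?_
  rw [Finset.sum_congr rfl fun σ _ => Finset.mul_sum _ _ _, Finset.sum_comm, Finset.mul_sum]
  refine Finset.sum_congr rfl fun J _ => ?_
  simp only [Finset.mul_sum]
  refine Finset.sum_congr rfl fun σ _ => ?_
  ring

/-- Telescoping, one factor at a time; `1 ≤ L` lets every power of `L` that occurs be bounded by `L
^ m`. -/
lemma abs_prod_sub_prod_le {m : ℕ} {L δ : ℝ} (hL : 1 ≤ L) (f g : Fin m → ℝ)
    (hf : ∀ i, |f i| ≤ L) (hg : ∀ i, |g i| ≤ L) (h : ∀ i, |f i - g i| ≤ δ) :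
    |∏ i, f i - ∏ i, g i| ≤ m * L ^ m * δ := by
  induction m with
  | zero => simp
  | succ m ih =>
    have hδ : 0 ≤ δ := (abs_nonneg _).trans (h 0)
    have ih' := ih (fun i => f i.castSucc) (fun i => g i.castSucc) (fun i => hf _) (fun i => hg _)
      fun i => h _
    have hfm : |∏ i : Fin m, g i.castSucc| ≤ L ^ m := by
      rw [Finset.abs_prod]
      refine (Finset.prod_le_prod (fun _ _ => abs_nonneg _) fun i _ => hg i.castSucc).trans ?_
      simp
    rw [Fin.prod_univ_castSucc, Fin.prod_univ_castSucc]
    have e : (∏ i : Fin m, f i.castSucc) * f (Fin.last m) -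
        (∏ i : Fin m, g i.castSucc) * g (Fin.last m) =
        (∏ i : Fin m, f i.castSucc - ∏ i : Fin m, g i.castSucc) * f (Fin.last m) +
        (∏ i : Fin m, g i.castSucc) * (f (Fin.last m) - g (Fin.last m)) := by ring
    rw [e]
    refine (abs_add_le _ _).trans ?_
    rw [abs_mul, abs_mul]
    have h1 : |∏ i : Fin m, f i.castSucc - ∏ i : Fin m, g i.castSucc| * |f (Fin.last m)| ≤
        m * L ^ m * δ * L := by
      gcongr
      exact hf _
    have h2 : |∏ i : Fin m, g i.castSucc| * |f (Fin.last m) - g (Fin.last m)| ≤ L ^ m * δ := by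
      gcongr
      exact h _
    have h3 : L ^ m * δ ≤ L ^ m * δ * L := le_mul_of_one_le_right (by positivity) hL
    push_cast
    rw [pow_succ]
    linarith

/-- `wedgeSum` is a polynomial in the entries, hence Lipschitz in `B` on bounded sets, with a
constant depending only on `m` and `L`. -/
lemma exists_wedgeSum_sub_bound (m : ℕ) {L : ℝ} (hL : 1 ≤ L) :
    ∃ C, 0 ≤ C ∧ ∀ (a : Fin (1 + 2 * m) → ℝ)
      (B B' : Fin m → Fin (1 + 2 * m) → Fin (1 + 2 * m) → ℝ) (δ : ℝ), (∀ p, |a p| ≤ L) →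
      (∀ l p q, |B l p q| ≤ L) → (∀ l p q, |B' l p q| ≤ L) →
      (∀ l p q, |B l p q - B' l p q| ≤ δ) → |wedgeSum m a B - wedgeSum m a B'| ≤ C * δ := by
  refine ⟨2⁻¹ ^ m * Fintype.card (Equiv.Perm (Fin (1 + 2 * m))) * (L * (m * L ^ m)),
    by positivity, fun a B B' δ ha hB hB' h => ?_⟩
  rw [wedgeSum, wedgeSum, ← mul_sub, ← Finset.sum_sub_distrib, abs_mul, abs_of_pos (by positivity),
    mul_assoc, mul_assoc]
  refine mul_le_mul_of_nonneg_left ?_ (by positivity)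
  refine (Finset.abs_sum_le_sum_abs _ _).trans ?_
  rw [← Finset.card_univ, ← nsmul_eq_mul]
  refine Finset.sum_le_card_nsmul _ _ _ fun σ _ => ?_
  rw [← mul_sub, ← mul_sub, abs_mul, abs_mul]
  have hs : |((Equiv.Perm.sign σ : ℤ) : ℝ)| = 1 := by
    rcases Int.units_eq_one_or (Equiv.Perm.sign σ) with h | h <;> simp [h]
  rw [hs, one_mul, mul_assoc L]
  have hδ := abs_prod_sub_prod_le hL
    (fun i => B i (σ (Fin.natAdd 1 (pairFst i))) (σ (Fin.natAdd 1 (pairSnd i))))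
    (fun i => B' i (σ (Fin.natAdd 1 (pairFst i))) (σ (Fin.natAdd 1 (pairSnd i))))
    (fun i => hB _ _ _) (fun i => hB' _ _ _) fun i => h _ _ _
  gcongr
  exact ha _

lemma continuousOn_wedgeSum {X : Type*} [TopologicalSpace X] {s : Set X} {m : ℕ}
    {a : Fin (1 + 2 * m) → X → ℝ} {B : Fin m → Fin (1 + 2 * m) → Fin (1 + 2 * m) → X → ℝ}
    (ha : ∀ p, ContinuousOn (a p) s) (hB : ∀ l p q, ContinuousOn (B l p q) s) :
    ContinuousOn (fun y => wedgeSum m (fun p => a p y) fun l p q => B l p q y) s := by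
  unfold wedgeSum
  exact continuousOn_const.mul (continuousOn_finsetSum _ fun σ _ =>
    continuousOn_const.mul ((ha _).mul (continuousOn_finsetProd _ fun i _ => hB _ _ _)))

variable {Y : Type*} [NormedAddCommGroup Y] [NormedSpace ℝ Y]

lemma continuousOn_taylorCoeff {r : ℝ} (hr : 0 < r) {V : Set Y} (hV : IsOpen V) {G : ℝ × Y → ℝ}
    (hG : ContDiffOn ℝ ∞ G (Ioo (-r) r ×ˢ V)) (j : ℕ) :
    ContinuousOn (fun y => (j.factorial : ℝ)⁻¹ * iteratedDeriv j (fun t => G (t, y)) 0) V :=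
  continuousOn_const.mul ((contDiffOn_iteratedDeriv_fst hV hG j).continuousOn.comp
    (by fun_prop : Continuous fun y : Y => ((0 : ℝ), y)).continuousOn
    fun y hy => ⟨⟨neg_lt_zero.2 hr, hr⟩, hy⟩)

lemma abs_le_norm_pi {I : Type*} [Fintype I] (f : I → ℝ) (p : I) : |f p| ≤ ‖f‖ :=
  norm_le_pi_norm f p

lemma abs_le_norm_pi_pi {I I' : Type*} [Fintype I] [Fintype I'] (f : I → I' → ℝ) (p : I) (q : I') :
    |f p q| ≤ ‖f‖ :=
  (norm_le_pi_norm (f p) q).trans (norm_le_pi_norm f p)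

/-- The first slot is already a polynomial in `t`, so only the 2-form entries `G` are approximated.
The Lipschitz bound transfers the error `O(|t|^N)` to the wedge, and multilinearity expands the
polynomial product exactly. Terms of degree at least `N` are kept, so no truncation error arises
from them. -/
lemma exists_wedgeSum_taylor_bound {r ε₀ : ℝ} (h0 : 0 < ε₀) (hε₀ : ε₀ < r) {V K : Set Y}
    (hV : IsOpen V) (hK : IsCompact K) (hKV : K ⊆ V) {m : ℕ} (N : ℕ)
    (A : Fin N → Fin (1 + 2 * m) → Y → ℝ)
    (G : Fin (1 + 2 * m) → Fin (1 + 2 * m) → ℝ × Y → ℝ) (hA : ∀ i p, ContinuousOn (A i p) V)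
    (hG : ∀ p q, ContDiffOn ℝ ∞ (G p q) (Ioo (-r) r ×ˢ V)) :
    ∃ C, 0 ≤ C ∧ ∀ y ∈ K, ∀ t, |t| ≤ ε₀ →
      |wedgeSum m (fun p => ∑ i : Fin N, t ^ (i : ℕ) * A i p y) (fun _ p q => G p q (t, y)) -
        ∑ j : Fin N, ∑ J : Fin m → Fin N, t ^ ((j : ℕ) + ∑ l, (J l : ℕ)) *
          wedgeSum m (fun p => A j p y) (fun l p q => ((J l : ℕ).factorial : ℝ)⁻¹ *
            iteratedDeriv (J l : ℕ) (fun t => G p q (t, y)) 0)| ≤ C * |t| ^ N := by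
  have hr : 0 < r := h0.trans hε₀
  obtain ⟨b, hb⟩ : ∃ b : Fin N → Fin (1 + 2 * m) → Fin (1 + 2 * m) → Y → ℝ, b = fun (j : Fin N) p q y =>
    ((j : ℕ).factorial : ℝ)⁻¹ * iteratedDeriv (j : ℕ) (fun t => G p q (t, y)) 0 := ⟨_, rfl⟩
  have hbc : ∀ j p q, ContinuousOn (b j p q) V := fun j p q => by
    rw [hb]
    exact continuousOn_taylorCoeff hr hV (hG p q) j
  have hIK := (isCompact_Icc (a := -ε₀) (b := ε₀)).prod hK
  have hsub : Icc (-ε₀) ε₀ ×ˢ K ⊆ Ioo (-r) r ×ˢ V :=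
    prod_mono (fun t ht => ⟨by linarith [ht.1], by linarith [ht.2]⟩) hKV
  have hsnd : MapsTo (Prod.snd : ℝ × Y → Y) (Icc (-ε₀) ε₀ ×ˢ K) V := fun a ha => hKV ha.2
  have c1 : ContinuousOn (fun (a : ℝ × Y) p => ∑ i : Fin N, a.1 ^ (i : ℕ) * A i p a.2)
      (Icc (-ε₀) ε₀ ×ˢ K) := continuousOn_pi.2 fun p => continuousOn_finsetSum _ fun i _ =>
    (continuous_fst.pow _).continuousOn.mul ((hA i p).comp continuous_snd.continuousOn hsnd)
  have c2 : ContinuousOn (fun (a : ℝ × Y) p q => G p q a) (Icc (-ε₀) ε₀ ×ˢ K) :=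
    continuousOn_pi.2 fun p => continuousOn_pi.2 fun q => (hG p q).continuousOn.mono hsub
  have c3 : ContinuousOn (fun (a : ℝ × Y) p q => ∑ j : Fin N, a.1 ^ (j : ℕ) * b j p q a.2)
      (Icc (-ε₀) ε₀ ×ˢ K) := continuousOn_pi.2 fun p => continuousOn_pi.2 fun q =>
    continuousOn_finsetSum _ fun j _ =>
      (continuous_fst.pow _).continuousOn.mul ((hbc j p q).comp continuous_snd.continuousOn hsnd)
  obtain ⟨L1, hL1⟩ := hIK.exists_bound_of_continuousOn c1
  obtain ⟨L2, hL2⟩ := hIK.exists_bound_of_continuousOn c2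
  obtain ⟨L3, hL3⟩ := hIK.exists_bound_of_continuousOn c3
  choose Ct hCt0 hCt using fun p q => exists_taylor_bound hε₀ hV hK hKV (hG p q) N
  -- One common bound for all entries, taken at least `1` for the sake of the product estimate.
  set L := max 1 (max L1 (max L2 L3)) with hL
  have hL1' : L1 ≤ L := (le_max_left _ _).trans (le_max_right _ _)
  have hL2' : L2 ≤ L := (le_max_left _ _).trans ((le_max_right _ _).trans (le_max_right _ _))
  have hL3' : L3 ≤ L := (le_max_right _ _).trans ((le_max_right _ _).trans (le_max_right _ _))
  have hL0 : 1 ≤ L := le_max_left _ _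
  set S := ∑ p, ∑ q, Ct p q with hS
  have hS0 : 0 ≤ S := Finset.sum_nonneg fun p _ => Finset.sum_nonneg fun q _ => hCt0 p q
  have hCS : ∀ p q, Ct p q ≤ S := fun p q =>
    (Finset.single_le_sum (f := fun q => Ct p q) (fun q _ => hCt0 p q) (Finset.mem_univ q)).trans
      (Finset.single_le_sum (f := fun p => ∑ q, Ct p q)
        (fun p _ => Finset.sum_nonneg fun q _ => hCt0 p q) (Finset.mem_univ p))
  obtain ⟨Cw, hCw0, hCw⟩ := exists_wedgeSum_sub_bound m hL0
  refine ⟨Cw * S, mul_nonneg hCw0 hS0, fun y hy t ht => ?_⟩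
  have hmem : (t, y) ∈ Icc (-ε₀) ε₀ ×ˢ K := ⟨abs_le.1 ht, hy⟩
  have n1 := (hL1 (t, y) hmem).trans hL1'
  have n2 := (hL2 (t, y) hmem).trans hL2'
  have n3 := (hL3 (t, y) hmem).trans hL3'
  have b1 : ∀ p, |∑ i : Fin N, t ^ (i : ℕ) * A i p y| ≤ L := fun p =>
    (abs_le_norm_pi _ p).trans n1
  have b2 : ∀ p q, |G p q (t, y)| ≤ L := fun p q => (abs_le_norm_pi_pi _ p q).trans n2
  have b3 : ∀ p q, |∑ j : Fin N, t ^ (j : ℕ) * b j p q y| ≤ L := fun p q =>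
    (abs_le_norm_pi_pi _ p q).trans n3
  have b4 : ∀ p q, |G p q (t, y) - ∑ j : Fin N, t ^ (j : ℕ) * b j p q y| ≤ S * |t| ^ N := by
    intro p q
    have h1 := hCt p q y hy t ht
    rw [Finset.sum_range] at h1
    rw [hb]
    exact h1.trans (mul_le_mul_of_nonneg_right (hCS p q) (by positivity))
  have h5 := hCw _ (fun _ p q => G p q (t, y))
    (fun _ p q => ∑ j : Fin N, t ^ (j : ℕ) * b j p q y) _ b1 (fun _ => b2) (fun _ => b3) fun _ => b4
  rw [wedgeSum_expand m N (fun i p => A i p y) (fun j p q => b j p q y) t, ← mul_assoc, hb] at h5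
  exact h5

end WedgeSumEstimates

/-! ### The compactly supported weights of the charts of `Z`. -/

section ChartWeight

variable {d : ℕ} {Z : Type*} [TopologicalSpace Z] [ChartedSpace (Euc d) Z] [IsManifold (𝓡 d) ∞ Z]
  [T2Space Z] [CompactSpace Z]

/-- The support of the weight of the chart at `e`. -/
def weightSupport (d : ℕ) {Z : Type*} [TopologicalSpace Z] [ChartedSpace (Euc d) Z]
    [IsManifold (𝓡 d) ∞ Z] [T2Space Z] [CompactSpace Z] (e : Z) : Set (Euc d) :=
  extChartAt (𝓡 d) e '' tsupport (chartPartition d Z e)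

lemma isCompact_weightSupport (e : Z) : IsCompact (weightSupport d e) :=
  (isClosed_tsupport _).isCompact.image_of_continuousOn
    ((continuousOn_extChartAt e).mono (tsupport_chartPartition_subset e))

lemma weightSupport_subset (e : Z) : weightSupport d e ⊆ (extChartAt (𝓡 d) e).target := by
  rintro _ ⟨p, hp, rfl⟩
  exact (extChartAt (𝓡 d) e).map_source (tsupport_chartPartition_subset e hp)

lemma chartWeight_eq_zero (ν : DForm d Z d) {e : Z} {y : Euc d}
    (hy : y ∈ (extChartAt (𝓡 d) e).target) (hy' : y ∉ weightSupport d e) :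
    chartWeight ν e y = 0 := by
  have h0 : chartPartition d Z e ((extChartAt (𝓡 d) e).symm y) = 0 :=
    image_eq_zero_of_notMem_tsupport fun h =>
      hy' ⟨_, h, (extChartAt (𝓡 d) e).right_inv hy⟩
  rw [chartWeight, h0, zero_mul]

lemma abs_chartWeight_le_one (ν : DForm d Z d) (e : Z) (y : Euc d) : |chartWeight ν e y| ≤ 1 := by
  rw [chartWeight, abs_mul, abs_of_nonneg ((chartPartition d Z).nonneg e _)]
  refine mul_le_one₀ ((chartPartition d Z).le_one e _) (abs_nonneg _) ?_
  generalize SignType.sign (coordValue (extChartAt (𝓡 d) e).symm ν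
      (fun i => EuclideanSpace.single i 1) y) = s
  cases s <;> simp

lemma continuousOn_chartWeight {ν : DForm d Z d} (hν : IsVolumeForm ν) (e : Z) :
    ContinuousOn (chartWeight ν e) (extChartAt (𝓡 d) e).target :=
  ((continuous_chartPartition e).comp_continuousOn (continuousOn_extChartAt_symm e)).mul
    (hν.continuousOn_sign e)

/-- The compact set `J` supplies integrability by continuity, while the integral runs over `J'`,
which may be half-open. -/
lemma integrableOn_chartWeight_mul {ν : DForm d Z d} (hν : IsVolumeForm ν) (e : Z) {J J' : Set ℝ}
    (hJ : IsCompact J) (hJ' : MeasurableSet J') (hJJ : J' ⊆ J) {g : ℝ × Euc d → ℝ}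
    (hg : ContinuousOn g (J ×ˢ (extChartAt (𝓡 d) e).target)) :
    IntegrableOn (fun p : ℝ × Euc d => chartWeight ν e p.2 * g p)
      (J' ×ˢ (extChartAt (𝓡 d) e).target) := by
  have h1 : ContinuousOn (fun p : ℝ × Euc d => chartWeight ν e p.2 * g p)
      (J ×ˢ (extChartAt (𝓡 d) e).target) :=
    ((continuousOn_chartWeight hν e).comp continuous_snd.continuousOn fun p hp => hp.2).mul hg
  refine IntegrableOn.of_forall_sdiff_eq_zero (s := J' ×ˢ weightSupport d e)
    (((h1.mono (prod_mono le_rfl (weightSupport_subset e))).integrableOn_compact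
      (hJ.prod (isCompact_weightSupport e))).mono_set (prod_mono hJJ le_rfl))
    (hJ'.prod (isOpen_extChartAt_target e).measurableSet) fun p hp => ?_
  rw [chartWeight_eq_zero ν hp.1.2 fun h => hp.2 ⟨hp.1.1, h⟩, zero_mul]

/-- A weighted integral over `J' × target` is bounded by the supremum of the integrand over the
support of the weight. -/
lemma abs_setIntegral_chartWeight_le (ν : DForm d Z d) (e : Z) {J' : Set ℝ} {ε₀ B : ℝ}
    (hJ' : MeasurableSet J') (hJε : J' ⊆ Icc (-ε₀) ε₀) (hB : 0 ≤ B) {g : ℝ × Euc d → ℝ}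
    (hg : ∀ t ∈ J', ∀ y ∈ weightSupport d e, |g (t, y)| ≤ B) :
    |∫ p in J' ×ˢ (extChartAt (𝓡 d) e).target, chartWeight ν e p.2 * g p| ≤
      B * volume.real (Icc (-ε₀) ε₀ ×ˢ weightSupport d e) := by
  have hfin : volume (Icc (-ε₀) ε₀ ×ˢ weightSupport d e) < ⊤ :=
    (isCompact_Icc.prod (isCompact_weightSupport e)).measure_lt_top
  have hsub : J' ×ˢ weightSupport d e ⊆ Icc (-ε₀) ε₀ ×ˢ weightSupport d e := prod_mono hJε le_rfl
  have hset := setIntegral_eq_of_subset_of_forall_sdiff_eq_zero (μ := volume)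
    (s := J' ×ˢ weightSupport d e) (f := fun p : ℝ × Euc d => chartWeight ν e p.2 * g p)
    (hJ'.prod (isOpen_extChartAt_target e).measurableSet)
    (prod_mono le_rfl (weightSupport_subset e)) fun p hp => by
      rw [chartWeight_eq_zero ν hp.1.2 fun h => hp.2 ⟨hp.1.1, h⟩, zero_mul]
  rw [hset, ← Real.norm_eq_abs]
  refine (norm_setIntegral_le_of_norm_le_const (C := B) ((measure_mono hsub).trans_lt hfin)
    fun p hp => ?_).trans (mul_le_mul_of_nonneg_left (measureReal_mono hsub hfin.ne) hB)
  rw [Real.norm_eq_abs, abs_mul]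
  calc |chartWeight ν e p.2| * |g p| ≤ 1 * B :=
        mul_le_mul (abs_chartWeight_le_one ν e _) (hg p.1 hp.1 p.2 hp.2) (abs_nonneg _) zero_le_one
    _ = B := one_mul B

end ChartWeight

/-! ### Reduction of the tube integral to integrals over `Z` and over the line. -/

section TubeEstimate

variable {d : ℕ} {M : Type*} [TopologicalSpace M] [ChartedSpace (Euc (d + 1)) M]
  [IsManifold (𝓡 (d + 1)) ∞ M] [T2Space M] [CompactSpace M]
  {Z : Type*} [TopologicalSpace Z] [ChartedSpace (Euc d) Z] [IsManifold (𝓡 d) ∞ Z]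
  [T2Space Z] [CompactSpace Z]
  {x : M → ℝ} {ι : Z → M} {r : ℝ} {T : OpenPartialHomeomorph M (Z × ℝ)}

/-- The form `(s dx ∧ ∑ x^i π^* α_i + β)^n` is integrable over a part `x ∈ J'` of the tube, and the
integral is determined by the integrals `∫_Z α_j ∧ β_J` up to a bounded error. -/
lemma IsTube.exists_integralOn_bound (hT : IsTube (d := d) x ι r T)
    (hx : ContMDiff (𝓡 (d + 1)) 𝓘(ℝ) ∞ x) {μ : DForm (d + 1) M (d + 1)} (hμ : IsVolumeForm μ)
    {ν : DForm d Z d} (hν : IsVolumeForm ν) (hind : IsInducedOrientation x ι μ ν)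
    {n N : ℕ} (hd : d + 1 = 2 * n) {α : Fin N → DForm d Z 1} {β : DForm (d + 1) M 2}
    (hα : ∀ i, IsSmoothOn (α i) univ) (hβ : IsSmoothOn β T.source)
    {ε₀ : ℝ} (h0 : 0 < ε₀) (hε₀ : ε₀ < r) (B : ℝ) (hB : 0 ≤ B) :
    ∃ C, ∀ (J J' : Set ℝ) (s : ℝ → ℝ) (η : DForm (d + 1) M (2 * n)), IsCompact J →
      MeasurableSet J' → J' ⊆ J → J ⊆ Icc (-ε₀) ε₀ → ContinuousOn s J →
      (∀ t ∈ J', |s t| * |t| ^ N ≤ B) →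
      (∀ p ∈ T.source ∩ x ⁻¹' J', η p = wedgePow n
        (s (x p) • wedge (dFun (d + 1) x p) (laurentSum x T α p) + β p)) →
      IsIntegrableOn μ (T.source ∩ x ⁻¹' J') hd.symm η ∧
      |integralOn μ (T.source ∩ x ⁻¹' J') hd.symm η - ∑ j : Fin N, ∑ J : Fin (n - 1) → Fin N,
        n * laurentIntegral hd ν T α β j J * ∫ t in J', s t * t ^ ((j : ℕ) + ∑ l, (J l : ℕ))| ≤ C := by
  have hd' : 1 + 2 * (n - 1) = d := by omega
  obtain ⟨E, hE0, hE1⟩ := exists_finset_chartPartition d Z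
  set A : Z → Fin N → Fin (1 + 2 * (n - 1)) → Euc d → ℝ := fun e i p y =>
    coordValue (extChartAt (𝓡 d) e).symm (α i) ![EuclideanSpace.single (Fin.cast hd' p) 1] y with hA
  set G : Z → Fin (1 + 2 * (n - 1)) → Fin (1 + 2 * (n - 1)) → ℝ × Euc d → ℝ := fun e p p' w =>
    coordValue (tubeParam T e) β ![consEquiv d (0, EuclideanSpace.single (Fin.cast hd' p) 1),
      consEquiv d (0, EuclideanSpace.single (Fin.cast hd' p') 1)] (consEquiv d w) with hG
  set R : Z → ℝ × Euc d → ℝ := fun e w => coordValue (tubeParam T e) (fun p => wedgePow n (β p))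
        (fun i => EuclideanSpace.single (Fin.cast hd.symm i) 1) (consEquiv d w) with hR
  have hAc : ∀ e i p, ContinuousOn (A e i p) (extChartAt (𝓡 d) e).target := by
    intro e i p
    have := (contDiffOn_coordValue_chart isOpen_univ (hα i) e
      ![EuclideanSpace.single (Fin.cast hd' p) 1]).continuousOn
    rwa [chartPart_univ] at this
  have hGs : ∀ e p p', ContDiffOn ℝ ∞ (G e p p') (Ioo (-r) r ×ˢ (extChartAt (𝓡 d) e).target) :=
    fun e p p' => hT.contDiffOn_coordValue_tube hβ e _
  have hRc : ∀ e, ContinuousOn (R e) (Ioo (-r) r ×ˢ (extChartAt (𝓡 d) e).target) := fun e =>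
    continuousOn_coordValue_wedgePow
      (fun v v' => (hT.contDiffOn_coordValue_tube hβ e ![v, v']).continuousOn) _
  set Q : Z → ℝ × Euc d → ℝ := fun e w => wedgeSum (n - 1)
    (fun p => ∑ i : Fin N, w.1 ^ (i : ℕ) * A e i p w.2) (fun _ p p' => G e p p' w) with hQ
  set q : Z → Fin N → (Fin (n - 1) → Fin N) → Euc d → ℝ := fun e j J y =>
    wedgeSum (n - 1) (fun p => A e j p y) (fun l p p' => ((J l : ℕ).factorial : ℝ)⁻¹ *
      iteratedDeriv (J l : ℕ) (fun t => G e p p' (t, y)) 0) with hq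
  have hQc : ∀ e, ContinuousOn (Q e) (Ioo (-r) r ×ˢ (extChartAt (𝓡 d) e).target) := fun e =>
    continuousOn_wedgeSum (fun p => continuousOn_finsetSum _ fun i _ =>
      (continuous_fst.pow _).continuousOn.mul
        ((hAc e i p).comp continuous_snd.continuousOn fun w hw => hw.2))
      fun _ p p' => (hGs e p p').continuousOn
  have hqc : ∀ e j J, ContinuousOn (q e j J) (extChartAt (𝓡 d) e).target := fun e j J =>
    continuousOn_wedgeSum (fun p => hAc e j p) fun l p p' =>
      continuousOn_taylorCoeff (h0.trans hε₀) (isOpen_extChartAt_target e) (hGs e p p') _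
  -- The functions `q` are the coordinate densities of `α_j ∧ β_J`, so that their weighted integrals
  -- assemble to `∫_Z α_j ∧ β_J`.
  have hL : ∀ j J, laurentIntegral hd ν T α β j J =
      ∑ e ∈ E, ∫ y in (extChartAt (𝓡 d) e).target, chartWeight ν e y * q e j J y := by
    intro j J
    rw [laurentIntegral, BSymplectic.integralOn_eq_sum hE0]
    refine Finset.sum_congr rfl fun e _ => ?_
    rw [chartPart_univ]
    refine setIntegral_congr_fun (isOpen_extChartAt_target e).measurableSet fun y hy => ?_
    simp only [chartDensity, signedValue, chartWeight]
    rw [mul_assoc, coordValue_wedge_wedgeFamily hd' (α j) (fun l => taylorCoeff T β (J l))]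
    simp only [hq, hA, hG, hT.coordValue_taylorCoeff hβ _ hy]
    congr 3
    funext l p p'
    congr 3
    funext t
    congr 1
    funext i
    fin_cases i <;> rfl
  choose Cq hCq0 hCq using fun e => exists_wedgeSum_taylor_bound h0 hε₀
    (isOpen_extChartAt_target e) (isCompact_weightSupport e) (weightSupport_subset (d := d) e) N
    (A e) (G e) (hAc e) (hGs e)
  have hIcc : Icc (-ε₀) ε₀ ⊆ Ioo (-r) r := fun t ht => ⟨by linarith [ht.1], by linarith [ht.2]⟩
  choose Cr hCr using fun e => ((isCompact_Icc (a := -ε₀) (b := ε₀)).prod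
    (isCompact_weightSupport e)).exists_bound_of_continuousOn
      ((hRc e).mono (prod_mono hIcc (weightSupport_subset e)))
  -- For each chart: `n · Cq · B` bounds the Taylor remainder times `s`, and `max Cr 0` bounds
  -- `β^n`. Nothing depends on `J`, `J'`, `s` or `η`, so the constant is uniform in `ε` in the
  -- applications.
  refine ⟨∑ e ∈ E, (n * (Cq e * B) + max (Cr e) 0) *
    volume.real (Icc (-ε₀) ε₀ ×ˢ weightSupport d e),
    fun J J' s η hJ hJ' hJJ hJε hs hsB hη => ?_⟩
  have hJr : J' ⊆ Ioo (-r) r := hJJ.trans (hJε.trans hIcc)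
  have hJt : ∀ e : Z, J ×ˢ (extChartAt (𝓡 d) e).target ⊆
      Ioo (-r) r ×ˢ (extChartAt (𝓡 d) e).target := fun e => prod_mono (hJε.trans hIcc) le_rfl
  have hsc : ∀ e : Z, ContinuousOn (fun w : ℝ × Euc d => s w.1)
      (J ×ˢ (extChartAt (𝓡 d) e).target) := fun e =>
    hs.comp continuous_fst.continuousOn fun w hw => hw.1
  have hDc : ∀ e, ContinuousOn (fun w : ℝ × Euc d => n * s w.1 * Q e w + R e w)
      (J ×ˢ (extChartAt (𝓡 d) e).target) := fun e =>
    ((continuousOn_const.mul (hsc e)).mul ((hQc e).mono (hJt e))).add ((hRc e).mono (hJt e))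
  obtain ⟨hint, heq⟩ := hT.integralOn_eq_sum hx hμ hν hind hE1 hd.symm η hJ' hJr
    (fun e w => n * s w.1 * Q e w + R e w) (fun e t ht y hy => by
      have hw := consEquiv_mem_tubeDomain.2 ⟨hJr ht, hy⟩
      have hxp : x (tubeParam T e (consEquiv d (t, y))) = t := by
        rw [hT.x_tubeParam hw, (consEquiv d).symm_apply_apply]
      refine hT.coordValue_wedgePow hx hd hd' α β (s t) η (hJr ht) hy ?_
      rw [hη _ ⟨hT.tubeParam_mem hw, by rw [mem_preimage, hxp]; exact ht⟩, hxp])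
    fun e => integrableOn_chartWeight_mul hν e hJ hJ' hJJ (hDc e)
  refine ⟨hint, ?_⟩
  have hqsc : ∀ e (j : Fin N) (K : Fin (n - 1) → Fin N), ContinuousOn (fun w : ℝ × Euc d =>
      n * (s w.1 * w.1 ^ ((j : ℕ) + ∑ l, (K l : ℕ))) * q e j K w.2)
      (J ×ˢ (extChartAt (𝓡 d) e).target) := fun e j K =>
    (continuousOn_const.mul ((hsc e).mul (continuous_fst.pow _).continuousOn)).mul
      ((hqc e j K).comp continuous_snd.continuousOn fun w hw => hw.2)
  -- Each monomial is a product of a function of `t` and a function on `Z`, so Fubini factors its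
  -- integral.
  have hmain : ∑ j : Fin N, ∑ K : Fin (n - 1) → Fin N,
      n * laurentIntegral hd ν T α β j K * ∫ t in J', s t * t ^ ((j : ℕ) + ∑ l, (K l : ℕ)) =
      ∑ e ∈ E, ∫ w in J' ×ˢ (extChartAt (𝓡 d) e).target, chartWeight ν e w.2 *
        ∑ j : Fin N, ∑ K : Fin (n - 1) → Fin N,
          n * (s w.1 * w.1 ^ ((j : ℕ) + ∑ l, (K l : ℕ))) * q e j K w.2 := by
    have h1 : ∀ e (j : Fin N) (K : Fin (n - 1) → Fin N), ∫ w in J' ×ˢ (extChartAt (𝓡 d) e).target,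
        chartWeight ν e w.2 * (n * (s w.1 * w.1 ^ ((j : ℕ) + ∑ l, (K l : ℕ))) * q e j K w.2) =
        n * (∫ y in (extChartAt (𝓡 d) e).target, chartWeight ν e y * q e j K y) *
          ∫ t in J', s t * t ^ ((j : ℕ) + ∑ l, (K l : ℕ)) := by
      intro e j K
      have h2 := setIntegral_prod_mul (μ := (volume : Measure ℝ)) (ν := (volume : Measure (Euc d)))
        (fun t : ℝ => s t * t ^ ((j : ℕ) + ∑ l, (K l : ℕ)))
        (fun y => n * (chartWeight ν e y * q e j K y)) J' (extChartAt (𝓡 d) e).target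
      rw [integral_const_mul] at h2
      rw [mul_comm _ (∫ t in J', _), ← h2]
      refine integral_congr_ae (Filter.Eventually.of_forall fun w => ?_)
      simp only
      ring
    have h3 : ∀ e, ∫ w in J' ×ˢ (extChartAt (𝓡 d) e).target, chartWeight ν e w.2 *
        ∑ j : Fin N, ∑ K : Fin (n - 1) → Fin N,
          n * (s w.1 * w.1 ^ ((j : ℕ) + ∑ l, (K l : ℕ))) * q e j K w.2 =
        ∑ j : Fin N, ∑ K : Fin (n - 1) → Fin N,
        n * (∫ y in (extChartAt (𝓡 d) e).target, chartWeight ν e y * q e j K y) *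
          ∫ t in J', s t * t ^ ((j : ℕ) + ∑ l, (K l : ℕ)) := by
      intro e
      simp only [Finset.mul_sum]
      rw [integral_finsetSum _ fun j _ => integrable_finsetSum _ fun K _ =>
        integrableOn_chartWeight_mul hν e hJ hJ' hJJ (hqsc e j K)]
      refine Finset.sum_congr rfl fun j _ => ?_
      rw [integral_finsetSum _ fun K _ =>
        integrableOn_chartWeight_mul hν e hJ hJ' hJJ (hqsc e j K)]
      exact Finset.sum_congr rfl fun K _ => h1 e j K
    rw [Finset.sum_congr rfl fun e _ => h3 e]
    symm
    rw [Finset.sum_comm]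
    refine Finset.sum_congr rfl fun j _ => ?_
    rw [Finset.sum_comm]
    refine Finset.sum_congr rfl fun K _ => ?_
    rw [hL, Finset.mul_sum, Finset.sum_mul]
  rw [heq, hmain, ← Finset.sum_sub_distrib]
  refine (Finset.abs_sum_le_sum_abs _ _).trans (Finset.sum_le_sum fun e _ => ?_)
  have hSc : ContinuousOn (fun w : ℝ × Euc d => ∑ j : Fin N, ∑ K : Fin (n - 1) → Fin N,
      n * (s w.1 * w.1 ^ ((j : ℕ) + ∑ l, (K l : ℕ))) * q e j K w.2)
      (J ×ˢ (extChartAt (𝓡 d) e).target) := continuousOn_finsetSum _ fun j _ =>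
    continuousOn_finsetSum _ fun K _ => hqsc e j K
  rw [← integral_sub (integrableOn_chartWeight_mul hν e hJ hJ' hJJ (hDc e))
    (integrableOn_chartWeight_mul hν e hJ hJ' hJJ hSc)]
  simp only [← mul_sub]
  refine abs_setIntegral_chartWeight_le ν e hJ' (hJJ.trans hJε)
    (add_nonneg (mul_nonneg (Nat.cast_nonneg _) (mul_nonneg (hCq0 e) hB)) (le_max_right _ _))
    fun t ht y hy => ?_
  have htε := hJε (hJJ ht)
  have h1 := hCq e y hy t (abs_le.2 htε)
  have h2 : |R e (t, y)| ≤ max (Cr e) 0 := (hCr e (t, y) ⟨htε, hy⟩).trans (le_max_left _ _)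
  have h3 : ∑ j : Fin N, ∑ K : Fin (n - 1) → Fin N,
      n * (s t * t ^ ((j : ℕ) + ∑ l, (K l : ℕ))) * q e j K y =
      n * s t * ∑ j : Fin N, ∑ K : Fin (n - 1) → Fin N,
        t ^ ((j : ℕ) + ∑ l, (K l : ℕ)) * q e j K y := by
    simp only [Finset.mul_sum]
    refine Finset.sum_congr rfl fun j _ => Finset.sum_congr rfl fun K _ => ?_
    ring
  simp only
  rw [h3, add_sub_right_comm, ← mul_sub]
  refine (abs_add_le _ _).trans (add_le_add ?_ h2)
  rw [abs_mul, abs_mul, Nat.abs_cast, mul_assoc]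
  refine mul_le_mul_of_nonneg_left ?_ (Nat.cast_nonneg _)
  -- The pole of `s` is absorbed by the order of vanishing `|t|^N` of the remainder, through the
  -- bound on `|s t| * |t| ^ N`.
  calc |s t| * |Q e (t, y) - ∑ j : Fin N, ∑ K : Fin (n - 1) → Fin N,
        t ^ ((j : ℕ) + ∑ l, (K l : ℕ)) * q e j K y|
      ≤ |s t| * (Cq e * |t| ^ N) := mul_le_mul_of_nonneg_left h1 (abs_nonneg _)
    _ = Cq e * (|s t| * |t| ^ N) := by ring
    _ ≤ Cq e * B := mul_le_mul_of_nonneg_left (hsB t ht) (hCq0 e)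

end TubeEstimate

/-! ### Assembling linear combinations of expansions. -/

section Expansion

lemma wedge_smul_left {V : Type*} [AddCommGroup V] [Module ℝ V] [TopologicalSpace V]
    [IsTopologicalAddGroup V] [ContinuousSMul ℝ V] (c : ℝ) (a b : V [⋀^Fin 1]→L[ℝ] ℝ) :
    wedge (c • a) b = c • wedge a b := by
  ext v
  have e : v = ![v 0, v 1] := by
    ext i
    fin_cases i <;> rfl
  rw [e]
  change wedge (c • a) b ![v 0, v 1] = c * wedge a b ![v 0, v 1]
  rw [wedge_one_one_apply, wedge_one_one_apply]
  simp only [ContinuousAlternatingMap.smul_apply, smul_eq_mul]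
  ring

/-- Linear combinations of the expansions of `g m`. -/
lemma exists_expansion_bound {P Q : Type*} [Fintype P] [Fintype Q] (k : ℕ) (s : ℕ → ℝ)
    (g : ℕ → ℝ → ℝ) {ε₀ : ℝ}
    (hg : ∀ m, ∃ C, ∀ ε, 0 < ε → ε < ε₀ → |g m ε - ∑ i ∈ Finset.Icc 1 k,
      expansionCoeff k s m i * ε ^ (-(2 * (i : ℤ) - 1))| ≤ C)
    (a : ℝ) (m : P → Q → ℕ) (I : P → Q → ℝ) :
    ∃ C, ∀ ε, 0 < ε → ε < ε₀ → |∑ p, ∑ q, a * I p q * g (m p q) ε - ∑ i ∈ Finset.Icc 1 k,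
      (∑ p, ∑ q, a * expansionCoeff k s (m p q) i * I p q) * ε ^ (-(2 * (i : ℤ) - 1))| ≤ C := by
  choose C hC using hg
  refine ⟨∑ p, ∑ q, |a * I p q| * C (m p q), fun ε h0 h1 => ?_⟩
  have h : ∑ i ∈ Finset.Icc 1 k, (∑ p, ∑ q, a * expansionCoeff k s (m p q) i * I p q) *
      ε ^ (-(2 * (i : ℤ) - 1)) = ∑ p, ∑ q, a * I p q * ∑ i ∈ Finset.Icc 1 k,
        expansionCoeff k s (m p q) i * ε ^ (-(2 * (i : ℤ) - 1)) := by
    simp only [Finset.sum_mul, Finset.mul_sum]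
    rw [Finset.sum_comm]
    refine Finset.sum_congr rfl fun p _ => ?_
    rw [Finset.sum_comm]
    refine Finset.sum_congr rfl fun q _ => Finset.sum_congr rfl fun i _ => ?_
    ring
  rw [h, ← Finset.sum_sub_distrib]
  refine (Finset.abs_sum_le_sum_abs _ _).trans (Finset.sum_le_sum fun p _ => ?_)
  rw [← Finset.sum_sub_distrib]
  refine (Finset.abs_sum_le_sum_abs _ _).trans (Finset.sum_le_sum fun q _ => ?_)
  rw [← mul_sub, abs_mul]
  exact mul_le_mul_of_nonneg_left (hC _ ε h0 h1) (abs_nonneg _)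

lemma isBigO_one_of_bound {g : ℝ → ℝ} {ε₀ C : ℝ} (h0 : 0 < ε₀)
    (h : ∀ ε, 0 < ε → ε < ε₀ → |g ε| ≤ C) : g =O[𝓝[>] 0] fun _ => (1 : ℝ) := by
  refine Asymptotics.IsBigO.of_bound C ?_
  filter_upwards [Ioo_mem_nhdsGT h0] with ε hε
  rw [norm_one, mul_one]
  exact h ε hε.1 hε.2

end Expansion

/-! ### Decomposition of `M` and the desingularized form off `U_ε`. -/

section Geometry

variable {d : ℕ} {M : Type*} [TopologicalSpace M] [ChartedSpace (Euc (d + 1)) M]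
  {Z : Type*} [TopologicalSpace Z] [ChartedSpace (Euc d) Z]
  {x : M → ℝ} {ι : Z → M} {r : ℝ} {T : OpenPartialHomeomorph M (Z × ℝ)}

lemma subTube_eq (ε : ℝ) : subTube x T ε = T.source ∩ x ⁻¹' Ioo (-ε) ε := by
  ext p
  rw [subTube, mem_ofPred_eq, abs_lt]
  rfl

lemma compl_subTube_eq_union {ε ε₀ : ℝ} (h : ε ≤ ε₀) :
    (subTube x T ε)ᶜ = (subTube x T ε₀)ᶜ ∪ (T.source ∩ x ⁻¹' shell ε ε₀) := by
  ext p
  simp only [subTube, shell, mem_compl_iff, mem_union, mem_inter_iff, mem_preimage, mem_ofPred_eq]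
  by_cases hp : p ∈ T.source
  · simp only [hp, true_and, not_lt]
    constructor
    · intro h1
      rcases lt_or_ge |x p| ε₀ with h2 | h2
      · exact Or.inr ⟨h1, h2⟩
      · exact Or.inl h2
    · rintro (h1 | h1)
      · exact h.trans h1
      · exact h1.1
  · simp [hp]

lemma disjoint_compl_subTube_shell (ε ε₀ : ℝ) :
    Disjoint (subTube x T ε₀)ᶜ (T.source ∩ x ⁻¹' shell ε ε₀) :=
  Set.disjoint_left.2 fun _ hp hp' => hp ⟨hp'.1, hp'.2.2⟩

lemma isOpen_subTube (hx : Continuous x) (ε : ℝ) : IsOpen (subTube x T ε) := by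
  rw [subTube_eq]
  exact T.open_source.inter (isOpen_Ioo.preimage hx)

lemma IsTube.mem_source_of_eq_zero (hT : IsTube (d := d) x ι r T) (hι : range ι = {p | x p = 0})
    {p : M} (hp : x p = 0) : p ∈ T.source := by
  have h1 : p ∈ range ι := by rw [hι]; exact hp
  obtain ⟨z, rfl⟩ := h1
  rw [← hT.zero_section z]
  exact T.map_target (hT.mem_target.2 ⟨neg_lt_zero.2 hT.pos, hT.pos⟩)

/-- The tube contains `Z` as its zero section, so removing a neighbourhood `|x| < ε` within the tube
removes all zeros of `x`; the singular form can then be integrated over the closed complement. -/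
lemma IsTube.compl_subTube_subset (hT : IsTube (d := d) x ι r T) (hι : range ι = {p | x p = 0})
    {ε : ℝ} (hε : 0 < ε) : (subTube x T ε)ᶜ ⊆ {p | x p ≠ 0} := fun p hp h0 =>
  hp ⟨hT.mem_source_of_eq_zero hι h0, by rw [h0, abs_zero]; exact hε⟩

/-- The global representation `x^{-m} dx ∧ α + β` is used, rather than the Laurent series, since
continuity is needed outside the tube as well. -/
lemma IsBSymplecticForm.continuousOn_coordValue [IsManifold (𝓡 (d + 1)) ∞ M] {m : ℕ}
    {σ : DForm (d + 1) M 2} (hσ : IsBSymplecticForm m x σ)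
    (hx : ContMDiff (𝓡 (d + 1)) 𝓘(ℝ) ∞ x) (c : M) (v v' : Euc (d + 1)) :
    ContinuousOn (coordValue (extChartAt (𝓡 (d + 1)) c).symm σ ![v, v'])
      (chartPart (d + 1) {p | x p ≠ 0} c) := by
  obtain ⟨-, -, α, β, hα, hβ, h, -⟩ := hσ
  set Φ := (extChartAt (𝓡 (d + 1)) c).symm
  have hxc : ContinuousOn (fun y => x (Φ y)) (extChartAt (𝓡 (d + 1)) c).target :=
    hx.continuous.comp_continuousOn (continuousOn_extChartAt_symm c)
  have hα' : ∀ u, ContinuousOn (coordValue Φ α ![u]) (extChartAt (𝓡 (d + 1)) c).target := by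
    intro u
    have := (contDiffOn_coordValue_chart isOpen_univ hα c ![u]).continuousOn
    rwa [chartPart_univ] at this
  have hβ' : ContinuousOn (coordValue Φ β ![v, v']) (extChartAt (𝓡 (d + 1)) c).target := by
    have := (contDiffOn_coordValue_chart isOpen_univ hβ c ![v, v']).continuousOn
    rwa [chartPart_univ] at this
  have hd' : ∀ u, ContinuousOn (coordValue Φ (dFun (d + 1) x) ![u])
      (extChartAt (𝓡 (d + 1)) c).target := fun u => (contDiffOn_coordValue_dFun hx c u).continuousOn
  have hsub : chartPart (d + 1) {p | x p ≠ 0} c ⊆ (extChartAt (𝓡 (d + 1)) c).target :=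
    inter_subset_left
  have h1 : ContinuousOn (fun y => ((x (Φ y)) ^ m)⁻¹ *
      (coordValue Φ (dFun (d + 1) x) ![v] y * coordValue Φ α ![v'] y -
        coordValue Φ (dFun (d + 1) x) ![v'] y * coordValue Φ α ![v] y) + coordValue Φ β ![v, v'] y)
      (chartPart (d + 1) {p | x p ≠ 0} c) := by
    refine ((((hxc.mono hsub).pow m).inv₀ fun y hy => pow_ne_zero m hy.2).mul ?_).add
      (hβ'.mono hsub)
    exact ((((hd' v).mul (hα' v')).sub ((hd' v').mul (hα' v))).mono hsub)
  refine h1.congr fun y hy => ?_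
  simp only [coordValue_two, coordValue_one]
  rw [h _ hy.2]
  rw [← wedge_one_one_apply]
  rfl

lemma dFun_comp (hx : ContMDiff (𝓡 (d + 1)) 𝓘(ℝ) ∞ x) {g : ℝ → ℝ} {g' : ℝ} {p : M}
    (hg : HasDerivAt g g' (x p)) :
    dFun (d + 1) (fun p' => g (x p')) p = g' • dFun (d + 1) x p := by
  have h1 : HasMFDerivAt (𝓡 (d + 1)) 𝓘(ℝ) x p (mfderiv (𝓡 (d + 1)) 𝓘(ℝ) x p) :=
    ((hx p).mdifferentiableAt (by simp)).hasMFDerivAt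
  have h2 := (hg.hasFDerivAt.hasMFDerivAt.comp p h1).mfderiv
  ext v
  have e : v = ![v 0] := by
    ext i
    fin_cases i
    rfl
  rw [e]
  change dFun (d + 1) (fun p' => g (x p')) p ![v 0] = g' * dFun (d + 1) x p ![v 0]
  rw [dFun_apply, dFun_apply]
  change (mfderiv (𝓡 (d + 1)) 𝓘(ℝ) (g ∘ x) p (v 0) : ℝ) = _
  rw [h2]
  exact mul_comm (G := ℝ) (mfderiv (𝓡 (d + 1)) 𝓘(ℝ) x p (v 0)) g'

section Desingularization

variable {k : ℕ} {f : ℝ → ℝ} {σ : DForm (d + 1) M 2} {α : Fin (2 * k) → DForm d Z 1}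
  {β : DForm (d + 1) M 2} {ε : ℝ}

lemma desingularization_of_mem (hx : ContMDiff (𝓡 (d + 1)) 𝓘(ℝ) ∞ x) (hf : IsProfile k f)
    (hk : 1 ≤ k) (hε : 0 < ε) {p : M} (hp : p ∈ T.source) :
    desingularization k f x T σ α β ε p =
      deriv (scaled k f ε) (x p) • wedge (dFun (d + 1) x p) (laurentSum x T α p) + β p := by
  have h := hasDerivAt_scaled hf hk hε (x p)
  rw [desingularization, if_pos hp, dFun_comp hx h.differentiableAt.hasDerivAt]
  exact congrArg (· + β p) (wedge_smul_left (V := Euc (d + 1)) _ _ _)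

/-- Inside the tube this is the agreement of `f_ε'` with `t^{-2k}` for `|t| ≥ ε` combined with the
Laurent decomposition; outside it is the definition. -/
lemma desingularization_eq_self (hx : ContMDiff (𝓡 (d + 1)) 𝓘(ℝ) ∞ x)
    (hL : IsLaurentDecomposition x T σ α β) (hf : IsProfile k f)
    (hk : 1 ≤ k) (hε : 0 < ε) {p : M} (hp : p ∈ (subTube x T ε)ᶜ) :
    desingularization k f x T σ α β ε p = σ p := by
  by_cases hpT : p ∈ T.source
  · have h1 : ε ≤ |x p| := not_lt.1 fun h => hp ⟨hpT, h⟩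
    rw [desingularization_of_mem hx hf hk hε hpT, deriv_scaled_of_le hf hk hε h1,
      hL.eq p hpT (abs_pos.1 (hε.trans_le h1))]
  · rw [desingularization, if_neg hpT]

end Desingularization

end Geometry

/-! ### The two basic expansions. -/

section Asymptotics

variable {d : ℕ} {M : Type*} [TopologicalSpace M] [ChartedSpace (Euc (d + 1)) M]
  [IsManifold (𝓡 (d + 1)) ∞ M] [T2Space M] [CompactSpace M]
  {Z : Type*} [TopologicalSpace Z] [ChartedSpace (Euc d) Z] [IsManifold (𝓡 d) ∞ Z]
  [T2Space Z] [CompactSpace Z]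
  {x : M → ℝ} {ι : Z → M} {r : ℝ} {T : OpenPartialHomeomorph M (Z × ℝ)}
  {μ : DForm (d + 1) M (d + 1)} {ν : DForm d Z d} {n k : ℕ}
  {σ : DForm (d + 1) M 2} {α : Fin (2 * k) → DForm d Z 1} {β : DForm (d + 1) M 2}

lemma IsBSymplecticForm.isIntegrableOn_wedgePow {m : ℕ} (hσ : IsBSymplecticForm m x σ)
    (hx : ContMDiff (𝓡 (d + 1)) 𝓘(ℝ) ∞ x) (hμ : IsVolumeForm μ) (hd : d + 1 = 2 * n) {S : Set M}
    (hS : IsClosed S) (hS0 : S ⊆ {p | x p ≠ 0}) :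
    IsIntegrableOn μ S hd.symm fun p => wedgePow n (σ p) :=
  isIntegrableOn_of_isClosed hμ hd.symm _ hS hS0 fun c =>
    continuousOn_coordValue_wedgePow (φ := fun y => y)
      (fun v v' => hσ.continuousOn_coordValue hx c v v') _

/-- The integral of `ω^n` away from the hypersurface. -/
lemma IsTube.exists_integralOn_compl_bound (hT : IsTube (d := d) x ι r T)
    (hM : IsBManifold (d := d) x ι) (hμ : IsVolumeForm μ)
    (hν : IsVolumeForm ν) (hind : IsInducedOrientation x ι μ ν) (hd : d + 1 = 2 * n)
    (hσ : IsBSymplecticForm (2 * k) x σ) (hL : IsLaurentDecomposition x T σ α β)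
    {ε₀ : ℝ} (h0 : 0 < ε₀) (hε₀ : ε₀ < r) :
    ∃ C, ∀ ε, 0 < ε → ε < ε₀ →
      IsIntegrableOn μ (subTube x T ε)ᶜ hd.symm (fun p => wedgePow n (σ p)) ∧
      |integralOn μ (subTube x T ε)ᶜ hd.symm (fun p => wedgePow n (σ p)) -
        ∑ i ∈ Finset.Icc 1 k, (∑ j : Fin (2 * k), ∑ J : Fin (n - 1) → Fin (2 * k),
          n * expansionCoeff k (fun i => 2 / (2 * i - 1)) ((j : ℕ) + ∑ l, (J l : ℕ)) i *
            laurentIntegral hd ν T α β j J) * ε ^ (-(2 * (i : ℤ) - 1))| ≤ C := by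
  obtain ⟨C, hC⟩ := hT.exists_integralOn_bound hM.smooth hμ hν hind hd hL.smooth_α hL.smooth_β
    h0 hε₀ 1 zero_le_one
  obtain ⟨C', hC'⟩ := exists_expansion_bound k (fun i => 2 / (2 * i - 1))
    (fun m ε => ∫ t in shell ε ε₀, (t ^ (2 * k))⁻¹ * t ^ m) (fun m => exists_shell_bound k m ε₀) n
    (fun (j : Fin (2 * k)) (J : Fin (n - 1) → Fin (2 * k)) => (j : ℕ) + ∑ l, (J l : ℕ))
    (laurentIntegral hd ν T α β)
  -- The integral over the fixed set `M \ U_{ε₀}` does not depend on `ε`, so it goes into the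
  -- constant.
  set K := integralOn μ (subTube x T ε₀)ᶜ hd.symm fun p => wedgePow n (σ p)
  refine ⟨|K| + C + C', fun ε hε hεε => ?_⟩
  have hsub : shell ε ε₀ ⊆ {t : ℝ | ε ≤ |t|} ∩ Icc (-ε₀) ε₀ := fun t ht =>
    ⟨ht.1, abs_le.1 ht.2.le⟩
  -- Here `s(t) = t^{-2k}`, for which `|s(t)| |t|^{2k} = 1`; this is the bound `1` chosen above. The
  -- shell is enlarged to a compact set that still avoids `0`.
  obtain ⟨hi, hb⟩ := hC ({t : ℝ | ε ≤ |t|} ∩ Icc (-ε₀) ε₀) (shell ε ε₀) (fun t => (t ^ (2 * k))⁻¹)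
    (fun p => wedgePow n (σ p))
    (isCompact_Icc.inter_left (isClosed_le continuous_const continuous_abs))
    (measurableSet_shell ε ε₀) hsub inter_subset_right
    ((continuousOn_id.pow _).inv₀ fun t ht => pow_ne_zero _ (abs_pos.1 (hε.trans_le ht.1)))
    (fun t ht => by
      have h1 : 0 < |t| := hε.trans_le ht.1
      rw [abs_inv, abs_pow, inv_mul_cancel₀ (pow_pos h1 _).ne'])
    fun p hp => by rw [hL.eq p hp.1 (abs_pos.1 (hε.trans_le hp.2.1))]
  have hi0 := hσ.isIntegrableOn_wedgePow hM.smooth hμ hd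
    (isOpen_subTube hM.smooth.continuous ε₀).isClosed_compl (hT.compl_subTube_subset hM.range_eq h0)
  rw [compl_subTube_eq_union hεε.le]
  refine ⟨hi0.union hi, ?_⟩
  rw [integralOn_union (disjoint_compl_subTube_shell ε ε₀)
    (measurableSet_chartPart_inter_preimage T.open_source hM.smooth.continuous.continuousOn
      (measurableSet_shell ε ε₀)) hi0 hi]
  have h2 := hC' ε hε hεε
  have h3 := neg_abs_le K
  have h4 := le_abs_self K
  rw [abs_le] at hb h2 ⊢
  constructor <;> linarith

/-- The integral of the desingularized volume near the hypersurface. -/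
lemma IsTube.exists_integralOn_subTube_bound (hT : IsTube (d := d) x ι r T)
    (hx : ContMDiff (𝓡 (d + 1)) 𝓘(ℝ) ∞ x) (hμ : IsVolumeForm μ)
    (hν : IsVolumeForm ν) (hind : IsInducedOrientation x ι μ ν) (hd : d + 1 = 2 * n)
    (hL : IsLaurentDecomposition x T σ α β) {f : ℝ → ℝ} (hf : IsProfile k f) (hk : 1 ≤ k)
    {ε₀ : ℝ} (h0 : 0 < ε₀) (hε₀ : ε₀ < r) :
    ∃ C, ∀ ε, 0 < ε → ε < ε₀ →
      IsIntegrableOn μ (subTube x T ε) hd.symm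
        (fun p => wedgePow n (desingularization k f x T σ α β ε p)) ∧
      |integralOn μ (subTube x T ε) hd.symm
          (fun p => wedgePow n (desingularization k f x T σ α β ε p)) -
        ∑ i ∈ Finset.Icc 1 k, (∑ j : Fin (2 * k), ∑ J : Fin (n - 1) → Fin (2 * k),
          n * expansionCoeff k (fun i => ∫ s in (-1 : ℝ)..1, deriv f s * s ^ (2 * (k - i)))
            ((j : ℕ) + ∑ l, (J l : ℕ)) i *
            laurentIntegral hd ν T α β j J) * ε ^ (-(2 * (i : ℤ) - 1))| ≤ C := by
  obtain ⟨B, hB0, hB⟩ := exists_deriv_scaled_bound hf hk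
  obtain ⟨C, hC⟩ := hT.exists_integralOn_bound hx hμ hν hind hd hL.smooth_α hL.smooth_β
    h0 hε₀ B hB0
  obtain ⟨C', hC'⟩ := exists_expansion_bound k
    (fun i => ∫ s in (-1 : ℝ)..1, deriv f s * s ^ (2 * (k - i)))
    (fun m ε => ∫ t in Ioo (-ε) ε, deriv (scaled k f ε) t * t ^ m)
    (fun m => exists_core_bound hf hk m ε₀) n
    (fun (j : Fin (2 * k)) (J : Fin (n - 1) → Fin (2 * k)) => (j : ℕ) + ∑ l, (J l : ℕ))
    (laurentIntegral hd ν T α β)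
  refine ⟨C + C', fun ε hε hεε => ?_⟩
  obtain ⟨hi, hb⟩ := hC (Icc (-ε) ε) (Ioo (-ε) ε) (deriv (scaled k f ε))
    (fun p => wedgePow n (desingularization k f x T σ α β ε p)) isCompact_Icc measurableSet_Ioo
    Ioo_subset_Icc_self (Icc_subset_Icc (neg_le_neg hεε.le) hεε.le)
    (continuous_deriv_scaled hf hk hε).continuousOn
    (fun t ht => hB ε hε t (abs_le.2 ⟨ht.1.le, ht.2.le⟩))
    fun p hp => by rw [desingularization_of_mem hx hf hk hε hp.1]
  rw [subTube_eq]
  refine ⟨hi, ?_⟩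
  have h2 := hC' ε hε hεε
  rw [abs_le] at hb h2 ⊢
  constructor <;> linarith

end Asymptotics

end BSymplectic

end

/-! ### The main theorem. -/

theorem mainTheorem3 (n k d : ℕ) (hd : d + 1 = 2 * n) (hk : 1 ≤ k) :
    ∃ C : ℕ → Fin (2 * k) → (Fin (n - 1) → Fin (2 * k)) → ℝ,
    ∀ f : ℝ → ℝ, IsProfile k f →
    ∃ A : ℕ → Fin (2 * k) → (Fin (n - 1) → Fin (2 * k)) → ℝ,
    ∀ (M : Type*) [TopologicalSpace M] [ChartedSpace (Euc (d + 1)) M]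
      [IsManifold (𝓡 (d + 1)) ∞ M] [T2Space M] [CompactSpace M]
      (Z : Type*) [TopologicalSpace Z] [ChartedSpace (Euc d) Z]
      [IsManifold (𝓡 d) ∞ Z] [T2Space Z] [CompactSpace Z]
      (x : M → ℝ) (ι : Z → M) (_ : IsBManifold (d := d) x ι)
      (μ : DForm (d + 1) M (d + 1)) (_ : IsVolumeForm μ)
      (ν : DForm d Z d) (_ : IsVolumeForm ν) (_ : IsInducedOrientation x ι μ ν)
      (σ : DForm (d + 1) M 2) (_ : IsBSymplecticForm (2 * k) x σ)
      (r : ℝ) (T : OpenPartialHomeomorph M (Z × ℝ)) (_ : IsTube (d := d) x ι r T)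
      (α : Fin (2 * k) → DForm d Z 1) (β : DForm (d + 1) M 2)
      (_ : IsLaurentDecomposition x T σ α β)
      (a c : ℕ → ℝ)
      (_ : ∀ i, a i = ∑ j, ∑ J, A i j J * laurentIntegral hd ν T α β j J)
      (_ : ∀ i, c i = ∑ j, ∑ J, C i j J * laurentIntegral hd ν T α β j J),
      ((fun ε : ℝ =>
          integralOn μ (subTube x T ε)ᶜ hd.symm (fun p => wedgePow n (σ p))
            - ∑ i ∈ Finset.Icc 1 k, c i * ε ^ (-(2 * (i : ℤ) - 1)))
        =O[𝓝[>] 0] fun _ => (1 : ℝ)) ∧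
      ((fun ε : ℝ =>
          integralOn μ (subTube x T ε) hd.symm
              (fun p => wedgePow n (desingularization k f x T σ α β ε p))
            - ∑ i ∈ Finset.Icc 1 k, a i * ε ^ (-(2 * (i : ℤ) - 1)))
        =O[𝓝[>] 0] fun _ => (1 : ℝ)) ∧
      ((fun ε : ℝ =>
          integralOn μ Set.univ hd.symm
              (fun p => wedgePow n (desingularization k f x T σ α β ε p))
            - ∑ i ∈ Finset.Icc 1 k, (a i + c i) * ε ^ (-(2 * (i : ℤ) - 1)))
        =O[𝓝[>] 0] fun _ => (1 : ℝ)) := by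
  -- The factor `n` comes from the contraction of the `n`-th power. Only multi-indices with `j + |J|
  -- = 2(k - i)` contribute to the coefficient of `ε^{-(2i-1)}`: with `2/(2i-1)` outside `U_ε`, and
  -- with a moment of `f'` on `[-1, 1]` inside.
  refine ⟨fun i j J => n * expansionCoeff k (fun i => 2 / (2 * i - 1)) ((j : ℕ) + ∑ l, (J l : ℕ)) i,
    fun f hf => ⟨fun i j J => n * expansionCoeff k
      (fun i => ∫ s in (-1 : ℝ)..1, deriv f s * s ^ (2 * (k - i))) ((j : ℕ) + ∑ l, (J l : ℕ)) i, ?_⟩⟩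
  intro M _ _ _ _ _ Z _ _ _ _ _ x ι hM μ hμ ν hν hind σ hσ r T hT α β hL a c ha hc
  -- Any `ε₀` strictly between `0` and `r` would do: the estimates need the closed interval `[-ε₀,
  -- ε₀]` to lie inside the range of `x` on the tube.
  have h0 : 0 < r / 2 := half_pos hT.pos
  obtain ⟨C₁, hC₁⟩ := hT.exists_integralOn_compl_bound hM hμ hν hind hd hσ hL h0
    (half_lt_self hT.pos)
  obtain ⟨C₂, hC₂⟩ := hT.exists_integralOn_subTube_bound hM.smooth hμ hν hind hd hL hf hk h0
    (half_lt_self hT.pos)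
  simp only [← hc] at hC₁
  simp only [← ha] at hC₂
  refine ⟨isBigO_one_of_bound h0 fun ε hε hεr => (hC₁ ε hε hεr).2,
    isBigO_one_of_bound h0 fun ε hε hεr => (hC₂ ε hε hεr).2,
    isBigO_one_of_bound (C := C₁ + C₂) h0 fun ε hε hεr => ?_⟩
  obtain ⟨hi₁, hb₁⟩ := hC₁ ε hε hεr
  obtain ⟨hi₂, hb₂⟩ := hC₂ ε hε hεr
  have hopen := isOpen_subTube (T := T) hM.smooth.continuous ε
  have hmeas : ∀ e, MeasurableSet (chartPart (d + 1) (subTube x T ε)ᶜ e) :=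
    measurableSet_chartPart_of_isClosed hopen.isClosed_compl
  -- Off `U_ε` the two volume forms coincide, so the integral over `M` is the sum of the two
  -- integrals already expanded, and their errors add.
  have heq : ∀ p ∈ (subTube x T ε)ᶜ, wedgePow n (σ p) =
      wedgePow n (desingularization k f x T σ α β ε p) := fun p hp => by
    rw [desingularization_eq_self hM.smooth hL hf hk hε hp]
  rw [integralOn_congr hmeas heq] at hb₁
  rw [← union_compl_self (subTube x T ε), union_comm, integralOn_union
    (disjoint_compl_left) (fun e => ?_) (hi₁.congr hmeas heq) hi₂]
  · simp only [add_mul, Finset.sum_add_distrib]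
    rw [abs_le] at hb₁ hb₂ ⊢
    constructor <;> linarith
  · rw [subTube_eq]
    exact measurableSet_chartPart_inter_preimage T.open_source hM.smooth.continuous.continuousOn
      measurableSet_Ioo e
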